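/- Setting. Let $D\ge 1$, $\alpha,b,\gamma>0$, $L>1$, $I=[-L,L]$, let $S\subseteq\mathbb R^D$ be the state space of the regressors and $\mathcal X\subseteq S$ a compact set. Let $\mathcal C(S)$ and $\mathcal C(S\times I)$ be vector spaces of bounded measurable functions on $S$ and on $S\times I$, each with a seminorm $\|\cdot\|$, and put $\|g\|_{\mathcal C}=\|g\|_\infty+\|g\|$. Assume: a function $g\in\mathcal C(S)$, viewed as the function $(x,y)\mapsto g(x)$, belongs to $\mathcal C(S\times I)$ with no larger seminorm; $\|e^{g}\|\le\|e^{g}\|_\infty\|g\|$ for all $g\in\mathcal C(S\times I)$; constants have seminorm $0$; $\|g(x)y\|\le(\|g\|+\|g\|_\infty)|I|$ for all $g\in\mathcal C(S)$; and $\|y\|\le|I|$, where $|I|=2L$ (the functions on the left being in $\mathcal C(S\times I)$). Process. Let $Z_i=(X_i,Y_i)$ be a process with values in $S\times I$ (so $|Y_i|\le L$) that is geometrically $\mathcal C$-mixing or geometrically time-reversed $\mathcal C$-mixing: for every finite nonempty index set $U$ and every index $i$ with $U\subset\{u<i\}$ (respectively $U\subset\{u>i\}$), every integrable $\sigma(Z_u:u\in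 U)$-measurable $F$ and every $g\in\mathcal C(S\times I)$, $$|\mathrm{Cov}(F,g(Z_i))|\le e^{-b\rho^\gamma}\,\|F\|_{L^1}\,\|g\|_{\mathcal C},\qquad \rho=\min_{u\in U}|u-i|.$$ All $(X_i,Y_i)$ have the same joint density $f(x,y)\ge0$ on $\mathbb R^{D+1}$; let $f_X(x)=\int f(x,y)\,dy$. Call $g$ uniformly $\alpha$-Hölder controllable on a set $A$ if there are $c\ge0$ and $r>0$ with $|g(z+v)-g(z)|\le c\|v\|^\alpha$ for all $z\in A$ and all $v$ with $\|v\|<r$ ($z+v$ need not lie in $A$). Assume that $f$ is uniformly $\alpha$-Hölder controllable on $\mathcal X\times\mathbb R$, that $f_X$ is so on $\mathcal X$, and that $\inf_{\mathcal X}f_X>0$. Assume the model $Y_i=m(X_i)+\sigma(X_i)\epsilon_i$ with $E[\epsilon_i\mid X_i]=0$ and $E[\epsilon_i^2\mid X_i]=1$, where on $\mathcal X$ the functions $m$ and $\sigma^2$ are the versions of the conditional mean and the conditional variance of $Y$ given $X=x$ computed from $f$: $m(x)=\int y f(x,y)\,dy/f_X(x)$ and $\sigma^2(x)=\int (y-m(x))^2f(x,y)\,dy/f_X(x)$.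 Estimators. For a kernel $K:\mathbb R^D\to\mathbb R$ and a bandwidth $h=h_N$, with $K_i(x)=K((X_i-x)/h)$ and sums over the first $N$ observations, $$\hat m(x)=\frac{\sum_i K_i(x)Y_i}{\sum_i K_i(x)},\qquad \hat\sigma^2(x)=\frac{\sum_i K_i(x)\,(Y_i-\hat m(X_i))^2}{\sum_i K_i(x)}.$$ Assume that $K$ is non-negative, bounded, Lipschitz continuous and supported in a ball centred at the origin, that $\int\|u\|^\alpha K(u)\,du<\infty$ and $\int K=1$; and that, for the bandwidth in question, there is $\kappa>0$ such that for all large $N$ and all $x\in\mathbb R^D$ the function $K((\cdot-x)/h_N)$ lies in $\mathcal C(S)$ with seminorm at most $N^\kappa$. Theorem. (a) With $h=\big((\log N)^{(\gamma+1)/\gamma}/N\big)^{1/(2\alpha+D)}$, $$\sup_{x\in\mathcal X}|\hat m(x)-m(x)|=O_{a.s.}\Big(\Big(\tfrac{(\log N)^{(\gamma+1)/\gamma}}{N}\Big)^{\alpha/(2\alpha+D)}\Big),$$ and with $h=(\log N/N)^{1/(2\alpha+D)}$, $$\sup_{x\in\mathcal X}|\hat m(x)-m(x)|=O_{p}\Big(\Big(\tfrac{\log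 N}{N}\Big)^{\alpha/(2\alpha+D)}\Big).$$ (b) If in addition $m$ is uniformly $\alpha$-Hölder controllable on $\mathcal X$, then for the same two bandwidths $\sup_{x\in\mathcal X}|\hat\sigma^2(x)-\sigma^2(x)|$ satisfies the same two rates. -/

import Mathlib

open MeasureTheory Filter Set

noncomputable section

/-- A vector space of bounded measurable functions on `T` carrying a seminorm: the data behind
the space `𝒞(T)` and the norm `‖f‖_𝒞 = ‖f‖_∞ + ‖f‖`. -/
structure CSpace (T : Type*) [MeasurableSpace T] where
  carrier : Submodule ℝ (T → ℝ)
  semi : Seminorm ℝ carrier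
  measurable' : ∀ f ∈ carrier, Measurable f
  bounded' : ∀ f ∈ carrier, ∃ C : ℝ, ∀ t, |f t| ≤ C

/-- The supremum norm of a (bounded) function. -/
def supNorm {T : Type*} (f : T → ℝ) : ℝ := ⨆ t, |f t|

namespace CSpace

variable {T : Type*} [MeasurableSpace T]

/-- The norm `‖f‖_𝒞 = ‖f‖_∞ + ‖f‖`. -/
def cNorm (𝒞 : CSpace T) (f : 𝒞.carrier) : ℝ := supNorm (f : T → ℝ) + 𝒞.semi f

/-- `f` belongs to `𝒞(T)` and its seminorm is at most `r`. -/
def SemiLE (𝒞 : CSpace T) (f : T → ℝ) (r : ℝ) : Prop :=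
  ∃ hf : f ∈ 𝒞.carrier, 𝒞.semi ⟨f, hf⟩ ≤ r

end CSpace

/-- Covariance of two real random variables. -/
def covar {Ω : Type*} [MeasurableSpace Ω] (μ : Measure Ω) (f g : Ω → ℝ) : ℝ :=
  ∫ ω, f ω * g ω ∂μ - (∫ ω, f ω ∂μ) * ∫ ω, g ω ∂μ

/-- The covariance inequality of geometrical `𝒞`-mixing of order `e` with parameters `b, γ`, for a
finite index set `U` and an index `i`: for every integrable `f` measurable with respect to
`σ(Z_u : u ∈ U)` and every `g ∈ 𝒞(T)`,
`|Cov(f, g(Z_i))| ≤ exp(-b ρ(U,i)^γ) ‖f‖_{L¹} ‖g‖_𝒞`, where `ρ(U,i) = min_{u ∈ U} |u - i|`. -/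
def GeomCovIneq {Ω T : Type*} [MeasurableSpace Ω] [MeasurableSpace T] (μ : Measure Ω)
    (𝒞 : CSpace T) (b γ : ℝ) (Z : ℕ → Ω → T) (U : Finset ℕ) (i : ℕ) : Prop :=
  ∀ f : Ω → ℝ, Measurable[⨆ u ∈ U, MeasurableSpace.comap (Z u) inferInstance] f →
    Integrable f μ → ∀ g : 𝒞.carrier,
      |covar μ f (fun ω => (g : T → ℝ) (Z i ω))| ≤
        Real.exp (-b * (Metric.infDist i (U : Set ℕ)) ^ γ) * (∫ ω, |f ω| ∂μ) * 𝒞.cNorm g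

/-- Geometrical `𝒞`-mixing of order `e`: the index set lies in the past of `i`. -/
def GeomCMixing {Ω T : Type*} [MeasurableSpace Ω] [MeasurableSpace T] (μ : Measure Ω)
    (𝒞 : CSpace T) (b γ : ℝ) (Z : ℕ → Ω → T) : Prop :=
  ∀ (U : Finset ℕ) (i : ℕ), U.Nonempty → (∀ u ∈ U, u < i) → GeomCovIneq μ 𝒞 b γ Z U i

/-- Geometrical time-reversed `𝒞`-mixing of order `e`: the index set lies in the future of `i`. -/
def GeomCMixingReversed {Ω T : Type*} [MeasurableSpace Ω] [MeasurableSpace T] (μ : Measure Ω)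
    (𝒞 : CSpace T) (b γ : ℝ) (Z : ℕ → Ω → T) : Prop :=
  ∀ (U : Finset ℕ) (i : ℕ), U.Nonempty → (∀ u ∈ U, i < u) → GeomCovIneq μ 𝒞 b γ Z U i

/-- Standing assumptions on the seminorms of `𝒞(S)` and `𝒞(S × I)`, where `I = [-L, L]`. -/
structure SeminormAssumptions {D : ℕ} {S : Set (EuclideanSpace ℝ (Fin D))} {L : ℝ}
    (𝒞S : CSpace S) (𝒞Z : CSpace (S × Icc (-L) L)) : Prop where
  /-- A function on `S` is also a function on `S × I`, with no larger seminorm. -/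
  lift_le : ∀ f : 𝒞S.carrier, 𝒞Z.SemiLE (fun z => (f : S → ℝ) z.1) (𝒞S.semi f)
  /-- `‖e^f‖ ≤ ‖e^f‖_∞ ‖f‖`. -/
  exp_le : ∀ f : 𝒞Z.carrier, 𝒞Z.SemiLE (fun z => Real.exp ((f : S × Icc (-L) L → ℝ) z))
    (supNorm (fun z => Real.exp ((f : S × Icc (-L) L → ℝ) z)) * 𝒞Z.semi f)
  /-- Constant functions have seminorm zero. -/
  const_le : ∀ c : ℝ, 𝒞Z.SemiLE (fun _ => c) 0
  /-- `‖f(x) y‖ ≤ (‖f‖ + ‖f‖_∞) |I|`. -/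
  mul_id_le : ∀ f : 𝒞S.carrier, 𝒞Z.SemiLE (fun z => (f : S → ℝ) z.1 * (z.2 : ℝ))
    ((𝒞S.semi f + supNorm (f : S → ℝ)) * volume.real (Icc (-L) L))
  /-- The coordinate `y` has seminorm at most `|I|`. -/
  id_le : 𝒞Z.SemiLE (fun z => (z.2 : ℝ)) (volume.real (Icc (-L) L))

/-- `g` is `α`-Hölder controllable at every point of `A`, with a constant `c` and a radius `r` that
are uniform over `A`; the increments `v` are not restricted to stay in `A`. -/
def UnifHolderControllableOn {V : Type*} [SeminormedAddCommGroup V] (α : ℝ) (A : Set V)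
    (g : V → ℝ) : Prop :=
  ∃ c r : ℝ, 0 ≤ c ∧ 0 < r ∧ ∀ x ∈ A, ∀ v : V, ‖v‖ < r → |g (x + v) - g x| ≤ c * ‖v‖ ^ α

/-- Marginal density of `X`. -/
def margDensity {E : Type*} (f : E × ℝ → ℝ) (x : E) : ℝ := ∫ y, f (x, y)

/-- `E[Y | X = x]`, computed from the joint density of `(X, Y)`. -/
def condMean {E : Type*} (f : E × ℝ → ℝ) (x : E) : ℝ := (∫ y, y * f (x, y)) / margDensity f x

/-- `Var[Y | X = x]`, computed from the joint density of `(X, Y)`. -/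
def condVar {E : Type*} (f : E × ℝ → ℝ) (x : E) : ℝ :=
  (∫ y, (y - condMean f x) ^ 2 * f (x, y)) / margDensity f x

/-- Conditions K1, K2, K3 on the kernel. -/
structure KernelAssumptions {D : ℕ} (α : ℝ) (K : EuclideanSpace ℝ (Fin D) → ℝ) : Prop where
  nonneg : ∀ u, 0 ≤ K u
  bounded : ∃ B : ℝ, ∀ u, K u ≤ B
  lipschitz : ∃ C, LipschitzWith C K
  moment : Integrable (fun u => ‖u‖ ^ α * K u)
  integral_one : ∫ u, K u = 1
  support_subset : ∃ M : ℝ, 0 < M ∧ Function.support K ⊆ Metric.closedBall 0 M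

/-- Condition K4 for the bandwidth sequence `h`: the functions `K((· - x)/h_N)`, `x ∈ ℝ^D`, belong
to `𝒞(S)` and their seminorms grow at most polynomially in `N`. -/
def KernelSeminormGrowth {D : ℕ} {S : Set (EuclideanSpace ℝ (Fin D))} (𝒞S : CSpace S)
    (K : EuclideanSpace ℝ (Fin D) → ℝ) (h : ℕ → ℝ) : Prop :=
  ∃ κ : ℝ, 0 < κ ∧ ∀ᶠ N : ℕ in atTop, ∀ x : EuclideanSpace ℝ (Fin D),
    𝒞S.SemiLE (fun s => K ((h N)⁻¹ • ((s : EuclideanSpace ℝ (Fin D)) - x))) ((N : ℝ) ^ κ)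

/-- Local constant (Nadaraya–Watson) smoother at `x` of the responses `W_0, …, W_{N-1}` observed
at the design points `X_0, …, X_{N-1}`, with kernel `K` and bandwidth `h`. -/
def nadarayaWatson {E : Type*} [AddCommGroup E] [Module ℝ E] (K : E → ℝ) (h : ℝ) (N : ℕ)
    (X : ℕ → E) (W : ℕ → ℝ) (x : E) : ℝ :=
  (∑ i ∈ Finset.range N, K (h⁻¹ • (X i - x)) * W i) /
    ∑ i ∈ Finset.range N, K (h⁻¹ • (X i - x))

/-- Two-step estimator of the conditional variance: the local constant smoother of the squared
residuals `(Y_i - m̂(X_i))²`. -/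
def residualVariance {E : Type*} [AddCommGroup E] [Module ℝ E] (K : E → ℝ) (h : ℝ) (N : ℕ)
    (X : ℕ → E) (Y : ℕ → ℝ) (x : E) : ℝ :=
  nadarayaWatson K h N X (fun i => (Y i - nadarayaWatson K h N X Y (X i)) ^ 2) x

/-- `sup_{x ∈ A} |err N x| = O_{a.s.}(r N)`, with a deterministic constant. -/
def UnifBigOAS {Ω E : Type*} [MeasurableSpace Ω] (μ : Measure Ω) (A : Set E)
    (err : ℕ → Ω → E → ℝ) (r : ℕ → ℝ) : Prop :=
  ∃ C : ℝ, ∀ᵐ ω ∂μ, ∀ᶠ N : ℕ in atTop, ∀ x ∈ A, |err N ω x| ≤ C * r N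

/-- `sup_{x ∈ A} |err N x| = O_p(r N)`. -/
def UnifBigOP {Ω E : Type*} [MeasurableSpace Ω] (μ : Measure Ω) (A : Set E)
    (err : ℕ → Ω → E → ℝ) (r : ℕ → ℝ) : Prop :=
  ∀ δ : ℝ, 0 < δ → ∃ C : ℝ, ∀ᶠ N : ℕ in atTop,
    μ {ω | ∃ x ∈ A, C * r N < |err N ω x|} ≤ ENNReal.ofReal δ

/-- `((log N)^((γ+1)/γ) / N)^s`. -/
def rateAS (γ s : ℝ) (N : ℕ) : ℝ := (Real.log N ^ ((γ + 1) / γ) / N) ^ s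

/-- `(log N / N)^s`. -/
def rateP (s : ℝ) (N : ℕ) : ℝ := (Real.log N / N) ^ s

end

/-! ### Mixing as a one-sided conditional bound on a finite window -/

section WindowMixing

variable {Ω T : Type*} [MeasurableSpace Ω] [MeasurableSpace T]

/-! Let `M` be a radius of a ball containing the support of `K`. Consider the event that, for all `x
∈ 𝒳`, all `z` within `M h` of `x` and all `j ≤ 2`, the sum of `K((X_i - z)/h) Y_i ^ j` differs from
`N h^D ∫ y^j f(x,y) dy` by at most a constant times `h^α N h^D`. On it both estimators are within
`O(h^α)` of their targets by pure algebra: they are ratios of such sums, and the residuals at `x`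
involve the mean estimator only at points `X_i` within `M h` of `x`. It remains to show that this
event fails with probability `O(N⁻²)`. The bias comes from the Hölder bound on `f`
(`exists_bias_le`); the fluctuations come from a Bernstein inequality and a polynomially fine grid.

Mixing is used only against non-negative weights `F` of the past, where it reads `E[F g(Z_i)] ≤ (E
g(Z_i) + e^{-bρ^γ}‖g‖_𝒞) E F` and replaces a bound on a conditional expectation. The window is cut
into blocks of length `k ≈ N^t`. Within each parity class the exponential moment is peeled off block
by block; the gap `k` makes the mixing error `e^{-bN^{tγ}}` beat every power of `N`, including the
growth of the seminorm of the kernel (`measure_sum_ge_le`).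

Inside a block the lag `ρ` may be small, and `e^{-bρ^γ} N^κ` is useless. The way out is multi-scale
(`exists_past_mean_le_summable`): the kernel at scale `h_N` is dominated by a bump at the coarser
scale `h_{ρ^n}`, whose seminorm is only a power of `ρ` and whose mean is at most of order `ρ⁻²`.
Correlations are thus summable in the lag uniformly in `N`, and the second moment of a block sum is
`O(k h^D)` without logarithmic loss. Chernoff's bound with parameter `h^α` then gives a probability
of order `exp(-q N h^{2α+D}) ≤ N^{-q}` as soon as `log N ≤ N h^{2α+D}`.

Both bandwidths meet this condition, and a failure probability `O(N⁻²)` yields the almost sure rate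
by Borel–Cantelli and the rate in probability at once. -/

/-- The `σ`-algebra generated by the coordinates `Z u`, `u ∈ U`. -/
abbrev coordAlgebra (Z : ℕ → Ω → T) (U : Finset ℕ) : MeasurableSpace Ω :=
  ⨆ u ∈ U, MeasurableSpace.comap (Z u) inferInstance

/-- Bounded non-negative functions of the coordinates `Z u`, `u ∈ U`. -/
structure IsWeight (Z : ℕ → Ω → T) (U : Finset ℕ) (F : Ω → ℝ) : Prop where
  meas : Measurable[coordAlgebra Z U] F
  nonneg : ∀ ω, 0 ≤ F ω
  bdd : ∃ C, ∀ ω, F ω ≤ C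

/-- The covariance inequality of geometrical `𝒞`-mixing for the first `N` observations, tested
against weights depending on coordinates that precede `i` by a gap of at least `ρ`. -/
def WindowMixing (μ : Measure Ω) (𝒞 : CSpace T) (b γ : ℝ) (Z : ℕ → Ω → T) (N : ℕ) : Prop :=
  ∀ (U : Finset ℕ) (i ρ : ℕ), i < N → 0 < ρ → (∀ u ∈ U, u + ρ ≤ i) →
    ∀ F, IsWeight Z U F → ∀ g : 𝒞.carrier,
      |∫ ω, F ω * (g : T → ℝ) (Z i ω) ∂μ - (∫ ω, F ω ∂μ) * ∫ ω, (g : T → ℝ) (Z i ω) ∂μ| ≤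
        Real.exp (-b * (ρ : ℝ) ^ γ) * (∫ ω, F ω ∂μ) * 𝒞.cNorm g

lemma supNorm_nonneg {T : Type*} (f : T → ℝ) : 0 ≤ supNorm f :=
  Real.iSup_nonneg fun _ => abs_nonneg _

lemma CSpace.cNorm_nonneg (𝒞 : CSpace T) (f : 𝒞.carrier) : 0 ≤ 𝒞.cNorm f :=
  add_nonneg (supNorm_nonneg _) (apply_nonneg _ _)

lemma coordAlgebra_le {Z : ℕ → Ω → T} (hZ : ∀ i, Measurable (Z i)) (U : Finset ℕ) :
    coordAlgebra Z U ≤ (inferInstance : MeasurableSpace Ω) :=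
  iSup₂_le fun u _ => (hZ u).comap_le

omit [MeasurableSpace Ω] in
lemma coordAlgebra_mono {Z : ℕ → Ω → T} {U V : Finset ℕ} (h : U ⊆ V) :
    coordAlgebra Z U ≤ coordAlgebra Z V :=
  biSup_mono fun _ hu => h hu

omit [MeasurableSpace Ω] in
lemma measurable_coordAlgebra {Z : ℕ → Ω → T} {U : Finset ℕ} {u : ℕ} (hu : u ∈ U) :
    Measurable[coordAlgebra Z U] (Z u) :=
  Measurable.mono (comap_measurable (Z u))
    (le_iSup₂ (f := fun u (_ : u ∈ U) => MeasurableSpace.comap (Z u) inferInstance) u hu) le_rfl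

namespace IsWeight

variable {Z : ℕ → Ω → T} {U V : Finset ℕ} {F : Ω → ℝ}

lemma measurable (hF : IsWeight Z U F) (hZ : ∀ i, Measurable (Z i)) : Measurable F :=
  hF.meas.mono (coordAlgebra_le hZ U) le_rfl

omit [MeasurableSpace Ω] in
lemma mono (hF : IsWeight Z U F) (h : U ⊆ V) : IsWeight Z V F :=
  ⟨hF.meas.mono (coordAlgebra_mono h) le_rfl, hF.nonneg, hF.bdd⟩

lemma integrable {μ : Measure Ω} [IsFiniteMeasure μ] (hF : IsWeight Z U F)
    (hZ : ∀ i, Measurable (Z i)) : Integrable F μ := by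
  obtain ⟨C, hC⟩ := hF.bdd
  exact Integrable.of_bound (hF.measurable hZ).aestronglyMeasurable C
    (ae_of_all _ fun ω => by rw [Real.norm_eq_abs, abs_of_nonneg (hF.nonneg ω)]; exact hC ω)

lemma integrable_mul {μ : Measure Ω} [IsFiniteMeasure μ] (hF : IsWeight Z U F)
    (hZ : ∀ i, Measurable (Z i)) {G : Ω → ℝ} (hG : Measurable G) {B : ℝ}
    (hB : ∀ ω, |G ω| ≤ B) : Integrable (fun ω => F ω * G ω) μ := by
  simp_rw [mul_comm (F _)]
  exact (hF.integrable hZ).bdd_mul hG.aestronglyMeasurable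
    (ae_of_all _ fun ω => by simpa using hB ω)

lemma integral_nonneg {μ : Measure Ω} (hF : IsWeight Z U F) : 0 ≤ ∫ ω, F ω ∂μ :=
  MeasureTheory.integral_nonneg hF.nonneg

omit [MeasurableSpace Ω] in
lemma mul (hF : IsWeight Z U F) {G : Ω → ℝ} (hG : IsWeight Z U G) :
    IsWeight Z U fun ω => F ω * G ω := by
  refine ⟨hF.meas.mul hG.meas, fun ω => mul_nonneg (hF.nonneg ω) (hG.nonneg ω), ?_⟩
  obtain ⟨C, hC⟩ := hF.bdd
  obtain ⟨C', hC'⟩ := hG.bdd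
  exact ⟨C * C', fun ω => mul_le_mul (hC ω) (hC' ω) (hG.nonneg ω) ((hF.nonneg ω).trans (hC ω))⟩

omit [MeasurableSpace Ω] in
lemma comp {ψ : T → ℝ} (hψ : Measurable ψ) (h0 : ∀ t, 0 ≤ ψ t) {B : ℝ} (hB : ∀ t, ψ t ≤ B)
    {u : ℕ} (hu : u ∈ U) : IsWeight Z U fun ω => ψ (Z u ω) :=
  ⟨hψ.comp (measurable_coordAlgebra hu), fun _ => h0 _, B, fun _ => hB _⟩

end IsWeight

/-- Common source for the two kinds of mixing: a re-enumeration `τ` of the window that preserves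
distances transports the covariance inequality. A gap of `ρ` bounds `infDist` from below, so the
exponential can only grow when the distance is replaced by `ρ`. -/
lemma windowMixing_of_gap {μ : Measure Ω} [IsProbabilityMeasure μ] {𝒞 : CSpace T} {b γ : ℝ}
    (hb : 0 < b) (hγ : 0 < γ) {Z Z' : ℕ → Ω → T} (hZ : ∀ i, Measurable (Z i)) {N : ℕ}
    (τ : ℕ → ℕ) (hZ' : ∀ i, Z' i = Z (τ i))
    (hτ : ∀ u i, u < N → i < N → dist (τ u) (τ i) = dist u i)
    (h : ∀ (U : Finset ℕ) (i : ℕ), i < N → U.Nonempty → (∀ u ∈ U, u < i) →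
      GeomCovIneq μ 𝒞 b γ Z (U.image τ) (τ i)) :
    WindowMixing μ 𝒞 b γ Z' N := by
  intro U i ρ hi hρ hU F hF g
  have hZm : ∀ i, Measurable (Z' i) := fun i => by rw [hZ' i]; exact hZ _
  rcases U.eq_empty_or_nonempty with rfl | hne
  -- With no past, `F` is measurable for the trivial `σ`-algebra, hence constant, and the covariance
  -- vanishes.
  · have : ∃ c, F = fun _ => c := by
      have := hF.meas
      have hbot : coordAlgebra Z' ∅ = ⊥ := by simp [coordAlgebra]
      rw [hbot] at this
      exact eq_const_of_measurable_bot this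
    obtain ⟨c, rfl⟩ := this
    rw [integral_const_mul, integral_const]
    simp only [probReal_univ, smul_eq_mul, one_mul, sub_self, abs_zero]
    refine mul_nonneg (mul_nonneg (Real.exp_pos _).le ?_) (𝒞.cNorm_nonneg g)
    obtain ⟨ω⟩ : Nonempty Ω := nonempty_of_isProbabilityMeasure μ
    exact hF.nonneg ω
  have hlt : ∀ u ∈ U, u < i := fun u hu => by have := hU u hu; omega
  have hmeas : Measurable[⨆ u ∈ U.image τ, MeasurableSpace.comap (Z u) inferInstance] F := by
    have e : (⨆ u ∈ U.image τ, MeasurableSpace.comap (Z u) inferInstance) =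
        coordAlgebra Z' U := by
      rw [Finset.iSup_finset_image, show Z' = fun i => Z (τ i) from funext hZ']
    rw [e]
    exact hF.meas
  have key := h U i hi hne hlt F hmeas (hF.integrable hZm) g
  simp only [covar, ← hZ'] at key
  refine key.trans ?_
  have habs : ∫ ω, |F ω| ∂μ = ∫ ω, F ω ∂μ := by
    congr 1; ext ω; exact abs_of_nonneg (hF.nonneg ω)
  rw [habs]
  refine mul_le_mul_of_nonneg_right (mul_le_mul_of_nonneg_right (Real.exp_le_exp.2 ?_)
    hF.integral_nonneg) (𝒞.cNorm_nonneg g)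
  have : (ρ : ℝ) ≤ Metric.infDist (τ i) ((U.image τ : Finset ℕ) : Set ℕ) := by
    refine (Metric.le_infDist (by simpa using hne)).2 ?_
    intro y hy
    simp only [Finset.coe_image, Set.mem_image, Finset.mem_coe] at hy
    obtain ⟨u, hu, rfl⟩ := hy
    rw [dist_comm, hτ u i ((hlt u hu).trans hi) hi, Nat.dist_eq, abs_sub_comm]
    have h1 : (u : ℝ) + ρ ≤ i := by exact_mod_cast hU u hu
    exact (by linarith : (ρ : ℝ) ≤ i - u).trans (le_abs_self _)
  have := Real.rpow_le_rpow (Nat.cast_nonneg ρ) this hγ.le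
  nlinarith

lemma GeomCMixing.windowMixing {μ : Measure Ω} [IsProbabilityMeasure μ] {𝒞 : CSpace T} {b γ : ℝ}
    (hb : 0 < b) (hγ : 0 < γ) {Z : ℕ → Ω → T} (hZ : ∀ i, Measurable (Z i))
    (h : GeomCMixing μ 𝒞 b γ Z) (N : ℕ) : WindowMixing μ 𝒞 b γ Z N :=
  windowMixing_of_gap hb hγ hZ id (fun _ => rfl) (fun _ _ _ _ => rfl) fun U i _ hU hlt => by
    simpa using h U i hU hlt

/-- Reflecting the window exchanges past and future. The reflection depends on `N`, which is why
mixing is formulated for one finite window at a time; sums over the window do not change. -/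
lemma GeomCMixingReversed.windowMixing {μ : Measure Ω} [IsProbabilityMeasure μ] {𝒞 : CSpace T}
    {b γ : ℝ} (hb : 0 < b) (hγ : 0 < γ) {Z : ℕ → Ω → T} (hZ : ∀ i, Measurable (Z i))
    (h : GeomCMixingReversed μ 𝒞 b γ Z) (N : ℕ) :
    WindowMixing μ 𝒞 b γ (fun i => Z (N - 1 - i)) N := by
  refine windowMixing_of_gap hb hγ hZ (fun i => N - 1 - i) (fun _ => rfl) ?_ ?_
  · intro u i hu hi
    have hu' : ((N - 1 - u : ℕ) : ℝ) = N - 1 - u := by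
      rw [Nat.sub_sub, Nat.cast_sub (by omega)]; push_cast; ring
    have hi' : ((N - 1 - i : ℕ) : ℝ) = N - 1 - i := by
      rw [Nat.sub_sub, Nat.cast_sub (by omega)]; push_cast; ring
    rw [Nat.dist_eq, Nat.dist_eq, hu', hi', abs_sub_comm]
    congr 1; ring
  · intro U i hi hU hlt
    refine h _ _ (hU.image _) fun u hu => ?_
    obtain ⟨v, hv, rfl⟩ := Finset.mem_image.1 hu
    have := hlt v hv
    omega

end WindowMixing

/-! ### A Bernstein inequality by alternating blocks -/

section BlockBernstein

variable {Ω T : Type*} [MeasurableSpace Ω] [MeasurableSpace T]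

/-- Each distance to `i` is attained at most once on either side of `i`, whence the factor 2. -/
lemma sum_natDist_le {w : ℕ → ℝ} (hw : ∀ d, 0 ≤ w d) {k : ℕ} (J : Finset ℕ) (i : ℕ)
    (hJ : ∀ j ∈ J, Nat.dist i j < k) :
    ∑ j ∈ J, w (Nat.dist i j) ≤ 2 * ∑ d ∈ Finset.range k, w d := by
  have key : ∀ J' : Finset ℕ, J' ⊆ J → Set.InjOn (fun j => Nat.dist i j) (J' : Set ℕ) →
      ∑ j ∈ J', w (Nat.dist i j) ≤ ∑ d ∈ Finset.range k, w d := by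
    intro J' hJ' hinj
    rw [← Finset.sum_image (f := w) (g := fun j => Nat.dist i j) hinj]
    refine Finset.sum_le_sum_of_subset_of_nonneg ?_ fun d _ _ => hw d
    intro d hd
    obtain ⟨j, hj, rfl⟩ := Finset.mem_image.1 hd
    exact Finset.mem_range.2 (hJ j (hJ' hj))
  rw [← Finset.sum_filter_add_sum_filter_not J (fun j => j ≤ i), two_mul]
  refine add_le_add (key _ (Finset.filter_subset _ _) ?_) (key _ (Finset.filter_subset _ _) ?_)
  · intro a ha c hc h
    simp only [Finset.coe_filter, Set.mem_ofPred_eq, Nat.dist] at ha hc h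
    omega
  · intro a ha c hc h
    simp only [Finset.coe_filter, Set.mem_ofPred_eq, Nat.dist] at ha hc h
    omega

/-- Bounds on single-time expectations given the past, from which the moment generating function
of a sum over the window `{0, …, N-1}` is estimated block by block, with blocks of length `k`. -/
structure PastBounds (μ : Measure Ω) (Z : ℕ → Ω → T) (N k : ℕ) (φ ψ : T → ℝ)
    (a B P η : ℝ) (w : ℕ → ℝ) : Prop where
  meas : Measurable φ
  meas_major : Measurable ψ
  abs_le : ∀ t, |φ t| ≤ ψ t
  major_le : ∀ t, ψ t ≤ B
  mean_le : ∀ (U : Finset ℕ) (i : ℕ), i < N → (∀ u ∈ U, u + k ≤ i) → ∀ F, IsWeight Z U F →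
    ∫ ω, F ω * φ (Z i ω) ∂μ ≤ (a + η) * ∫ ω, F ω ∂μ
  integral_major_le : ∀ (U : Finset ℕ) (i : ℕ), i < N → (∀ u ∈ U, u + k ≤ i) →
    ∀ F, IsWeight Z U F → ∫ ω, F ω * ψ (Z i ω) ∂μ ≤ P * ∫ ω, F ω ∂μ
  integral_major_le_gap : ∀ (U : Finset ℕ) (i ρ : ℕ), i < N → 0 < ρ → (∀ u ∈ U, u + ρ ≤ i) →
    ∀ F, IsWeight Z U F → ∫ ω, F ω * ψ (Z i ω) ∂μ ≤ w ρ * ∫ ω, F ω ∂μ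
  weight_nonneg : ∀ d, 0 ≤ w d
  le_weight : B ≤ w 0
  abs_mean_le : |a| ≤ P
  err_nonneg : 0 ≤ η

namespace PastBounds

variable {μ : Measure Ω} [IsProbabilityMeasure μ] {Z : ℕ → Ω → T} {N k : ℕ} {φ ψ : T → ℝ}
  {a B P η : ℝ} {w : ℕ → ℝ}

omit [IsProbabilityMeasure μ] in
lemma major_nonneg (h : PastBounds μ Z N k φ ψ a B P η w) (t : T) : 0 ≤ ψ t :=
  (abs_nonneg _).trans (h.abs_le t)

omit [IsProbabilityMeasure μ] in
lemma P_nonneg (h : PastBounds μ Z N k φ ψ a B P η w) : 0 ≤ P :=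
  (abs_nonneg _).trans h.abs_mean_le

omit [IsProbabilityMeasure μ] in
lemma abs_major_le (h : PastBounds μ Z N k φ ψ a B P η w) (t : T) : |ψ t| ≤ B := by
  rw [abs_of_nonneg (h.major_nonneg t)]; exact h.major_le t

/-- Two-step conditioning: the factor at the earlier time is absorbed into the weight, the later one
is removed at cost `w` of the lag, and the earlier one is then removed at cost `P`. One factor is
thus paid at the rate of the mean, the other only at a rate summable in the lag. -/
lemma integral_pair_le (h : PastBounds μ Z N k φ ψ a B P η w) (hZ : ∀ i, Measurable (Z i))
    {U : Finset ℕ} {i j : ℕ} (hi : i < N) (hj : j < N) (hUi : ∀ u ∈ U, u + k ≤ i)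
    (hUj : ∀ u ∈ U, u + k ≤ j) {F : Ω → ℝ} (hF : IsWeight Z U F) :
    ∫ ω, F ω * (ψ (Z i ω) * ψ (Z j ω)) ∂μ ≤ P * w (Nat.dist i j) * ∫ ω, F ω ∂μ := by
  wlog hij : i ≤ j generalizing i j
  · rw [Nat.dist_comm]
    simp_rw [mul_comm (ψ (Z i _))]
    exact this hj hi hUj hUi (le_of_not_ge hij)
  rcases hij.eq_or_lt with rfl | hlt
  -- On the diagonal there is no gap to exploit: one factor is bounded by `B`, so `w 0` has to
  -- dominate `B`.
  · rw [Nat.dist_self]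
    calc ∫ ω, F ω * (ψ (Z i ω) * ψ (Z i ω)) ∂μ ≤ ∫ ω, B * (F ω * ψ (Z i ω)) ∂μ := by
          refine integral_mono ?_ ?_ fun ω => ?_
          · refine hF.integrable_mul hZ (((h.meas_major.comp (hZ i)).mul
              (h.meas_major.comp (hZ i)))) (B := B * B) fun ω => ?_
            rw [abs_mul]
            exact mul_le_mul (h.abs_major_le _) (h.abs_major_le _) (abs_nonneg _)
              ((abs_nonneg _).trans (h.abs_major_le (Z i ω)))
          · exact (hF.integrable_mul hZ (h.meas_major.comp (hZ i))
              fun ω => h.abs_major_le _).const_mul B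
          · have h1 := hF.nonneg ω
            have h2 := h.major_nonneg (Z i ω)
            have h3 := h.major_le (Z i ω)
            nlinarith [mul_nonneg h1 h2, mul_nonneg (mul_nonneg h1 h2) (sub_nonneg.2 h3)]
      _ = B * ∫ ω, F ω * ψ (Z i ω) ∂μ := integral_const_mul _ _
      _ ≤ w 0 * (P * ∫ ω, F ω ∂μ) := by
          refine mul_le_mul h.le_weight (h.integral_major_le U i hi hUi F hF) ?_
            (h.weight_nonneg 0)
          exact integral_nonneg fun ω => mul_nonneg (hF.nonneg ω) (h.major_nonneg _)
      _ = _ := by ring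
  · have hG : IsWeight Z (insert i U) fun ω => F ω * ψ (Z i ω) :=
      (hF.mono (Finset.subset_insert _ _)).mul
        (IsWeight.comp h.meas_major h.major_nonneg h.major_le (Finset.mem_insert_self _ _))
    have hd : Nat.dist i j = j - i := Nat.dist_eq_sub_of_le hij
    rw [hd]
    have hgap : ∀ u ∈ insert i U, u + (j - i) ≤ j := by
      intro u hu
      rcases Finset.mem_insert.1 hu with rfl | hu
      · omega
      · have := hUi u hu
        omega
    calc ∫ ω, F ω * (ψ (Z i ω) * ψ (Z j ω)) ∂μ = ∫ ω, F ω * ψ (Z i ω) * ψ (Z j ω) ∂μ := by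
          simp_rw [mul_assoc]
      _ ≤ w (j - i) * ∫ ω, F ω * ψ (Z i ω) ∂μ :=
          h.integral_major_le_gap _ j _ hj (by omega) hgap _ hG
      _ ≤ w (j - i) * (P * ∫ ω, F ω ∂μ) :=
          mul_le_mul_of_nonneg_left (h.integral_major_le U i hi hUi F hF) (h.weight_nonneg _)
      _ = _ := by ring

/-- The exponential moment of the centred sum over one block, given the distant past. -/
lemma integral_exp_block_le (h : PastBounds μ Z N k φ ψ a B P η w) (hZ : ∀ i, Measurable (Z i))
    {U J : Finset ℕ} (hJN : ∀ j ∈ J, j < N) (hJk : J.card ≤ k)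
    (hJd : ∀ i ∈ J, ∀ j ∈ J, Nat.dist i j < k) (hUJ : ∀ u ∈ U, ∀ j ∈ J, u + k ≤ j)
    {l Q : ℝ} (hl : 0 ≤ l) (hlk : l * (k * (B + P)) ≤ 1)
    (hQ : ∑ d ∈ Finset.range k, w d ≤ Q) {F : Ω → ℝ} (hF : IsWeight Z U F) :
    ∫ ω, F ω * Real.exp (l * ∑ i ∈ J, (φ (Z i ω) - a)) ∂μ ≤
      (1 + l * (k * η) + l ^ 2 * (4 * k * P * Q + 2 * (k * P) ^ 2)) * ∫ ω, F ω ∂μ := by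
  have hP := h.P_nonneg
  have hJk' : (J.card : ℝ) ≤ k := by exact_mod_cast hJk
  have hIF := hF.integrable (μ := μ) hZ
  have hF0 := hF.integral_nonneg (μ := μ)
  have hφm : ∀ i, Measurable fun ω => φ (Z i ω) := fun i => h.meas.comp (hZ i)
  have hψm : ∀ i, Measurable fun ω => ψ (Z i ω) := fun i => h.meas_major.comp (hZ i)
  have hφB : ∀ i ω, |φ (Z i ω)| ≤ B := fun i ω => (h.abs_le _).trans (h.major_le _)
  have hterm : ∀ i ω, |φ (Z i ω) - a| ≤ ψ (Z i ω) + P := fun i ω =>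
    (abs_sub _ _).trans (add_le_add (h.abs_le _) h.abs_mean_le)
  have habs : ∀ ω, |∑ i ∈ J, (φ (Z i ω) - a)| ≤ ∑ i ∈ J, ψ (Z i ω) + k * P := by
    intro ω
    calc |∑ i ∈ J, (φ (Z i ω) - a)| ≤ ∑ i ∈ J, (ψ (Z i ω) + P) :=
          (Finset.abs_sum_le_sum_abs _ _).trans (Finset.sum_le_sum fun i _ => hterm i ω)
      _ = ∑ i ∈ J, ψ (Z i ω) + J.card * P := by
          rw [Finset.sum_add_distrib, Finset.sum_const, nsmul_eq_mul]
      _ ≤ _ := by gcongr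
  have hB0 : ∀ ω, ∑ i ∈ J, ψ (Z i ω) ≤ k * B := by
    intro ω
    have hB : 0 ≤ B := (abs_nonneg _).trans (hφB 0 ω)
    calc ∑ i ∈ J, ψ (Z i ω) ≤ J.card * B := by
          rw [← nsmul_eq_mul]; exact Finset.sum_le_card_nsmul _ _ _ fun i _ => h.major_le _
      _ ≤ _ := by gcongr
  have hbound : ∀ ω, |∑ i ∈ J, (φ (Z i ω) - a)| ≤ k * (B + P) := fun ω => by
    linarith [habs ω, hB0 ω]
  -- The inequality `e^y ≤ 1 + y + y²` for `|y| ≤ 1`, applicable by `hlk`; the square is bounded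
  -- through the majorant `ψ` and expanded into pairs of times.
  have hpt : ∀ ω, F ω * Real.exp (l * ∑ i ∈ J, (φ (Z i ω) - a)) ≤
      F ω + ∑ i ∈ J, l * (F ω * φ (Z i ω) - a * F ω) +
        (∑ i ∈ J, ∑ j ∈ J, 2 * l ^ 2 * (F ω * (ψ (Z i ω) * ψ (Z j ω))) +
          2 * l ^ 2 * (k * P) ^ 2 * F ω) := by
    intro ω
    set s := ∑ i ∈ J, (φ (Z i ω) - a) with hs
    set p := ∑ i ∈ J, ψ (Z i ω) with hp
    have e1 : ∑ i ∈ J, l * (F ω * φ (Z i ω) - a * F ω) = F ω * (l * s) := by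
      rw [hs, Finset.mul_sum, Finset.mul_sum]
      exact Finset.sum_congr rfl fun i _ => by ring
    have e2 : ∑ i ∈ J, ∑ j ∈ J, 2 * l ^ 2 * (F ω * (ψ (Z i ω) * ψ (Z j ω))) =
        F ω * (2 * l ^ 2 * p ^ 2) := by
      rw [sq p, hp, Finset.sum_mul_sum, Finset.mul_sum, Finset.mul_sum]
      refine Finset.sum_congr rfl fun i _ => ?_
      rw [Finset.mul_sum, Finset.mul_sum]
      exact Finset.sum_congr rfl fun j _ => by ring
    have hls : |l * s| ≤ 1 := by
      rw [abs_mul, abs_of_nonneg hl]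
      exact (mul_le_mul_of_nonneg_left (hbound ω) hl).trans hlk
    have hexp := (_root_.abs_le.1 (Real.abs_exp_sub_one_sub_id_le hls)).2
    have hs2 : s ^ 2 ≤ 2 * p ^ 2 + 2 * (k * P) ^ 2 := by
      have : s ^ 2 ≤ (p + k * P) ^ 2 := sq_le_sq.2 ((habs ω).trans (le_abs_self _))
      nlinarith [sq_nonneg (p - k * P)]
    have hmul : (l * s) ^ 2 ≤ l ^ 2 * (2 * p ^ 2 + 2 * (k * P) ^ 2) := by
      rw [mul_pow]; exact mul_le_mul_of_nonneg_left hs2 (sq_nonneg l)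
    rw [e1, e2]
    calc F ω * Real.exp (l * s) ≤
          F ω * (1 + l * s + l ^ 2 * (2 * p ^ 2 + 2 * (k * P) ^ 2)) :=
          mul_le_mul_of_nonneg_left (by linarith) (hF.nonneg ω)
      _ = _ := by ring
  have hIφ : ∀ i, Integrable (fun ω => F ω * φ (Z i ω)) μ := fun i =>
    hF.integrable_mul hZ (hφm i) (hφB i)
  have hIψ : ∀ i j, Integrable (fun ω => F ω * (ψ (Z i ω) * ψ (Z j ω))) μ := fun i j => by
    refine hF.integrable_mul hZ ((hψm i).mul (hψm j)) (B := B * B) fun ω => ?_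
    rw [abs_mul]
    exact mul_le_mul (h.abs_major_le _) (h.abs_major_le _) (abs_nonneg _)
      ((abs_nonneg _).trans (h.abs_major_le (Z i ω)))
  have hI0 : ∀ i, Integrable (fun ω => l * (F ω * φ (Z i ω) - a * F ω)) μ := fun i =>
    ((hIφ i).sub (hIF.const_mul a)).const_mul l
  have hI1 : Integrable (fun ω => ∑ i ∈ J, l * (F ω * φ (Z i ω) - a * F ω)) μ :=
    integrable_finsetSum _ fun i _ => hI0 i
  have hI2 : Integrable (fun ω => ∑ i ∈ J, ∑ j ∈ J,
      2 * l ^ 2 * (F ω * (ψ (Z i ω) * ψ (Z j ω)))) μ :=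
    integrable_finsetSum _ fun i _ => integrable_finsetSum _ fun j _ => (hIψ i j).const_mul _
  have hI3 : Integrable (fun ω => 2 * l ^ 2 * (k * P) ^ 2 * F ω) μ := hIF.const_mul _
  have hIexp : Integrable (fun ω => F ω * Real.exp (l * ∑ i ∈ J, (φ (Z i ω) - a))) μ := by
    refine hF.integrable_mul hZ (B := Real.exp 1) ?_ fun ω => ?_
    · exact Real.measurable_exp.comp
        ((Finset.measurable_sum _ fun i _ => (hφm i).sub_const a).const_mul l)
    · rw [Real.abs_exp]
      refine Real.exp_le_exp.2 ((le_abs_self _).trans ?_)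
      rw [abs_mul, abs_of_nonneg hl]
      exact (mul_le_mul_of_nonneg_left (hbound ω) hl).trans hlk
  have hI4 : Integrable (fun ω => F ω + ∑ i ∈ J, l * (F ω * φ (Z i ω) - a * F ω)) μ :=
    hIF.add hI1
  have hI5 : Integrable (fun ω => ∑ i ∈ J, ∑ j ∈ J, 2 * l ^ 2 * (F ω * (ψ (Z i ω) * ψ (Z j ω))) +
      2 * l ^ 2 * (k * P) ^ 2 * F ω) μ := hI2.add hI3
  have hmono := integral_mono hIexp (hI4.add hI5) hpt
  simp only [Pi.add_apply] at hmono
  have e : ∫ ω, (F ω + ∑ i ∈ J, l * (F ω * φ (Z i ω) - a * F ω) +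
        (∑ i ∈ J, ∑ j ∈ J, 2 * l ^ 2 * (F ω * (ψ (Z i ω) * ψ (Z j ω))) +
          2 * l ^ 2 * (k * P) ^ 2 * F ω)) ∂μ =
      ∫ ω, F ω ∂μ + ∑ i ∈ J, l * (∫ ω, F ω * φ (Z i ω) ∂μ - a * ∫ ω, F ω ∂μ) +
        (∑ i ∈ J, ∑ j ∈ J, 2 * l ^ 2 * ∫ ω, F ω * (ψ (Z i ω) * ψ (Z j ω)) ∂μ +
          2 * l ^ 2 * (k * P) ^ 2 * ∫ ω, F ω ∂μ) := by
    have e1 : ∀ i, ∫ ω, l * (F ω * φ (Z i ω) - a * F ω) ∂μ =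
        l * (∫ ω, F ω * φ (Z i ω) ∂μ - a * ∫ ω, F ω ∂μ) := fun i => by
      rw [integral_const_mul, integral_sub (hIφ i) (hIF.const_mul a), integral_const_mul]
    have e2 : ∀ i, ∫ ω, ∑ j ∈ J, 2 * l ^ 2 * (F ω * (ψ (Z i ω) * ψ (Z j ω))) ∂μ =
        ∑ j ∈ J, 2 * l ^ 2 * ∫ ω, F ω * (ψ (Z i ω) * ψ (Z j ω)) ∂μ := fun i => by
      rw [integral_finsetSum _ fun j _ => (hIψ i j).const_mul _]
      exact Finset.sum_congr rfl fun j _ => integral_const_mul _ _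
    rw [integral_add hI4 hI5, integral_add hIF hI1, integral_add hI2 hI3,
      integral_finsetSum _ fun i _ => hI0 i, integral_finsetSum _ fun i _ =>
        integrable_finsetSum _ fun j _ => (hIψ i j).const_mul _, integral_const_mul]
    simp_rw [e1, e2]
  have b1 : ∑ i ∈ J, l * (∫ ω, F ω * φ (Z i ω) ∂μ - a * ∫ ω, F ω ∂μ) ≤
      l * (k * η) * ∫ ω, F ω ∂μ := by
    calc ∑ i ∈ J, l * (∫ ω, F ω * φ (Z i ω) ∂μ - a * ∫ ω, F ω ∂μ) ≤
          ∑ i ∈ J, l * (η * ∫ ω, F ω ∂μ) := by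
          refine Finset.sum_le_sum fun i hi => mul_le_mul_of_nonneg_left ?_ hl
          linarith [h.mean_le U i (hJN i hi) (fun u hu => hUJ u hu i hi) F hF]
      _ = J.card * (l * (η * ∫ ω, F ω ∂μ)) := by rw [Finset.sum_const, nsmul_eq_mul]
      _ ≤ k * (l * (η * ∫ ω, F ω ∂μ)) :=
          mul_le_mul_of_nonneg_right hJk' (mul_nonneg hl (mul_nonneg h.err_nonneg hF0))
      _ = _ := by ring
  have hQ0 : 0 ≤ Q := (Finset.sum_nonneg fun d _ => h.weight_nonneg d).trans hQ
  have b2 : ∑ i ∈ J, ∑ j ∈ J, 2 * l ^ 2 * ∫ ω, F ω * (ψ (Z i ω) * ψ (Z j ω)) ∂μ ≤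
      l ^ 2 * (4 * k * P * Q) * ∫ ω, F ω ∂μ := by
    calc ∑ i ∈ J, ∑ j ∈ J, 2 * l ^ 2 * ∫ ω, F ω * (ψ (Z i ω) * ψ (Z j ω)) ∂μ ≤
          ∑ i ∈ J, ∑ j ∈ J, 2 * l ^ 2 * (P * w (Nat.dist i j) * ∫ ω, F ω ∂μ) := by
          refine Finset.sum_le_sum fun i hi => Finset.sum_le_sum fun j hj =>
            mul_le_mul_of_nonneg_left ?_ (by positivity)
          exact h.integral_pair_le hZ (hJN i hi) (hJN j hj) (fun u hu => hUJ u hu i hi)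
            (fun u hu => hUJ u hu j hj) hF
      _ = ∑ i ∈ J, 2 * l ^ 2 * P * (∫ ω, F ω ∂μ) * ∑ j ∈ J, w (Nat.dist i j) := by
          refine Finset.sum_congr rfl fun i _ => ?_
          rw [Finset.mul_sum]
          exact Finset.sum_congr rfl fun j _ => by ring
      _ ≤ ∑ i ∈ J, 2 * l ^ 2 * P * (∫ ω, F ω ∂μ) * (2 * Q) := by
          refine Finset.sum_le_sum fun i hi => mul_le_mul_of_nonneg_left ?_ (by positivity)
          exact (sum_natDist_le h.weight_nonneg J i (hJd i hi)).trans (by linarith)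
      _ = J.card * (2 * l ^ 2 * P * (∫ ω, F ω ∂μ) * (2 * Q)) := by
          rw [Finset.sum_const, nsmul_eq_mul]
      _ ≤ k * (2 * l ^ 2 * P * (∫ ω, F ω ∂μ) * (2 * Q)) :=
          mul_le_mul_of_nonneg_right hJk' (by positivity)
      _ = _ := by ring
  rw [e] at hmono
  linarith

/-- The exponential moment of the centred sum over every second block. -/
lemma integral_exp_blocks_le (h : PastBounds μ Z N k φ ψ a B P η w) (hZ : ∀ i, Measurable (Z i))
    (hk : 0 < k) {l Q : ℝ} (hl : 0 ≤ l) (hlk : l * (k * (B + P)) ≤ 1)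
    (hQ : ∑ d ∈ Finset.range k, w d ≤ Q) (e R : ℕ) :
    ∫ ω, Real.exp (l * ∑ s ∈ Finset.range R,
        ∑ i ∈ Finset.range N with i / k = e + 2 * s, (φ (Z i ω) - a)) ∂μ ≤
      (1 + l * (k * η) + l ^ 2 * (4 * k * P * Q + 2 * (k * P) ^ 2)) ^ R := by
  have hP := h.P_nonneg
  have hη := h.err_nonneg
  have hQ0 : 0 ≤ Q := (Finset.sum_nonneg fun d _ => h.weight_nonneg d).trans hQ
  have hdiv : ∀ i, k * (i / k) ≤ i ∧ i < k * (i / k) + k := fun i =>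
    ⟨Nat.mul_div_le i k, by
      have := Nat.div_add_mod i k; have := Nat.mod_lt i hk; omega⟩
  have hB : ∀ i ω, |φ (Z i ω) - a| ≤ B + P := fun i ω =>
    (abs_sub _ _).trans (add_le_add ((h.abs_le _).trans (h.major_le _)) h.abs_mean_le)
  induction R with
  | zero => simp
  | succ R ih =>
    -- Blocks of the other parity are left out, so a whole block separates `U` from `J`; this
    -- provides the gap `k`.
    set U : Finset ℕ := {i ∈ Finset.range N | i / k + 2 ≤ e + 2 * R} with hU
    set J : Finset ℕ := {i ∈ Finset.range N | i / k = e + 2 * R} with hJ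
    have hF : IsWeight Z U fun ω => Real.exp (l * ∑ s ∈ Finset.range R,
        ∑ i ∈ Finset.range N with i / k = e + 2 * s, (φ (Z i ω) - a)) := by
      refine ⟨?_, fun ω => (Real.exp_pos _).le, ?_⟩
      · refine Real.measurable_exp.comp (Measurable.const_mul ?_ l)
        refine Finset.measurable_sum _ fun s hs => Finset.measurable_sum _ fun i hi => ?_
        refine Measurable.sub_const (h.meas.comp (measurable_coordAlgebra ?_)) a
        simp only [hU, Finset.mem_filter, Finset.mem_range] at hs hi ⊢
        omega
      · refine ⟨Real.exp (l * ∑ s ∈ Finset.range R,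
          ∑ i ∈ Finset.range N with i / k = e + 2 * s, (B + P)), fun ω => ?_⟩
        refine Real.exp_le_exp.2 (mul_le_mul_of_nonneg_left ?_ hl)
        exact Finset.sum_le_sum fun s _ => Finset.sum_le_sum fun i _ =>
          (le_abs_self _).trans (hB i ω)
    have hblock := h.integral_exp_block_le hZ (U := U) (J := J) ?_ ?_ ?_ ?_ hl hlk hQ hF
    · have hsplit : ∀ ω, Real.exp (l * ∑ s ∈ Finset.range (R + 1),
          ∑ i ∈ Finset.range N with i / k = e + 2 * s, (φ (Z i ω) - a)) =
          Real.exp (l * ∑ s ∈ Finset.range R,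
            ∑ i ∈ Finset.range N with i / k = e + 2 * s, (φ (Z i ω) - a)) *
          Real.exp (l * ∑ i ∈ J, (φ (Z i ω) - a)) := fun ω => by
        rw [Finset.sum_range_succ, mul_add, Real.exp_add]
      simp_rw [hsplit]
      refine hblock.trans ?_
      rw [pow_succ' _ R]
      exact mul_le_mul_of_nonneg_left ih (by positivity)
    · intro j hj
      exact Finset.mem_range.1 (Finset.mem_filter.1 hj).1
    · have : J ⊆ Finset.Ico (k * (e + 2 * R)) (k * (e + 2 * R) + k) := by
        intro i hi
        have h1 := (Finset.mem_filter.1 hi).2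
        have h2 := hdiv i
        rw [h1] at h2
        exact Finset.mem_Ico.2 h2
      simpa using Finset.card_le_card this
    · intro i hi j hj
      have h1 := hdiv i
      have h2 := hdiv j
      rw [(Finset.mem_filter.1 hi).2] at h1
      rw [(Finset.mem_filter.1 hj).2] at h2
      simp only [Nat.dist]
      omega
    · intro u hu j hj
      have h1 := hdiv u
      have h2 := hdiv j
      have h3 := (Finset.mem_filter.1 hu).2
      rw [(Finset.mem_filter.1 hj).2] at h2
      have h4 : k * (u / k + 2) ≤ k * (e + 2 * R) := Nat.mul_le_mul_left k h3
      rw [mul_add] at h4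
      omega

-- Splitting into even and odd blocks. Taking `N / k + 1` blocks of each parity is more than enough,
-- as the surplus blocks are empty.
omit [MeasurableSpace Ω] [MeasurableSpace T] in
lemma sum_range_eq_sum_blocks (x : ℕ → ℝ) :
    ∑ i ∈ Finset.range N, x i =
      ∑ s ∈ Finset.range (N / k + 1), ∑ i ∈ Finset.range N with i / k = 0 + 2 * s, x i +
      ∑ s ∈ Finset.range (N / k + 1), ∑ i ∈ Finset.range N with i / k = 1 + 2 * s, x i := by
  have h1 : ∀ i ∈ Finset.range N, i / k ∈ Finset.range (2 * (N / k + 1)) := by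
    intro i hi
    have := Nat.div_le_div_right (c := k) (Finset.mem_range.1 hi).le
    rw [Finset.mem_range]
    omega
  rw [← Finset.sum_fiberwise_of_maps_to h1]
  have h2 : ∀ (y : ℕ → ℝ) (R : ℕ), ∑ c ∈ Finset.range (2 * R), y c =
      ∑ s ∈ Finset.range R, y (0 + 2 * s) + ∑ s ∈ Finset.range R, y (1 + 2 * s) := by
    intro y R
    induction R with
    | zero => simp
    | succ R ih =>
      rw [mul_add, mul_one, Finset.sum_range_succ, Finset.sum_range_succ, ih,
        Finset.sum_range_succ, Finset.sum_range_succ, zero_add, add_comm 1 (2 * R)]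
      ring
  exact h2 _ _

/-- A one-sided Bernstein-type inequality for sums over the window. -/
lemma measure_sum_ge_le (h : PastBounds μ Z N k φ ψ a B P η w) (hZ : ∀ i, Measurable (Z i))
    (hk : 0 < k) (hkN : k ≤ N) {l Q : ℝ} (hl : 0 ≤ l) (hlk : l * (k * (B + P)) ≤ 1)
    (hQ : ∑ d ∈ Finset.range k, w d ≤ Q) (hkP : k * P ≤ Q) (t : ℝ) :
    μ.real {ω | 2 * t ≤ ∑ i ∈ Finset.range N, (φ (Z i ω) - a)} ≤
      2 * Real.exp (-l * t + (2 * l * N * η + 12 * l ^ 2 * N * P * Q)) := by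
  have hP := h.P_nonneg
  have hη := h.err_nonneg
  have hQ0 : 0 ≤ Q := (Finset.sum_nonneg fun d _ => h.weight_nonneg d).trans hQ
  have hB : ∀ i ω, |φ (Z i ω) - a| ≤ B + P := fun i ω =>
    (abs_sub _ _).trans (add_le_add ((h.abs_le _).trans (h.major_le _)) h.abs_mean_le)
  set R := N / k + 1 with hR
  have hRk : (R : ℝ) * k ≤ 2 * N := by
    have : R * k ≤ 2 * N := by
      have := Nat.div_mul_le_self N k
      rw [hR, add_mul]; omega
    exact_mod_cast this
  set S : ℕ → Ω → ℝ := fun e ω => ∑ s ∈ Finset.range R,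
    ∑ i ∈ Finset.range N with i / k = e + 2 * s, (φ (Z i ω) - a) with hS
  have key : ∀ e, μ.real {ω | t ≤ S e ω} ≤
      Real.exp (-l * t + (2 * l * N * η + 12 * l ^ 2 * N * P * Q)) := by
    intro e
    have hmeas : Measurable (S e) := Finset.measurable_sum _ fun s _ =>
      Finset.measurable_sum _ fun i _ => (h.meas.comp (hZ i)).sub_const a
    have hint : Integrable (fun ω => Real.exp (l * S e ω)) μ := by
      refine Integrable.of_bound (Real.measurable_exp.comp
        (hmeas.const_mul l)).aestronglyMeasurable (Real.exp (l * ∑ s ∈ Finset.range R,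
          ∑ i ∈ Finset.range N with i / k = e + 2 * s, (B + P))) (ae_of_all _ fun ω => ?_)
      rw [Real.norm_eq_abs, Real.abs_exp]
      refine Real.exp_le_exp.2 (mul_le_mul_of_nonneg_left ?_ hl)
      exact Finset.sum_le_sum fun s _ => Finset.sum_le_sum fun i _ =>
        (le_abs_self _).trans (hB i ω)
    refine (ProbabilityTheory.measure_ge_le_exp_mul_mgf t hl hint).trans ?_
    rw [Real.exp_add]
    refine mul_le_mul_of_nonneg_left ?_ (Real.exp_pos _).le
    refine (h.integral_exp_blocks_le hZ hk hl hlk hQ e R).trans ?_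
    -- The 6 is `4 + 2`, after `(k P)² ≤ k P Q` from `hkP`. With `R k ≤ 2 N` it becomes the 12 of
    -- the statement.
    have h1 : 1 + l * (k * η) + l ^ 2 * (4 * k * P * Q + 2 * (k * P) ^ 2) ≤
        Real.exp (k * (l * η + 6 * l ^ 2 * P * Q)) := by
      refine le_trans ?_ (Real.add_one_le_exp _)
      have : (k * P) ^ 2 ≤ k * P * Q := by
        rw [sq]; exact mul_le_mul_of_nonneg_left hkP (by positivity)
      nlinarith [mul_le_mul_of_nonneg_left this (sq_nonneg l)]
    calc _ ≤ Real.exp (k * (l * η + 6 * l ^ 2 * P * Q)) ^ R :=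
          pow_le_pow_left₀ (by positivity) h1 R
      _ = Real.exp (R * k * (l * η + 6 * l ^ 2 * P * Q)) := by
          rw [← Real.exp_nat_mul]; ring_nf
      _ ≤ _ := by
          refine Real.exp_le_exp.2 ?_
          have : 0 ≤ l * η + 6 * l ^ 2 * P * Q := by positivity
          nlinarith [mul_le_mul_of_nonneg_right hRk this]
  -- If the total reaches `2 t`, one of the two parity sums reaches `t`.
  calc μ.real {ω | 2 * t ≤ ∑ i ∈ Finset.range N, (φ (Z i ω) - a)} ≤
        μ.real ({ω | t ≤ S 0 ω} ∪ {ω | t ≤ S 1 ω}) := by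
        refine measureReal_mono fun ω hω => ?_
        simp only [Set.mem_ofPred_eq, sum_range_eq_sum_blocks (k := k) (fun i => φ (Z i ω) - a)] at hω
        by_contra hcon
        simp only [Set.mem_union, Set.mem_ofPred_eq, not_or, not_le] at hcon
        have := add_lt_add hcon.1 hcon.2
        simp only [hS] at this
        linarith
    _ ≤ _ := (measureReal_union_le _ _).trans (by linarith [key 0, key 1])

end PastBounds

end BlockBernstein

/-! ### Approximating kernel times powers of the response inside `𝒞` -/

section Approximation

variable {Ω T : Type*} [MeasurableSpace Ω] [MeasurableSpace T]

namespace CSpace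

/-- `φ` is within `δ`, uniformly, of an element of `𝒞(T)` of norm at most `M`. -/
def Approx (𝒞 : CSpace T) (φ : T → ℝ) (δ M : ℝ) : Prop :=
  ∃ g : 𝒞.carrier, (∀ t, |φ t - (g : T → ℝ) t| ≤ δ) ∧ 𝒞.cNorm g ≤ M

variable {𝒞 : CSpace T}

lemma SemiLE.mono {f : T → ℝ} {r r' : ℝ} (h : 𝒞.SemiLE f r) (hr : r ≤ r') : 𝒞.SemiLE f r' :=
  ⟨h.1, h.2.trans hr⟩

lemma SemiLE.add {f g : T → ℝ} {r s : ℝ} (hf : 𝒞.SemiLE f r) (hg : 𝒞.SemiLE g s) :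
    𝒞.SemiLE (fun t => f t + g t) (r + s) := by
  obtain ⟨hf, hfr⟩ := hf
  obtain ⟨hg, hgs⟩ := hg
  exact ⟨𝒞.carrier.add_mem hf hg,
    (map_add_le_add 𝒞.semi (⟨f, hf⟩ : 𝒞.carrier) ⟨g, hg⟩).trans (add_le_add hfr hgs)⟩

lemma SemiLE.const_mul {f : T → ℝ} {r : ℝ} (hf : 𝒞.SemiLE f r) (c : ℝ) :
    𝒞.SemiLE (fun t => c * f t) (|c| * r) := by
  obtain ⟨hf, hfr⟩ := hf
  refine ⟨𝒞.carrier.smul_mem c hf, ?_⟩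
  have := map_smul_eq_mul 𝒞.semi c (⟨f, hf⟩ : 𝒞.carrier)
  exact this.le.trans (mul_le_mul_of_nonneg_left hfr (abs_nonneg c))

lemma SemiLE.sub {f g : T → ℝ} {r s : ℝ} (hf : 𝒞.SemiLE f r) (hg : 𝒞.SemiLE g s) :
    𝒞.SemiLE (fun t => f t - g t) (r + s) := by
  have := hf.add (hg.const_mul (-1))
  simpa [sub_eq_add_neg] using this

lemma supNorm_le {T : Type*} {f : T → ℝ} {B : ℝ} (h0 : 0 ≤ B) (hB : ∀ t, |f t| ≤ B) :
    supNorm f ≤ B :=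
  Real.iSup_le hB h0

lemma SemiLE.approx {f φ : T → ℝ} {r B δ : ℝ} (hf : 𝒞.SemiLE f r) (h0 : 0 ≤ B)
    (hB : ∀ t, |f t| ≤ B) (hδ : ∀ t, |φ t - f t| ≤ δ) : 𝒞.Approx φ δ (B + r) :=
  ⟨⟨f, hf.1⟩, hδ, add_le_add (supNorm_le h0 hB) hf.2⟩

lemma Approx.mono {φ : T → ℝ} {δ M δ' M' : ℝ} (h : 𝒞.Approx φ δ M) (hδ : δ ≤ δ')
    (hM : M ≤ M') : 𝒞.Approx φ δ' M' := by
  obtain ⟨g, h1, h2⟩ := h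
  exact ⟨g, fun t => (h1 t).trans hδ, h2.trans hM⟩

lemma Approx.neg {φ : T → ℝ} {δ M : ℝ} (h : 𝒞.Approx φ δ M) :
    𝒞.Approx (fun t => -φ t) δ M := by
  obtain ⟨g, h1, h2⟩ := h
  refine ⟨-g, fun t => ?_, ?_⟩
  · have := h1 t
    rw [← abs_neg] at this
    convert this using 2
    simp; ring
  · refine le_trans (le_of_eq ?_) h2
    simp [cNorm, supNorm]

/-- The covariance inequality is applied to the approximant `g`. The error `δ` is paid twice: once
under the weight, once in the unweighted mean. -/
lemma Approx.mean_le {φ : T → ℝ} {δ M : ℝ} (h : 𝒞.Approx φ δ M) (hφ : Measurable φ)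
    {μ : Measure Ω} [IsProbabilityMeasure μ] {b γ : ℝ} {Z : ℕ → Ω → T} {N : ℕ}
    (hZ : ∀ i, Measurable (Z i)) (hmix : WindowMixing μ 𝒞 b γ Z N) {U : Finset ℕ} {i ρ : ℕ}
    (hi : i < N) (hρ : 0 < ρ) (hU : ∀ u ∈ U, u + ρ ≤ i) {F : Ω → ℝ} (hF : IsWeight Z U F) :
    ∫ ω, F ω * φ (Z i ω) ∂μ ≤
      (∫ ω, φ (Z i ω) ∂μ + (2 * δ + Real.exp (-b * (ρ : ℝ) ^ γ) * M)) * ∫ ω, F ω ∂μ := by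
  obtain ⟨g, hg, hM⟩ := h
  obtain ⟨C, hC⟩ := 𝒞.bounded' g g.2
  have hgm : Measurable (g : T → ℝ) := 𝒞.measurable' g g.2
  have hIF := hF.integrable (μ := μ) hZ
  have hF0 := hF.integral_nonneg (μ := μ)
  have hφB : ∀ t, |φ t| ≤ C + δ := fun t => by
    calc |φ t| = |(g : T → ℝ) t + (φ t - (g : T → ℝ) t)| := by ring_nf
      _ ≤ _ := (abs_add_le _ _).trans (add_le_add (hC t) (hg t))
  have hIg : Integrable (fun ω => F ω * (g : T → ℝ) (Z i ω)) μ := hF.integrable_mul (μ := μ) hZ (hgm.comp (hZ i)) fun ω => hC _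
  have hIφ : Integrable (fun ω => F ω * φ (Z i ω)) μ := hF.integrable_mul (μ := μ) hZ (hφ.comp (hZ i)) fun ω => hφB _
  have hg1 : Integrable (fun ω => (g : T → ℝ) (Z i ω)) μ :=
    Integrable.of_bound (hgm.comp (hZ i)).aestronglyMeasurable C (ae_of_all _ fun ω => hC _)
  have hφ1 : Integrable (fun ω => φ (Z i ω)) μ :=
    Integrable.of_bound (hφ.comp (hZ i)).aestronglyMeasurable _ (ae_of_all _ fun ω => hφB _)
  have h1 : ∫ ω, F ω * φ (Z i ω) ∂μ ≤
      ∫ ω, F ω * (g : T → ℝ) (Z i ω) ∂μ + δ * ∫ ω, F ω ∂μ := by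
    rw [← integral_const_mul, ← integral_add hIg (hIF.const_mul δ)]
    refine integral_mono hIφ (hIg.add (hIF.const_mul δ)) fun ω => ?_
    have := mul_le_mul_of_nonneg_left (abs_le.1 (hg (Z i ω))).2 (hF.nonneg ω)
    linarith
  have h2 : ∫ ω, (g : T → ℝ) (Z i ω) ∂μ ≤ ∫ ω, φ (Z i ω) ∂μ + δ := by
    have : ∫ ω, φ (Z i ω) ∂μ + δ = ∫ ω, (φ (Z i ω) + δ) ∂μ := by
      rw [integral_add hφ1 (integrable_const δ)]; simp
    rw [this]
    refine integral_mono hg1 (hφ1.add (integrable_const δ)) fun ω => ?_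
    have := (abs_le.1 (hg (Z i ω))).1
    linarith
  have h3 := (abs_le.1 (hmix U i ρ hi hρ hU F hF g)).2
  have h4 : Real.exp (-b * (ρ : ℝ) ^ γ) * (∫ ω, F ω ∂μ) * 𝒞.cNorm g ≤
      Real.exp (-b * (ρ : ℝ) ^ γ) * (∫ ω, F ω ∂μ) * M :=
    mul_le_mul_of_nonneg_left hM (by positivity)
  have h5 := mul_le_mul_of_nonneg_left h2 hF0
  nlinarith

/-- Second-order Taylor expansion of the exponential, solved for the square. It is the device for
producing squares in a space known to be stable only under linear operations and exponentials. -/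
lemma abs_sq_sub_exp_le {x t B : ℝ} (ht : 0 < t) (hx : |x| ≤ B) (htB : t * B ≤ 1) :
    |x ^ 2 - 2 / t ^ 2 * (Real.exp (t * x) - 1 - t * x)| ≤ 2 * t * B ^ 3 := by
  have h1 : |t * x| ≤ 1 := by
    rw [abs_mul, abs_of_pos ht]; exact (mul_le_mul_of_nonneg_left hx ht.le).trans htB
  have h2 := Real.exp_bound h1 (n := 3) (by norm_num)
  simp only [Finset.sum_range_succ, Finset.sum_range_zero, Nat.factorial] at h2
  norm_num at h2
  rw [← abs_mul] at h2
  have h3 : |t * x| ^ 3 ≤ (t * B) ^ 3 := by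
    rw [abs_mul, abs_of_pos ht]
    exact pow_le_pow_left₀ (by positivity) (mul_le_mul_of_nonneg_left hx ht.le) 3
  have e : x ^ 2 - 2 / t ^ 2 * (Real.exp (t * x) - 1 - t * x) =
      -(2 / t ^ 2 * (Real.exp (t * x) - (1 + t * x + (t * x) ^ 2 / 2))) := by
    field_simp; ring
  rw [e, abs_neg, abs_mul, abs_of_pos (by positivity)]
  calc 2 / t ^ 2 * |Real.exp (t * x) - (1 + t * x + (t * x) ^ 2 / 2)| ≤
        2 / t ^ 2 * (t * B) ^ 3 := by
        refine mul_le_mul_of_nonneg_left ?_ (by positivity)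
        refine h2.trans ?_
        have : 0 ≤ |t * x| ^ 3 := by positivity
        linarith
    _ = _ := by field_simp

variable (hexp : ∀ f : 𝒞.carrier, 𝒞.SemiLE (fun z => Real.exp ((f : T → ℝ) z))
    (supNorm (fun z => Real.exp ((f : T → ℝ) z)) * 𝒞.semi f))
  (hconst : ∀ c : ℝ, 𝒞.SemiLE (fun _ => c) 0)

-- As `t g ≤ 1`, the sup norm of `e^{t g}` is at most `e < 3` and its seminorm at most `3 t s`.
-- Adding `t s` for the linear term and multiplying by `2 / t ^ 2` gives `8 s / t`: the seminorm
-- blows up only like `1 / t`.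
include hexp hconst in
lemma SemiLE.exp_quotient {g : T → ℝ} {s B t : ℝ} (hg : 𝒞.SemiLE g s) (ht : 0 < t)
    (hB : ∀ z, |g z| ≤ B) (htB : t * B ≤ 1) :
    𝒞.SemiLE (fun z => 2 / t ^ 2 * (Real.exp (t * g z) - 1 - t * g z)) (8 * s / t) := by
  have h1 := hg.const_mul t
  rw [abs_of_pos ht] at h1
  have hs : 0 ≤ s := (apply_nonneg 𝒞.semi _).trans hg.2
  have h2 : 𝒞.SemiLE (fun z => Real.exp (t * g z)) (3 * (t * s)) := by
    refine (hexp ⟨_, h1.1⟩).mono (mul_le_mul ?_ h1.2 (apply_nonneg _ _) (by norm_num))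
    refine supNorm_le (by norm_num) fun z => ?_
    rw [Real.abs_exp]
    have hz : t * g z ≤ 1 :=
      (mul_le_mul_of_nonneg_left ((le_abs_self _).trans (hB z)) ht.le).trans htB
    exact (Real.exp_le_exp.2 hz).trans (by linarith [Real.exp_one_lt_d9])
  have h3 := ((h2.sub (hconst 1)).sub h1).const_mul (2 / t ^ 2)
  refine h3.mono (le_of_eq ?_)
  rw [abs_of_pos (by positivity)]
  field_simp; ring

-- Polarization `4 f g = (f + g)² - (f - g)²`, each square being replaced by its exponential
-- approximant. The parameter `t` trades accuracy against the size of the norm.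
include hexp hconst in
lemma SemiLE.approx_mul {f g : T → ℝ} {s B t : ℝ} (hadd : 𝒞.SemiLE (fun z => f z + g z) s)
    (hsub : 𝒞.SemiLE (fun z => f z - g z) s) (ht : 0 < t) (hB0 : 0 ≤ B)
    (hB1 : ∀ z, |f z + g z| ≤ B) (hB2 : ∀ z, |f z - g z| ≤ B) (htB : t * B ≤ 1) :
    𝒞.Approx (fun z => f z * g z) (t * B ^ 3) (2 * B ^ 2 + 4 * s / t) := by
  have h1 := SemiLE.exp_quotient hexp hconst hadd ht hB1 htB
  have h2 := SemiLE.exp_quotient hexp hconst hsub ht hB2 htB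
  have h3 := (h1.sub h2).const_mul (1 / 4)
  have herr : ∀ z, |f z * g z - 1 / 4 *
      (2 / t ^ 2 * (Real.exp (t * (f z + g z)) - 1 - t * (f z + g z)) -
        2 / t ^ 2 * (Real.exp (t * (f z - g z)) - 1 - t * (f z - g z)))| ≤ t * B ^ 3 := by
    intro z
    have a1 := abs_le.1 (abs_sq_sub_exp_le ht (hB1 z) htB)
    have a2 := abs_le.1 (abs_sq_sub_exp_le ht (hB2 z) htB)
    rw [abs_le]
    constructor <;> nlinarith [a1.1, a1.2, a2.1, a2.2]
  have hsup : ∀ z, |1 / 4 *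
      (2 / t ^ 2 * (Real.exp (t * (f z + g z)) - 1 - t * (f z + g z)) -
        2 / t ^ 2 * (Real.exp (t * (f z - g z)) - 1 - t * (f z - g z)))| ≤ 2 * B ^ 2 := by
    intro z
    have a0 := abs_le.1 (herr z)
    have a1 : (f z + g z) ^ 2 ≤ B ^ 2 := sq_le_sq.2 (by rw [abs_of_nonneg hB0]; exact hB1 z)
    have a2 : (f z - g z) ^ 2 ≤ B ^ 2 := sq_le_sq.2 (by rw [abs_of_nonneg hB0]; exact hB2 z)
    have a3 : t * B ^ 3 ≤ B ^ 2 := by nlinarith [mul_le_mul_of_nonneg_right htB (sq_nonneg B)]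
    have a4 := sq_nonneg (f z + g z)
    have a5 := sq_nonneg (f z - g z)
    rw [abs_le]
    constructor <;> nlinarith [a0.1, a0.2]
  refine (h3.approx (by positivity) hsup herr).mono le_rfl (le_of_eq ?_)
  rw [abs_of_pos (by norm_num)]
  ring

end CSpace

/-- The functions `g(x) y^j`, `j ≤ 2`, are approximable in `𝒞(S × I)`. -/
lemma SeminormAssumptions.approx_mul_pow {D : ℕ} {S : Set (EuclideanSpace ℝ (Fin D))} {L : ℝ}
    {𝒞S : CSpace S} {𝒞Z : CSpace (S × Icc (-L) L)} (h : SeminormAssumptions 𝒞S 𝒞Z) (hL : 1 ≤ L)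
    {g : S → ℝ} {s B t : ℝ} (hg : 𝒞S.SemiLE g s) (hB1 : 1 ≤ B) (hB : ∀ x, |g x| ≤ B)
    (ht : 0 < t) (htB : t * (2 * B * L) ≤ 1) {j : ℕ} (hj : j ≤ 2) :
    𝒞Z.Approx (fun z => g z.1 * (z.2 : ℝ) ^ j) (t * (2 * B * L) ^ 3)
      (8 * B ^ 2 * L ^ 2 + 8 * L * (s + B + 1) / t) := by
  have hs : 0 ≤ s := (apply_nonneg 𝒞S.semi _).trans hg.2
  have hy : ∀ z : S × Icc (-L) L, |(z.2 : ℝ)| ≤ L := fun z => abs_le.2 z.2.2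
  have hvol : volume.real (Icc (-L) L) = 2 * L := by
    rw [Real.volume_real_Icc_of_le (by linarith)]; ring
  have hBL : 1 ≤ B * L := one_le_mul_of_one_le_of_one_le hB1 hL
  have ht1 : t ≤ 1 := by nlinarith
  have hdiv : 8 * L * (s + B + 1) ≤ 8 * L * (s + B + 1) / t := by
    rw [le_div_iff₀ ht]
    nlinarith [mul_nonneg (by linarith : 0 ≤ L) (by linarith : 0 ≤ s + B + 1)]
  have hgy : ∀ z : S × Icc (-L) L, |g z.1 * (z.2 : ℝ)| ≤ B * L := fun z => by
    rw [abs_mul]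
    exact mul_le_mul (hB _) (hy z) (abs_nonneg _) (by linarith)
  have hmul : 𝒞Z.SemiLE (fun z => g z.1 * (z.2 : ℝ)) ((s + B) * (2 * L)) := by
    refine (h.mul_id_le ⟨g, hg.1⟩).mono ?_
    rw [hvol]
    exact mul_le_mul_of_nonneg_right (add_le_add hg.2 (CSpace.supNorm_le (by linarith) hB))
      (by linarith)
  have hid : 𝒞Z.SemiLE (fun z => (z.2 : ℝ)) (2 * L) := h.id_le.mono hvol.le
  have hδ : 0 ≤ t * (2 * B * L) ^ 3 := by positivity
  interval_cases j
  · have h0 : 𝒞Z.SemiLE (fun z => g z.1) s := (h.lift_le ⟨g, hg.1⟩).mono hg.2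
    refine (h0.approx (by linarith) (fun z => hB _) (δ := 0) fun z => by simp).mono hδ ?_
    nlinarith [sq_nonneg (B * L)]
  · refine (hmul.approx (by linarith) hgy (δ := 0) fun z => by simp).mono hδ ?_
    nlinarith [mul_nonneg hs (by linarith : 0 ≤ L)]
  -- Only `y²` needs approximation, with factors `g(x) y` and `y`; their sum and difference are
  -- bounded by `B L + L ≤ 2 B L`.
  · have h2 := CSpace.SemiLE.approx_mul h.exp_le h.const_le (hmul.add hid) (hmul.sub hid) ht
      (B := 2 * B * L) (by nlinarith) (fun z => ?_) (fun z => ?_) htB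
    · simp_rw [pow_two, ← mul_assoc]
      refine h2.mono le_rfl ?_
      refine add_le_add (by nlinarith) ?_
      rw [div_le_div_iff_of_pos_right ht]
      nlinarith
    · exact (abs_add_le _ _).trans ((add_le_add (hgy z) (hy z)).trans (by nlinarith))
    · exact (abs_sub _ _).trans ((add_le_add (hgy z) (hy z)).trans (by nlinarith))

end Approximation

/-! ### The joint density: support, moments and bias -/

section JointDensity

/-- The integral `∫_{[-L,L]} y^j f(x,y) dy`. -/
noncomputable def partialMoment {E : Type*} (f : E × ℝ → ℝ) (L : ℝ) (j : ℕ) (x : E) : ℝ :=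
  ∫ y in Icc (-L) L, y ^ j * f (x, y)

/-- The pairs `(X i, Y i)` have the common density `f`, responses in `[-L, L]`, and `f` is uniformly
Hölder controllable over `𝒳`. -/
structure JointDensity {Ω : Type*} [MeasurableSpace Ω] (μ : Measure Ω) {D : ℕ} (α L : ℝ)
    (𝒳 : Set (EuclideanSpace ℝ (Fin D))) (X : ℕ → Ω → EuclideanSpace ℝ (Fin D)) (Y : ℕ → Ω → ℝ)
    (f : EuclideanSpace ℝ (Fin D) × ℝ → ℝ) : Prop where
  α_pos : 0 < α
  L_pos : 0 < L
  compact : IsCompact 𝒳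
  measurable_X : ∀ i, Measurable (X i)
  measurable_Y : ∀ i, Measurable (Y i)
  Y_mem : ∀ i ω, Y i ω ∈ Icc (-L) L
  measurable_f : Measurable f
  nonneg : ∀ p, 0 ≤ f p
  law : ∀ i, μ.map (fun ω => (X i ω, Y i ω)) =
    (volume : Measure (EuclideanSpace ℝ (Fin D) × ℝ)).withDensity (fun p => ENNReal.ofReal (f p))
  holder : UnifHolderControllableOn α (𝒳 ×ˢ (univ : Set ℝ)) f

namespace JointDensity

variable {Ω : Type*} [MeasurableSpace Ω] {μ : Measure Ω} [IsProbabilityMeasure μ] {D : ℕ}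
  {α L : ℝ} {𝒳 : Set (EuclideanSpace ℝ (Fin D))} {X : ℕ → Ω → EuclideanSpace ℝ (Fin D)}
  {Y : ℕ → Ω → ℝ} {f : EuclideanSpace ℝ (Fin D) × ℝ → ℝ}

lemma _root_.UnifHolderControllableOn.continuousAt {V : Type*} [SeminormedAddCommGroup V] {α : ℝ}
    (hα : 0 < α) {A : Set V} {g : V → ℝ} (h : UnifHolderControllableOn α A g) {x : V}
    (hx : x ∈ A) : ContinuousAt g x := by
  obtain ⟨c, r, hc, hr, hg⟩ := h
  rw [ContinuousAt, tendsto_iff_dist_tendsto_zero]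
  have hlim : Tendsto (fun y => c * ‖y - x‖ ^ α) (nhds x) (nhds 0) := by
    have : Continuous fun y => c * ‖y - x‖ ^ α := by
      refine continuous_const.mul (Continuous.rpow_const (by fun_prop) fun _ => Or.inr hα.le)
    have h0 := this.tendsto x
    simpa [Real.zero_rpow hα.ne'] using h0
  refine squeeze_zero' (Eventually.of_forall fun _ => dist_nonneg) ?_ hlim
  filter_upwards [Metric.ball_mem_nhds x hr] with y hy
  have := hg x hx (y - x) (by simpa [dist_eq_norm] using hy)
  rwa [add_sub_cancel] at this

omit [IsProbabilityMeasure μ] in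
lemma exists_bound (h : JointDensity μ α L 𝒳 X Y f) :
    ∃ C, 0 ≤ C ∧ ∀ x ∈ 𝒳, ∀ y ∈ Icc (-L) L, f (x, y) ≤ C := by
  have hcont : ContinuousOn f (𝒳 ×ˢ Icc (-L) L) := fun p hp =>
    (h.holder.continuousAt h.α_pos ⟨hp.1, mem_univ _⟩).continuousWithinAt
  obtain ⟨C, hC⟩ := (h.compact.prod isCompact_Icc).exists_bound_of_continuousOn hcont
  exact ⟨max C 0, le_max_right _ _, fun x hx y hy =>
    (le_abs_self _).trans ((hC (x, y) ⟨hx, hy⟩).trans (le_max_left _ _))⟩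

-- The law of `Y` determines `f` off the strip only almost everywhere, but continuity of `f` at
-- points over `𝒳` upgrades this to every point: a positive value would persist on an open set and
-- give mass to responses outside `[-L, L]`.
omit [IsProbabilityMeasure μ] in
lemma eq_zero (h : JointDensity μ α L 𝒳 X Y f) {x : EuclideanSpace ℝ (Fin D)} (hx : x ∈ 𝒳) {y : ℝ}
    (hy : y ∉ Icc (-L) L) : f (x, y) = 0 := by
  by_contra hne
  have hpos : 0 < f (x, y) := lt_of_le_of_ne (h.nonneg _) (Ne.symm hne)
  have hcont := h.holder.continuousAt h.α_pos (x := (x, y)) ⟨hx, mem_univ _⟩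
  have h1 : ∀ᶠ p in nhds (x, y), f (x, y) / 2 < f p :=
    hcont.eventually (lt_mem_nhds (by linarith))
  have hmem : (Icc (-L) L)ᶜ ∈ nhds (x, y).2 := isClosed_Icc.isOpen_compl.mem_nhds hy
  have h2 : ∀ᶠ p : EuclideanSpace ℝ (Fin D) × ℝ in nhds (x, y), p.2 ∉ Icc (-L) L :=
    continuousAt_snd.eventually hmem
  obtain ⟨U, hU, hUo, hxU⟩ := mem_nhds_iff.1 (h1.and h2)
  have hzero : μ.map (fun ω => (X 0 ω, Y 0 ω)) U = 0 := by
    rw [Measure.map_apply ((h.measurable_X 0).prodMk (h.measurable_Y 0)) hUo.measurableSet]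
    have : (fun ω => (X 0 ω, Y 0 ω)) ⁻¹' U = ∅ :=
      eq_empty_of_forall_notMem fun ω hω => (hU hω).2 (h.Y_mem 0 ω)
    rw [this, measure_empty]
  rw [h.law 0, withDensity_apply _ hUo.measurableSet] at hzero
  have hge : ENNReal.ofReal (f (x, y) / 2) * volume U ≤
      ∫⁻ p in U, ENNReal.ofReal (f p) := by
    rw [← setLIntegral_const]
    exact setLIntegral_mono (by have := h.measurable_f; fun_prop) fun p hp =>
      ENNReal.ofReal_le_ofReal (hU hp).1.le
  have hvol : 0 < volume U := hUo.measure_pos _ ⟨_, hxU⟩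
  have : 0 < ENNReal.ofReal (f (x, y) / 2) * volume U :=
    ENNReal.mul_pos (by simpa using hpos) hvol.ne'
  rw [hzero] at hge
  exact absurd (this.trans_le hge) (lt_irrefl _)

omit [IsProbabilityMeasure μ] in
lemma integral_mul_eq (h : JointDensity μ α L 𝒳 X Y f) {x : EuclideanSpace ℝ (Fin D)} (hx : x ∈ 𝒳)
    (g : ℝ → ℝ) : ∫ y, g y * f (x, y) = ∫ y in Icc (-L) L, g y * f (x, y) :=
  (setIntegral_eq_integral_of_forall_compl_eq_zero fun y hy => by rw [h.eq_zero hx hy, mul_zero]).symm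

omit [IsProbabilityMeasure μ] in
lemma margDensity_eq (h : JointDensity μ α L 𝒳 X Y f) {x : EuclideanSpace ℝ (Fin D)}
    (hx : x ∈ 𝒳) : margDensity f x = partialMoment f L 0 x := by
  have := h.integral_mul_eq hx fun _ => 1
  simpa [margDensity, partialMoment] using this

omit [IsProbabilityMeasure μ] in
lemma condMean_eq (h : JointDensity μ α L 𝒳 X Y f) {x : EuclideanSpace ℝ (Fin D)}
    (hx : x ∈ 𝒳) : condMean f x = partialMoment f L 1 x / partialMoment f L 0 x := by
  rw [condMean, h.margDensity_eq hx, h.integral_mul_eq hx fun y => y]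
  simp [partialMoment]

omit [IsProbabilityMeasure μ] in
lemma integrableOn_section (h : JointDensity μ α L 𝒳 X Y f) {x : EuclideanSpace ℝ (Fin D)}
    (hx : x ∈ 𝒳) (j : ℕ) : IntegrableOn (fun y => y ^ j * f (x, y)) (Icc (-L) L) := by
  obtain ⟨C, hC0, hC⟩ := h.exists_bound
  have hm := h.measurable_f
  refine Measure.integrableOn_of_bounded (M := L ^ j * C) (by simp)
    (by fun_prop : Measurable fun y => y ^ j * f (x, y)).aestronglyMeasurable ?_
  refine (ae_restrict_iff' measurableSet_Icc).2 (ae_of_all _ fun y hy => ?_)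
  rw [norm_mul, norm_pow, Real.norm_eq_abs, Real.norm_eq_abs, abs_of_nonneg (h.nonneg _)]
  have hL := h.L_pos
  exact mul_le_mul (pow_le_pow_left₀ (abs_nonneg _) (abs_le.2 hy) j) (hC x hx y hy)
    (h.nonneg _) (by positivity)

omit [IsProbabilityMeasure μ] in
lemma condVar_eq (h : JointDensity μ α L 𝒳 X Y f) {x : EuclideanSpace ℝ (Fin D)}
    (hx : x ∈ 𝒳) : condVar f x = (partialMoment f L 2 x - 2 * condMean f x * partialMoment f L 1 x +
      condMean f x ^ 2 * partialMoment f L 0 x) / partialMoment f L 0 x := by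
  set m := condMean f x with hm
  rw [condVar, h.margDensity_eq hx, ← hm, h.integral_mul_eq hx fun y => (y - m) ^ 2]
  congr 1
  have i0 := h.integrableOn_section hx 0
  have i1 := h.integrableOn_section hx 1
  have i2 := h.integrableOn_section hx 2
  have i3 : IntegrableOn (fun y => y ^ 2 * f (x, y) - 2 * m * (y ^ 1 * f (x, y))) (Icc (-L) L) :=
    i2.sub (i1.const_mul _)
  simp only [partialMoment]
  rw [← integral_const_mul, ← integral_const_mul, ← integral_sub i2 (i1.const_mul _),
    ← integral_add i3 (i0.const_mul _)]
  congr 1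
  ext y
  simp
  ring

omit [IsProbabilityMeasure μ] in
lemma abs_partialMoment_le (h : JointDensity μ α L 𝒳 X Y f) :
    ∃ C, 0 ≤ C ∧ ∀ x ∈ 𝒳, ∀ j ≤ 2, |partialMoment f L j x| ≤ C := by
  obtain ⟨C, hC0, hC⟩ := h.exists_bound
  have hL := h.L_pos
  refine ⟨(1 + L) ^ 2 * C * (2 * L), by positivity, fun x hx j hj => ?_⟩
  have := norm_setIntegral_le_of_norm_le_const (μ := volume) (s := Icc (-L) L)
    (f := fun y => y ^ j * f (x, y)) (C := (1 + L) ^ 2 * C) (by simp) fun y hy => ?_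
  · rw [Real.volume_real_Icc_of_le (by linarith)] at this
    refine this.trans (le_of_eq ?_)
    ring
  · rw [norm_mul, norm_pow, Real.norm_eq_abs, Real.norm_eq_abs, abs_of_nonneg (h.nonneg _)]
    refine mul_le_mul ?_ (hC x hx y hy) (h.nonneg _) (by positivity)
    have h1 : |y| ^ j ≤ (1 + L) ^ j :=
      pow_le_pow_left₀ (abs_nonneg _) ((abs_le.2 hy).trans (by linarith)) j
    exact h1.trans (pow_le_pow_right₀ (by linarith) hj)

lemma integrable (h : JointDensity μ α L 𝒳 X Y f) : Integrable f := by
  have hm := h.measurable_f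
  refine ⟨hm.aestronglyMeasurable, ?_⟩
  rw [hasFiniteIntegral_iff_ofReal (ae_of_all _ h.nonneg)]
  have : μ.map (fun ω => (X 0 ω, Y 0 ω)) univ = 1 := by
    rw [Measure.map_apply ((h.measurable_X 0).prodMk (h.measurable_Y 0)) MeasurableSet.univ]
    simp
  rw [h.law 0, withDensity_apply _ MeasurableSet.univ, Measure.restrict_univ] at this
  rw [this]
  exact ENNReal.one_lt_top

-- Since `Y i` takes values in `[-L, L]`, the power may be truncated there, which makes the second
-- factor bounded. The right-hand side does not depend on `i`, so the expectations are stationary.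
omit [IsProbabilityMeasure μ] in
lemma expectation_eq (h : JointDensity μ α L 𝒳 X Y f) {κ : EuclideanSpace ℝ (Fin D) → ℝ}
    (hκ : Measurable κ) (i j : ℕ) :
    ∫ ω, κ (X i ω) * Y i ω ^ j ∂μ =
      ∫ p : EuclideanSpace ℝ (Fin D) × ℝ,
        f p * (κ p.1 * (Icc (-L) L).indicator (fun y => y ^ j) p.2) := by
  have hq : Measurable ((Icc (-L) L).indicator fun y : ℝ => y ^ j) :=
    (by fun_prop : Measurable fun y : ℝ => y ^ j).indicator measurableSet_Icc
  have hm := h.measurable_f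
  have h1 : ∫ ω, κ (X i ω) * Y i ω ^ j ∂μ = ∫ p : EuclideanSpace ℝ (Fin D) × ℝ,
      κ p.1 * (Icc (-L) L).indicator (fun y => y ^ j) p.2 ∂(μ.map fun ω => (X i ω, Y i ω)) := by
    rw [integral_map ((h.measurable_X i).prodMk (h.measurable_Y i)).aemeasurable
      (by fun_prop : Measurable fun p : EuclideanSpace ℝ (Fin D) × ℝ =>
        κ p.1 * (Icc (-L) L).indicator (fun y => y ^ j) p.2).aestronglyMeasurable]
    congr 1
    ext ω
    rw [indicator_of_mem (h.Y_mem i ω)]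
  rw [h1, h.law i, integral_withDensity_eq_integral_toReal_smul (by fun_prop)
    (ae_of_all _ fun _ => ENNReal.ofReal_lt_top)]
  congr 1
  ext p
  rw [ENNReal.toReal_ofReal (h.nonneg p), smul_eq_mul]

lemma _root_.KernelAssumptions.integrable {K : EuclideanSpace ℝ (Fin D) → ℝ}
    (hK : KernelAssumptions α K) : Integrable K := by
  by_contra hn
  have := hK.integral_one
  rw [integral_undef hn] at this
  exact zero_ne_one this

lemma _root_.KernelAssumptions.measurable {K : EuclideanSpace ℝ (Fin D) → ℝ}
    (hK : KernelAssumptions α K) : Measurable K := by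
  obtain ⟨C, hC⟩ := hK.lipschitz
  exact hC.continuous.measurable

lemma _root_.KernelAssumptions.integral_scaled {K : EuclideanSpace ℝ (Fin D) → ℝ}
    (hK : KernelAssumptions α K) {h : ℝ} (hh : 0 < h) (z : EuclideanSpace ℝ (Fin D)) :
    ∫ u, K (h⁻¹ • (u - z)) = h ^ D := by
  rw [integral_sub_right_eq_self (fun u => K (h⁻¹ • u)) z, Measure.integral_comp_inv_smul,
    hK.integral_one, finrank_euclideanSpace_fin, abs_of_pos (pow_pos hh D), smul_eq_mul, mul_one]

lemma _root_.KernelAssumptions.integrable_scaled {K : EuclideanSpace ℝ (Fin D) → ℝ}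
    (hK : KernelAssumptions α K) {h : ℝ} (hh : 0 < h) (z : EuclideanSpace ℝ (Fin D)) :
    Integrable fun u => K (h⁻¹ • (u - z)) :=
  (hK.integrable.comp_smul (inv_ne_zero hh.ne')).comp_sub_right z

/-- The bias of the kernel averages, uniformly over points `z` at distance `O(h)` from `x ∈ 𝒳`. -/
lemma exists_bias_le (hd : JointDensity μ α L 𝒳 X Y f) {K : EuclideanSpace ℝ (Fin D) → ℝ}
    (hK : KernelAssumptions α K) {M : ℝ} (hM0 : 0 < M)
    (hM : Function.support K ⊆ Metric.closedBall 0 M) (M' : ℝ) :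
    ∃ C h₀, 0 ≤ C ∧ 0 < h₀ ∧ ∀ h, 0 < h → h ≤ h₀ → ∀ x ∈ 𝒳, ∀ z, ‖z - x‖ ≤ M' * h →
      ∀ i, ∀ j ≤ 2, |∫ ω, K (h⁻¹ • (X i ω - z)) * Y i ω ^ j ∂μ - h ^ D * partialMoment f L j x| ≤
        C * h ^ α * h ^ D := by
  obtain ⟨c, r, hc, hr, hhol⟩ := hd.holder
  have hL := hd.L_pos
  -- Points where the kernel around `z` is non-zero lie within `(M + |M'|) h` of `x`; the bound on
  -- `h` keeps `A h` below the Hölder radius.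
  set A := M + |M'| + 1 with hA
  have hA0 : 0 < A := by positivity
  refine ⟨(1 + L) ^ 2 * c * A ^ α * (2 * L), r / (2 * A), by positivity, by positivity,
    fun h hh0 hh x hx z hz i j hj => ?_⟩
  have hAr : A * h < r := by
    have := mul_le_mul_of_nonneg_left hh hA0.le
    have e : A * (r / (2 * A)) = r / 2 := by field_simp
    linarith
  set κ : EuclideanSpace ℝ (Fin D) → ℝ := fun u => K (h⁻¹ • (u - z)) with hκ
  set q : ℝ → ℝ := (Icc (-L) L).indicator fun y => y ^ j with hq
  have hκm : Measurable κ := hK.measurable.comp (by fun_prop)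
  have hκ0 : ∀ u, 0 ≤ κ u := fun u => hK.nonneg _
  have hκi : Integrable κ := hK.integrable_scaled hh0 z
  have hκs : ∀ u, κ u ≠ 0 → ‖u - x‖ ≤ A * h := by
    intro u hu
    have h1 : h⁻¹ • (u - z) ∈ Metric.closedBall 0 M := hM hu
    rw [mem_closedBall_zero_iff, norm_smul, norm_inv, Real.norm_eq_abs, abs_of_pos hh0,
      inv_mul_le_iff₀ hh0] at h1
    have h2 := norm_sub_le_norm_sub_add_norm_sub u z x
    have h3 : M' * h ≤ |M'| * h := mul_le_mul_of_nonneg_right (le_abs_self _) hh0.le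
    rw [hA]; nlinarith
  have hqm : Measurable q := (by fun_prop : Measurable fun y : ℝ => y ^ j).indicator
    measurableSet_Icc
  have hfm := hd.measurable_f
  have hqL : ∀ y, |q y| ≤ (1 + L) ^ 2 * (Icc (-L) L).indicator (fun _ => (1 : ℝ)) y := by
    intro y
    by_cases hy : y ∈ Icc (-L) L
    · rw [hq, indicator_of_mem hy, indicator_of_mem hy, abs_pow, mul_one]
      exact (pow_le_pow_left₀ (abs_nonneg _) ((abs_le.2 hy).trans (by linarith)) j).trans
        (pow_le_pow_right₀ (by linarith) hj)
    · rw [hq, indicator_of_notMem hy, indicator_of_notMem hy]; simp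
  have hqB : ∀ y, |q y| ≤ (1 + L) ^ 2 := fun y => (hqL y).trans <| by
    refine mul_le_of_le_one_right (by positivity) ?_
    exact indicator_le_self' (fun _ _ => zero_le_one) y |>.trans le_rfl
  obtain ⟨BK, hBK⟩ := hK.bounded
  have hI1 : Integrable fun p : EuclideanSpace ℝ (Fin D) × ℝ => f p * (κ p.1 * q p.2) := by
    simp_rw [mul_comm (f _)]
    refine hd.integrable.bdd_mul (c := BK * (1 + L) ^ 2) ?_ (ae_of_all _ fun p => ?_)
    · exact (by fun_prop : Measurable fun p : EuclideanSpace ℝ (Fin D) × ℝ =>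
        κ p.1 * q p.2).aestronglyMeasurable
    · rw [norm_mul, Real.norm_eq_abs, Real.norm_eq_abs, abs_of_nonneg (hκ0 _)]
      exact mul_le_mul (hBK _) (hqB _) (abs_nonneg _) ((hκ0 p.1).trans (hBK _))
  have hqf : Integrable fun y => q y * f (x, y) := by
    have := (hd.integrableOn_section hx j).integrable_indicator measurableSet_Icc
    refine this.congr (ae_of_all _ fun y => ?_)
    by_cases hy : y ∈ Icc (-L) L
    · simp only [hq, indicator_of_mem hy]
    · simp only [hq, indicator_of_notMem hy, zero_mul]
  have hI2 : Integrable fun p : EuclideanSpace ℝ (Fin D) × ℝ => κ p.1 * (q p.2 * f (x, p.2)) :=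
    hκi.mul_prod hqf
  have hG : h ^ D * partialMoment f L j x =
      ∫ p : EuclideanSpace ℝ (Fin D) × ℝ, κ p.1 * (q p.2 * f (x, p.2)) := by
    rw [Measure.volume_eq_prod, integral_prod_mul κ fun y => q y * f (x, y), hκ, hK.integral_scaled hh0 z,
      partialMoment, ← integral_indicator measurableSet_Icc]
    congr 2
    ext y
    by_cases hy : y ∈ Icc (-L) L
    · simp only [hq, indicator_of_mem hy]
    · simp only [hq, indicator_of_notMem hy, zero_mul]
  have hE := hd.expectation_eq hκm i j
  simp only [hκ] at hE hG
  rw [hE, hG, ← integral_sub hI1 hI2]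
  have hone : Integrable ((Icc (-L) L).indicator fun _ => (1 : ℝ)) :=
    (integrable_indicator_iff measurableSet_Icc).2 (integrableOn_const (by simp))
  have hbd : Integrable fun p : EuclideanSpace ℝ (Fin D) × ℝ =>
      κ p.1 * ((1 + L) ^ 2 * c * (A * h) ^ α * (Icc (-L) L).indicator (fun _ => (1 : ℝ)) p.2) :=
    hκi.mul_prod (hone.const_mul _)
  rw [← Real.norm_eq_abs]
  refine (norm_integral_le_of_norm_le hbd (ae_of_all _ fun p => ?_)).trans (le_of_eq ?_)
  · have e : f p * (κ p.1 * q p.2) - κ p.1 * (q p.2 * f (x, p.2)) =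
        κ p.1 * (q p.2 * (f p - f (x, p.2))) := by ring
    change ‖f p * (κ p.1 * q p.2) - κ p.1 * (q p.2 * f (x, p.2))‖ ≤ _
    rw [e, norm_mul, norm_mul, Real.norm_eq_abs, Real.norm_eq_abs, Real.norm_eq_abs,
      abs_of_nonneg (hκ0 _)]
    by_cases hp : κ p.1 = 0
    · rw [hp]; simp
    have hpx := hκs _ hp
    refine mul_le_mul_of_nonneg_left ?_ (hκ0 _)
    -- The increment moves only the regressor, from a point of `𝒳 × ℝ`, so neither `z` nor `p.1` has
    -- to lie in `𝒳`.
    have hv : ‖((p.1 - x, 0) : EuclideanSpace ℝ (Fin D) × ℝ)‖ = ‖p.1 - x‖ := by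
      simp [Prod.norm_def]
    have h1 := hhol (x, p.2) ⟨hx, mem_univ _⟩ (p.1 - x, 0) (by rw [hv]; linarith)
    rw [hv] at h1
    have h2 : (x, p.2) + (p.1 - x, (0 : ℝ)) = p := by
      ext1 <;> simp
    rw [h2] at h1
    have h3 : c * ‖p.1 - x‖ ^ α ≤ c * (A * h) ^ α :=
      mul_le_mul_of_nonneg_left (Real.rpow_le_rpow (norm_nonneg _) hpx hd.α_pos.le) hc
    calc |q p.2| * |f p - f (x, p.2)| ≤
          (1 + L) ^ 2 * (Icc (-L) L).indicator (fun _ => (1 : ℝ)) p.2 * (c * (A * h) ^ α) :=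
          mul_le_mul (hqL _) (h1.trans h3) (abs_nonneg _)
            ((abs_nonneg _).trans (hqL _))
      _ = _ := by ring
  · rw [Measure.volume_eq_prod, integral_prod_mul κ fun y =>
      (1 + L) ^ 2 * c * (A * h) ^ α * (Icc (-L) L).indicator (fun _ => (1 : ℝ)) y, hκ,
      hK.integral_scaled hh0 z, integral_const_mul, integral_indicator measurableSet_Icc,
      setIntegral_const, Real.volume_real_Icc_of_le (by linarith),
      Real.mul_rpow hA0.le hh0.le, smul_eq_mul]
    ring

end JointDensity

end JointDensity

/-! ### Multi-scale comparison: summable correlations -/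

section MultiScale

/-- A single term `(b x^γ)^m / m!` of the exponential series, with `m ≥ e / γ`, already dominates
`x^e`. -/
lemma exists_exp_neg_mul_rpow_le {b γ : ℝ} (hb : 0 < b) (hγ : 0 < γ) (e : ℝ) :
    ∃ C, 0 < C ∧ ∀ x : ℝ, 1 ≤ x → Real.exp (-b * x ^ γ) * x ^ e ≤ C := by
  obtain ⟨m, hm⟩ := exists_nat_ge (e / γ)
  refine ⟨m.factorial / b ^ m, by positivity, fun x hx => ?_⟩
  have hx0 : 0 < x := by linarith
  have h1 : x ^ e ≤ (x ^ γ) ^ m := by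
    rw [← Real.rpow_natCast, ← Real.rpow_mul hx0.le]
    refine Real.rpow_le_rpow_of_exponent_le hx ?_
    rw [div_le_iff₀ hγ] at hm
    linarith
  have h2 := Real.pow_div_factorial_le_exp (b * x ^ γ) (by positivity) m
  rw [neg_mul, Real.exp_neg, inv_mul_le_iff₀ (Real.exp_pos _)]
  refine h1.trans ?_
  rw [mul_pow] at h2
  have hf : (0 : ℝ) < m.factorial := by positivity
  have hbm : 0 < b ^ m := by positivity
  rw [div_le_iff₀ hf] at h2
  rw [← mul_div_assoc, le_div_iff₀ hbm]
  linarith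

/-- A stationary regression sample whose first `N` observations, enumerated by `τ N`, satisfy the
`𝒞`-mixing inequality. -/
structure MixingRegression {Ω : Type*} [MeasurableSpace Ω] (μ : Measure Ω) {D : ℕ}
    (α b γ L : ℝ) {S : Set (EuclideanSpace ℝ (Fin D))} (𝒳 : Set (EuclideanSpace ℝ (Fin D)))
    (𝒞S : CSpace S) (𝒞Z : CSpace (S × Icc (-L) L)) (Z : ℕ → Ω → S × Icc (-L) L)
    (X : ℕ → Ω → EuclideanSpace ℝ (Fin D)) (Y : ℕ → Ω → ℝ)
    (f : EuclideanSpace ℝ (Fin D) × ℝ → ℝ) (K : EuclideanSpace ℝ (Fin D) → ℝ)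
    (τ : ℕ → ℕ → ℕ) : Prop extends JointDensity μ α L 𝒳 X Y f where
  D_pos : 0 < D
  b_pos : 0 < b
  γ_pos : 0 < γ
  one_le_L : 1 ≤ L
  X_eq : ∀ i ω, X i ω = ((Z i ω).1 : EuclideanSpace ℝ (Fin D))
  Y_eq : ∀ i ω, Y i ω = ((Z i ω).2 : ℝ)
  measurable_Z : ∀ i, Measurable (Z i)
  semi : SeminormAssumptions 𝒞S 𝒞Z
  kernel : KernelAssumptions α K
  mixing : ∀ N, WindowMixing μ 𝒞Z b γ (fun i => Z (τ N i)) N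
  sum_reindex : ∀ (N : ℕ) (x : ℕ → ℝ),
    ∑ i ∈ Finset.range N, x (τ N i) = ∑ i ∈ Finset.range N, x i

/-- Bandwidths between `(log N / N)^(1/(2α+D))` and a negative power of `N`. -/
structure AdmissibleBandwidth (α : ℝ) (D : ℕ) (h : ℕ → ℝ) (a : ℝ) : Prop where
  a_pos : 0 < a
  eventually : ∀ᶠ N : ℕ in atTop, 0 < h N ∧ h N ≤ (N : ℝ) ^ (-a) ∧
    Real.log N ≤ N * h N ^ (2 * α + D)

/-- For `N ≥ 3` one has `log N ≥ 1`, so `N h^{2α+D} ≥ 1`. This polynomial bound on `1 / h` is what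
allows mixing errors to be compared with powers of `h`. -/
lemma AdmissibleBandwidth.eventually_inv_le {α : ℝ} (hα : 0 < α) {D : ℕ} {h : ℕ → ℝ} {a : ℝ}
    (hb : AdmissibleBandwidth α D h a) :
    ∀ᶠ N : ℕ in atTop, (h N)⁻¹ ≤ (N : ℝ) ^ (1 / (2 * α + D)) := by
  filter_upwards [hb.eventually, eventually_ge_atTop 3] with N ⟨h0, _, h2⟩ h3
  have hN : (3 : ℝ) ≤ N := by exact_mod_cast h3
  have hlog : 1 ≤ Real.log N := by
    rw [Real.le_log_iff_exp_le (by linarith)]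
    linarith [Real.exp_one_lt_d9]
  have hp : 0 < 2 * α + D := by positivity
  have h4 : (h N)⁻¹ ^ (2 * α + D) ≤ N := by
    rw [Real.inv_rpow h0.le, inv_le_iff_one_le_mul₀ (by positivity)]
    linarith
  calc (h N)⁻¹ = ((h N)⁻¹ ^ (2 * α + D)) ^ (1 / (2 * α + D)) := by
        rw [← Real.rpow_mul (by positivity), mul_one_div_cancel hp.ne', Real.rpow_one]
    _ ≤ _ := Real.rpow_le_rpow (by positivity) h4 (by positivity)

/-- A continuous kernel of integral one is bounded below on some ball, not necessarily around the
origin. Rescaled, it serves as a majorant for finer kernels. -/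
lemma KernelAssumptions.exists_ball {D : ℕ} {α : ℝ} {K : EuclideanSpace ℝ (Fin D) → ℝ}
    (hK : KernelAssumptions α K) :
    ∃ u₀ c r, 0 < c ∧ 0 < r ∧ ∀ u, ‖u - u₀‖ ≤ r → c ≤ K u := by
  have : ∃ u₀, K u₀ ≠ 0 := by
    by_contra! hcon
    have := hK.integral_one
    simp [hcon] at this
  obtain ⟨u₀, hu₀⟩ := this
  have hpos : 0 < K u₀ := lt_of_le_of_ne (hK.nonneg _) (Ne.symm hu₀)
  obtain ⟨C, hC⟩ := hK.lipschitz
  have hev : ∀ᶠ u in nhds u₀, K u₀ / 2 < K u :=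
    hC.continuous.continuousAt.eventually (lt_mem_nhds (by linarith))
  obtain ⟨r, hr, hball⟩ := Metric.eventually_nhds_iff.1 hev
  refine ⟨u₀, K u₀ / 2, r / 2, by linarith, by linarith, fun u hu => (hball ?_).le⟩
  rw [dist_eq_norm]; linarith

namespace MixingRegression

variable {Ω : Type*} [MeasurableSpace Ω] {μ : Measure Ω} [IsProbabilityMeasure μ] {D : ℕ}
  {α b γ L : ℝ} {S 𝒳 : Set (EuclideanSpace ℝ (Fin D))}
  {𝒞S : CSpace S} {𝒞Z : CSpace (S × Icc (-L) L)} {Z : ℕ → Ω → S × Icc (-L) L}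
  {X : ℕ → Ω → EuclideanSpace ℝ (Fin D)} {Y : ℕ → Ω → ℝ}
  {f : EuclideanSpace ℝ (Fin D) × ℝ → ℝ} {K : EuclideanSpace ℝ (Fin D) → ℝ} {τ : ℕ → ℕ → ℕ}

lemma exists_mean_le (hs : MixingRegression μ α b γ L 𝒳 𝒞S 𝒞Z Z X Y f K τ) {h : ℕ → ℝ} {a : ℝ}
    (hh : AdmissibleBandwidth α D h a) (M' : ℝ) :
    ∃ C, 0 ≤ C ∧ ∀ᶠ n : ℕ in atTop, ∀ x ∈ 𝒳, ∀ z, ‖z - x‖ ≤ M' * h n → ∀ i,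
      ∫ ω, K ((h n)⁻¹ • (X i ω - z)) ∂μ ≤ C * h n ^ D := by
  obtain ⟨M, hM0, hM⟩ := hs.kernel.support_subset
  obtain ⟨C, h₀, hC, hh₀, hbias⟩ := hs.toJointDensity.exists_bias_le hs.kernel hM0 hM M'
  obtain ⟨C', hC', hmom⟩ := hs.toJointDensity.abs_partialMoment_le
  have hlim : Tendsto (fun n : ℕ => (n : ℝ) ^ (-a)) atTop (nhds 0) :=
    (tendsto_rpow_neg_atTop hh.a_pos).comp tendsto_natCast_atTop_atTop
  refine ⟨C + C', by positivity, ?_⟩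
  filter_upwards [hh.eventually, hlim.eventually (gt_mem_nhds hh₀),
    hlim.eventually (gt_mem_nhds one_pos)] with n ⟨h0, h1, _⟩ h2 h3 x hx z hz i
  have := hbias (h n) h0 (h1.trans h2.le) x hx z hz i 0 (by norm_num)
  simp only [pow_zero, mul_one] at this
  have h4 := (abs_le.1 this).2
  have h5 := (abs_le.1 (hmom x hx 0 (by norm_num))).2
  have h6 : h n ^ α ≤ 1 := Real.rpow_le_one h0.le (h1.trans h3.le) hs.α_pos.le
  have h7 : 0 ≤ h n ^ D := by positivity
  have h8 : C * h n ^ α * h n ^ D ≤ C * h n ^ D :=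
    mul_le_mul_of_nonneg_right (mul_le_of_le_one_right hC h6) h7
  have h9 := mul_le_mul_of_nonneg_left h5 h7
  linarith

/-- Kernel averages at scale `h n`, given the past: the direct estimate from the seminorm. -/
lemma exists_past_mean_le (hs : MixingRegression μ α b γ L 𝒳 𝒞S 𝒞Z Z X Y f K τ) {h : ℕ → ℝ}
    {a κ : ℝ} (hh : AdmissibleBandwidth α D h a) (hκ : 0 < κ)
    (hgrow : ∀ᶠ n : ℕ in atTop, ∀ x : EuclideanSpace ℝ (Fin D),
      𝒞S.SemiLE (fun s => K ((h n)⁻¹ • ((s : EuclideanSpace ℝ (Fin D)) - x))) ((n : ℝ) ^ κ))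
    (M' : ℝ) :
    ∃ C, 0 ≤ C ∧ ∀ᶠ n : ℕ in atTop, ∀ x ∈ 𝒳, ∀ z, ‖z - x‖ ≤ M' * h n →
      ∀ (N : ℕ) (U : Finset ℕ) (i ρ : ℕ), i < N → 0 < ρ → (∀ u ∈ U, u + ρ ≤ i) →
      ∀ F, IsWeight (fun i => Z (τ N i)) U F →
        ∫ ω, F ω * K ((h n)⁻¹ • (X (τ N i) ω - z)) ∂μ ≤
          C * (h n ^ D + Real.exp (-b * (ρ : ℝ) ^ γ) * (n : ℝ) ^ κ) * ∫ ω, F ω ∂μ := by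
  obtain ⟨C, hC, hmean⟩ := hs.exists_mean_le hh M'
  obtain ⟨B, hB⟩ := hs.kernel.bounded
  have hB0 : 0 ≤ B := (hs.kernel.nonneg 0).trans (hB 0)
  refine ⟨C + B + 1, by positivity, ?_⟩
  filter_upwards [hmean, hgrow, eventually_ge_atTop 1, hh.eventually] with n hm hg hn ⟨h0, _⟩ x hx z
    hz N U i ρ hi hρ hU F hF
  have hn1 : (1 : ℝ) ≤ (n : ℝ) ^ κ := Real.one_le_rpow (by exact_mod_cast hn) hκ.le
  have hlift : 𝒞Z.SemiLE
      (fun z' => K ((h n)⁻¹ • ((z'.1 : EuclideanSpace ℝ (Fin D)) - z))) ((n : ℝ) ^ κ) :=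
    (hs.semi.lift_le ⟨_, (hg z).1⟩).mono (hg z).2
  -- The scale index `n` is independent of the window length `N`, so that a coarser kernel can later
  -- be tested on the same window.
  have happ : 𝒞Z.Approx (fun z' => K ((h n)⁻¹ • ((z'.1 : EuclideanSpace ℝ (Fin D)) - z))) 0
      (B + (n : ℝ) ^ κ) := hlift.approx hB0
    (fun z' => by rw [abs_of_nonneg (hs.kernel.nonneg _)]; exact hB _) fun z' => by simp
  have hKm := hs.kernel.measurable
  have key := happ.mean_le (by fun_prop) (fun i => hs.measurable_Z (τ N i)) (hs.mixing N) hi hρ hU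
    hF
  simp only [← hs.X_eq] at key
  refine key.trans (mul_le_mul_of_nonneg_right ?_ hF.integral_nonneg)
  have h1 := hm x hx z hz (τ N i)
  have h2 := Real.exp_pos (-b * (ρ : ℝ) ^ γ)
  have h3 : 0 < h n ^ D := by positivity
  have h4 : B + (n : ℝ) ^ κ ≤ (C + B + 1) * (n : ℝ) ^ κ := by nlinarith
  have h5 := mul_le_mul_of_nonneg_left h4 h2.le
  nlinarith [mul_nonneg hB0 h3.le]

set_option maxHeartbeats 1000000 in
/-- Kernel averages given the past: comparing with bumps at the larger scale `h (ρ ^ n)` shows that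
correlations at lag `ρ` are summable uniformly in the bandwidth. -/
lemma exists_past_mean_le_summable (hs : MixingRegression μ α b γ L 𝒳 𝒞S 𝒞Z Z X Y f K τ)
    {h : ℕ → ℝ} {a κ : ℝ} (hh : AdmissibleBandwidth α D h a) (hκ : 0 < κ)
    (hgrow : ∀ᶠ n : ℕ in atTop, ∀ x : EuclideanSpace ℝ (Fin D),
      𝒞S.SemiLE (fun s => K ((h n)⁻¹ • ((s : EuclideanSpace ℝ (Fin D)) - x))) ((n : ℝ) ^ κ))
    {M' : ℝ} (hM'0 : 0 ≤ M') :
    ∃ W, 0 ≤ W ∧ ∀ᶠ N : ℕ in atTop, ∀ x ∈ 𝒳, ∀ z, ‖z - x‖ ≤ M' * h N →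
      ∀ (U : Finset ℕ) (i ρ : ℕ), i < N → 0 < ρ → (∀ u ∈ U, u + ρ ≤ i) →
      ∀ F, IsWeight (fun i => Z (τ N i)) U F →
        ∫ ω, F ω * K ((h N)⁻¹ • (X (τ N i) ω - z)) ∂μ ≤
          W * (h N ^ D + 1 / ((ρ : ℝ) + 1) ^ 2) * ∫ ω, F ω ∂μ := by
  obtain ⟨M, hM0, hM⟩ := hs.kernel.support_subset
  obtain ⟨u₀, c, r, hc, hr, hball⟩ := hs.kernel.exists_ball
  obtain ⟨B, hB⟩ := hs.kernel.bounded
  have hB0 : 0 ≤ B := (hs.kernel.nonneg 0).trans (hB 0)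
  have hbp := hs.b_pos
  -- Large enough both for `z` itself at scale `h N` and, at the coarse scale `s`, for the shifted
  -- centre `z - s • u₀` when `h N ≤ (r / M) s`.
  set M'' := M' + M' * (r / M) + ‖u₀‖ with hM''
  obtain ⟨C, hC, hpast⟩ := hs.exists_past_mean_le hh hκ hgrow M''
  obtain ⟨n₁, hn₁⟩ := eventually_atTop.1
    (hpast.and (hh.eventually.and (hh.eventually_inv_le hs.α_pos)))
  -- With this `n`, `h (ρ ^ n) ≤ ρ ^ (-a n) ≤ ρ⁻²`: the mean of the coarse bump is summable in the
  -- lag.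
  obtain ⟨n, hn⟩ := exists_nat_ge (2 / a)
  have ha := hh.a_pos
  have hn0 : 0 < n := by
    have : (0 : ℝ) < n := lt_of_lt_of_le (by positivity) hn
    exact_mod_cast this
  set p := 1 / (2 * α + D) with hp
  have hp0 : 0 < p := by have := hs.α_pos; positivity
  clear_value p
  -- The two exponents are the powers of `ρ` that bound the seminorm growth at the coarse scale and
  -- at scale `N` respectively, each increased by 2 for summability.
  obtain ⟨C₁, hC₁0, hC₁⟩ := exists_exp_neg_mul_rpow_le hs.b_pos hs.γ_pos (n * κ + 2)
  obtain ⟨C₂, hC₂0, hC₂⟩ := exists_exp_neg_mul_rpow_le hs.b_pos hs.γ_pos (n * p / a * κ + 2)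
  set C₃ := (M / r) ^ (1 / a * κ) with hC₃
  have hC₃0 : 0 < C₃ := by positivity
  clear_value C₃
  refine ⟨B * ((n₁ : ℝ) + 1) ^ 2 + 4 * (B / c * C * (1 + C₁)) + C + 4 * (C * (C₃ * C₂)),
    by positivity, ?_⟩
  set W := B * ((n₁ : ℝ) + 1) ^ 2 + 4 * (B / c * C * (1 + C₁)) + C + 4 * (C * (C₃ * C₂)) with hW
  have hW0 : 0 ≤ W := by positivity
  clear_value W
  filter_upwards [eventually_ge_atTop n₁, eventually_ge_atTop 1] with N hN hN1 x hx z hz U i ρ hi hρ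
    hU F hF
  obtain ⟨hpastN, ⟨hN0, hNa, -⟩, -⟩ := hn₁ N hN
  have hρ1 : (1 : ℝ) ≤ ρ := by exact_mod_cast hρ
  have hρ0 : (0 : ℝ) < ρ := by linarith
  have hKm := hs.kernel.measurable
  have hF0 := hF.integral_nonneg (μ := μ)
  have hZm : ∀ i, Measurable ((fun i => Z (τ N i)) i) := fun i => hs.measurable_Z _
  have hXm := hs.measurable_X (τ N i)
  have hρ4 : 1 / (ρ : ℝ) ^ 2 ≤ 4 * (1 / ((ρ : ℝ) + 1) ^ 2) := by
    rw [mul_one_div, div_le_div_iff₀ (by positivity) (by positivity)]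
    have : ((ρ : ℝ) + 1) ^ 2 ≤ (2 * ρ) ^ 2 := pow_le_pow_left₀ (by positivity) (by linarith) 2
    linarith
  have hhD : 0 ≤ h N ^ D := by positivity
  have hlag : 0 ≤ 1 / ((ρ : ℝ) + 1) ^ 2 := by positivity
  have hint : ∀ (s : ℝ) (z : EuclideanSpace ℝ (Fin D)),
      Integrable (fun ω => F ω * K (s⁻¹ • (X (τ N i) ω - z))) μ := fun s z =>
    hF.integrable_mul hZm (by fun_prop : Measurable fun ω => K (s⁻¹ • (X (τ N i) ω - z)))
      fun ω => by rw [abs_of_nonneg (hs.kernel.nonneg _)]; exact hB _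
  have hsplit : ∀ e : ℝ, (ρ : ℝ) ^ (e + 2) = (ρ : ℝ) ^ e * ρ ^ 2 := fun e => by
    rw [Real.rpow_add hρ0]; norm_cast
  -- Finitely many lags, for which the asymptotic bounds may fail at scale `ρ ^ n`; the trivial
  -- bound by `B` suffices.
  by_cases hsmall : ρ ^ n < n₁
  · have hρn : ρ < n₁ := (Nat.le_self_pow hn0.ne' ρ).trans_lt hsmall
    have hρn' : (ρ : ℝ) < n₁ := by exact_mod_cast hρn
    have h1 : ∫ ω, F ω * K ((h N)⁻¹ • (X (τ N i) ω - z)) ∂μ ≤ B * ∫ ω, F ω ∂μ := by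
      rw [← integral_const_mul]
      refine integral_mono (hint _ _) ((hF.integrable hZm).const_mul B) fun ω => ?_
      have := mul_le_mul_of_nonneg_left (hB ((h N)⁻¹ • (X (τ N i) ω - z))) (hF.nonneg ω)
      simpa [mul_comm] using this
    refine h1.trans (mul_le_mul_of_nonneg_right ?_ hF0)
    have h2 : B ≤ B * ((n₁ : ℝ) + 1) ^ 2 * (1 / ((ρ : ℝ) + 1) ^ 2) := by
      rw [mul_one_div, le_div_iff₀ (by positivity)]
      exact mul_le_mul_of_nonneg_left (pow_le_pow_left₀ (by positivity) (by linarith) 2) hB0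
    have h3 : B * ((n₁ : ℝ) + 1) ^ 2 ≤ W := by
      rw [hW]
      have : 0 ≤ 4 * (B / c * C * (1 + C₁)) + C + 4 * (C * (C₃ * C₂)) := by positivity
      linarith
    rw [mul_add]
    linarith [mul_le_mul_of_nonneg_right h3 hlag, mul_nonneg hW0 hhD]
  · push Not at hsmall
    obtain ⟨hpast', ⟨hs0, hsa, -⟩, hinv⟩ := hn₁ _ hsmall
    set s := h (ρ ^ n) with hsdef
    have hcast : ((ρ ^ n : ℕ) : ℝ) = (ρ : ℝ) ^ (n : ℝ) := by
      rw [Real.rpow_natCast]; push_cast; rfl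
    rw [hcast] at hsa hinv hpast'
    -- Fine kernel, coarse lag scale: the support of the fine kernel fits into the ball of radius `r
    -- s` around `z`, on which the coarse bump centred at `z - s • u₀` is at least `c`.
    by_cases hcase : M * h N ≤ r * s
    · have hz' : ‖z - s • u₀ - x‖ ≤ M'' * s := by
        have e : z - s • u₀ - x = (z - x) - s • u₀ := by abel
        rw [e]
        refine (norm_sub_le _ _).trans ?_
        rw [norm_smul, Real.norm_eq_abs, abs_of_pos hs0]
        have h1 : h N ≤ r / M * s := by
          rw [div_mul_eq_mul_div, le_div_iff₀ hM0]; linarith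
        have h2 := mul_le_mul_of_nonneg_left h1 hM'0
        rw [hM'', add_mul, add_mul]
        linarith [mul_nonneg hM'0 hs0.le]
      have hcmp : ∀ ω, F ω * K ((h N)⁻¹ • (X (τ N i) ω - z)) ≤
          B / c * (F ω * K (s⁻¹ • (X (τ N i) ω - (z - s • u₀)))) := by
        intro ω
        set u := X (τ N i) ω
        by_cases hu : K ((h N)⁻¹ • (u - z)) = 0
        · rw [hu, mul_zero]
          have := hs.kernel.nonneg (s⁻¹ • (u - (z - s • u₀)))
          have := hF.nonneg ω
          positivity
        have h1 : (h N)⁻¹ • (u - z) ∈ Metric.closedBall 0 M := hM hu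
        rw [mem_closedBall_zero_iff, norm_smul, norm_inv, Real.norm_eq_abs, abs_of_pos hN0,
          inv_mul_le_iff₀ hN0] at h1
        have h2 : c ≤ K (s⁻¹ • (u - (z - s • u₀))) := by
          refine hball _ ?_
          have e : s⁻¹ • (u - (z - s • u₀)) - u₀ = s⁻¹ • (u - z) := by
            rw [sub_sub_eq_add_sub, add_sub_right_comm, smul_add, smul_smul, inv_mul_cancel₀ hs0.ne',
              one_smul, add_sub_cancel_right]
          rw [e, norm_smul, norm_inv, Real.norm_eq_abs, abs_of_pos hs0, inv_mul_le_iff₀ hs0]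
          linarith
        have h3 : K ((h N)⁻¹ • (u - z)) ≤ B / c * K (s⁻¹ • (u - (z - s • u₀))) := by
          refine (hB _).trans ?_
          rw [div_mul_eq_mul_div, le_div_iff₀ hc]
          exact mul_le_mul_of_nonneg_left h2 hB0
        have := mul_le_mul_of_nonneg_left h3 (hF.nonneg ω)
        linarith
      have h1 : ∫ ω, F ω * K ((h N)⁻¹ • (X (τ N i) ω - z)) ∂μ ≤
          B / c * ∫ ω, F ω * K (s⁻¹ • (X (τ N i) ω - (z - s • u₀))) ∂μ := by
        rw [← integral_const_mul]
        exact integral_mono (hint _ _) ((hint _ _).const_mul _) hcmp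
      have h2 := hpast' x hx (z - s • u₀) hz' N U i ρ hi hρ hU F hF
      have h3 : s ^ D + Real.exp (-b * (ρ : ℝ) ^ γ) * ((ρ : ℝ) ^ (n : ℝ)) ^ κ ≤
          (1 + C₁) * (1 / (ρ : ℝ) ^ 2) := by
        have h4 : s ^ D ≤ 1 / (ρ : ℝ) ^ 2 := by
          have hs1 : s ≤ 1 / (ρ : ℝ) ^ 2 := by
            refine hsa.trans ?_
            rw [← Real.rpow_mul hρ0.le, one_div, ← Real.rpow_natCast, ← Real.rpow_neg hρ0.le]
            refine Real.rpow_le_rpow_of_exponent_le hρ1 ?_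
            rw [div_le_iff₀ ha] at hn
            push_cast
            linarith
          have hle1 : s ≤ 1 := hs1.trans (by
            rw [div_le_one (by positivity)]; exact one_le_pow₀ hρ1)
          exact (pow_le_of_le_one hs0.le hle1 hs.D_pos.ne').trans hs1
        have h5 := hC₁ ρ hρ1
        rw [hsplit, Real.rpow_mul hρ0.le] at h5
        have h6 : Real.exp (-b * (ρ : ℝ) ^ γ) * ((ρ : ℝ) ^ (n : ℝ)) ^ κ ≤ C₁ * (1 / (ρ : ℝ) ^ 2) := by
          rw [mul_one_div, le_div_iff₀ (by positivity)]
          linarith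
        linarith
      refine h1.trans ((mul_le_mul_of_nonneg_left h2 (by positivity)).trans ?_)
      rw [← mul_assoc]
      refine mul_le_mul_of_nonneg_right ?_ hF0
      calc B / c * (C * (s ^ D + Real.exp (-b * (ρ : ℝ) ^ γ) * ((ρ : ℝ) ^ (n : ℝ)) ^ κ)) ≤
            B / c * (C * ((1 + C₁) * (4 * (1 / ((ρ : ℝ) + 1) ^ 2)))) := by
            gcongr
            refine h3.trans ?_
            gcongr
        _ = 4 * (B / c * C * (1 + C₁)) * (1 / ((ρ : ℝ) + 1) ^ 2) := by ring
        _ ≤ W * (1 / ((ρ : ℝ) + 1) ^ 2) := by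
            refine mul_le_mul_of_nonneg_right ?_ hlag
            rw [hW]
            have : 0 ≤ B * ((n₁ : ℝ) + 1) ^ 2 + C + 4 * (C * (C₃ * C₂)) := by positivity
            linarith
        _ ≤ _ := by
            refine mul_le_mul_of_nonneg_left (by linarith) (by positivity)
    -- Here `h N` is not much smaller than `s`, so `N` itself is at most a power of `ρ` up to a
    -- constant, and the direct estimate at scale `N` suffices.
    · push Not at hcase
      have hN1' : (1 : ℝ) ≤ N := by exact_mod_cast hN1
      have hN0' : (0 : ℝ) < N := by linarith
      have hNpow : (N : ℝ) ^ κ ≤ C₃ * (ρ : ℝ) ^ (n * p / a * κ) := by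
        have h1 : (N : ℝ) ^ a ≤ M / r * ((ρ : ℝ) ^ (n : ℝ)) ^ p := by
          rw [Real.rpow_neg hN0'.le] at hNa
          have h2 : (N : ℝ) ^ a ≤ (h N)⁻¹ := by
            rw [le_inv_comm₀ (by positivity) hN0]; exact hNa
          have h3 : (h N)⁻¹ ≤ M / r * s⁻¹ := by
            rw [div_mul_eq_mul_div, le_div_iff₀ hr, inv_mul_le_iff₀ hN0, ← div_eq_mul_inv, mul_div,
              le_div_iff₀ hs0]
            linarith
          exact h2.trans (h3.trans (mul_le_mul_of_nonneg_left hinv (by positivity)))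
        calc (N : ℝ) ^ κ = ((N : ℝ) ^ a) ^ (1 / a * κ) := by
              rw [← Real.rpow_mul hN0'.le]; congr 1; field_simp
          _ ≤ (M / r * ((ρ : ℝ) ^ (n : ℝ)) ^ p) ^ (1 / a * κ) :=
              Real.rpow_le_rpow (by positivity) h1 (by positivity)
          _ = _ := by
              rw [hC₃, Real.mul_rpow (by positivity) (by positivity), ← Real.rpow_mul hρ0.le,
                ← Real.rpow_mul hρ0.le]
              congr 2; ring
      have hz' : ‖z - x‖ ≤ M'' * h N := by
        refine hz.trans (mul_le_mul_of_nonneg_right ?_ hN0.le)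
        rw [hM'']
        have : 0 ≤ M' * (r / M) := by positivity
        linarith [norm_nonneg u₀]
      have h2 := hpastN x hx z hz' N U i ρ hi hρ hU F hF
      refine h2.trans (mul_le_mul_of_nonneg_right ?_ hF0)
      have h5 := hC₂ ρ hρ1
      rw [hsplit] at h5
      have h6 : Real.exp (-b * (ρ : ℝ) ^ γ) * (N : ℝ) ^ κ ≤ C₃ * C₂ * (1 / (ρ : ℝ) ^ 2) := by
        calc Real.exp (-b * (ρ : ℝ) ^ γ) * (N : ℝ) ^ κ ≤
              Real.exp (-b * (ρ : ℝ) ^ γ) * (C₃ * (ρ : ℝ) ^ (n * p / a * κ)) :=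
              mul_le_mul_of_nonneg_left hNpow (Real.exp_pos _).le
          _ ≤ _ := by
            rw [mul_one_div, le_div_iff₀ (by positivity)]
            linarith [mul_le_mul_of_nonneg_left h5 hC₃0.le]
      have h7 : Real.exp (-b * (ρ : ℝ) ^ γ) * (N : ℝ) ^ κ ≤
          C₃ * C₂ * (4 * (1 / ((ρ : ℝ) + 1) ^ 2)) :=
        h6.trans (mul_le_mul_of_nonneg_left hρ4 (by positivity))
      have h8 : C ≤ W := by
        rw [hW]
        have : 0 ≤ B * ((n₁ : ℝ) + 1) ^ 2 + 4 * (B / c * C * (1 + C₁)) + 4 * (C * (C₃ * C₂)) := by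
          positivity
        linarith
      have h9 : 4 * (C * (C₃ * C₂)) ≤ W := by
        rw [hW]
        have : 0 ≤ B * ((n₁ : ℝ) + 1) ^ 2 + 4 * (B / c * C * (1 + C₁)) + C := by
          positivity
        linarith
      have h10 := mul_le_mul_of_nonneg_left h7 hC
      rw [mul_add, mul_add]
      linarith [mul_le_mul_of_nonneg_right h8 hhD, mul_le_mul_of_nonneg_right h9 hlag]

end MixingRegression

end MultiScale

/-! ### Pointwise deviations of kernel averages -/

section Deviation

lemma sum_range_inv_succ_sq_le (k : ℕ) :
    ∑ d ∈ Finset.range k, 1 / ((d : ℝ) + 1) ^ 2 ≤ 2 := by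
  have key : ∀ k : ℕ, ∑ d ∈ Finset.range k, 1 / ((d : ℝ) + 1) ^ 2 ≤ 2 - 1 / (k : ℝ) := by
    intro k
    induction k with
    | zero => norm_num
    | succ k ih =>
      rw [Finset.sum_range_succ]
      rcases Nat.eq_zero_or_pos k with rfl | hk
      · norm_num
      have hk' : (0 : ℝ) < k := by exact_mod_cast hk
      have h1 : 1 / ((k : ℝ) + 1) ^ 2 ≤ 1 / (k : ℝ) - 1 / ((k : ℝ) + 1) := by
        rw [div_sub_div _ _ hk'.ne' (by positivity), div_le_div_iff₀ (by positivity) (by positivity)]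
        nlinarith
      push_cast
      linarith
  exact (key k).trans (by have : (0 : ℝ) ≤ 1 / (k : ℝ) := by positivity
                          linarith)

namespace MixingRegression

variable {Ω : Type*} [MeasurableSpace Ω] {μ : Measure Ω} [IsProbabilityMeasure μ] {D : ℕ}
  {α b γ L : ℝ} {S 𝒳 : Set (EuclideanSpace ℝ (Fin D))}
  {𝒞S : CSpace S} {𝒞Z : CSpace (S × Icc (-L) L)} {Z : ℕ → Ω → S × Icc (-L) L}
  {X : ℕ → Ω → EuclideanSpace ℝ (Fin D)} {Y : ℕ → Ω → ℝ}
  {f : EuclideanSpace ℝ (Fin D) × ℝ → ℝ} {K : EuclideanSpace ℝ (Fin D) → ℝ} {τ : ℕ → ℕ → ℕ}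

-- The input of the Bernstein inequality: sup norms of order 1, means of order `h^D`, mixing error
-- `O(1/N)` across a block, and lag weights whose sum over a block stays bounded once `k h^D ≤ 1`.
-- The sign `s` gives access to both tails.
set_option maxHeartbeats 1000000 in
lemma exists_pastBounds (hs : MixingRegression μ α b γ L 𝒳 𝒞S 𝒞Z Z X Y f K τ)
    {h : ℕ → ℝ} {a κ : ℝ} (hh : AdmissibleBandwidth α D h a) (hκ : 0 < κ)
    (hgrow : ∀ᶠ n : ℕ in atTop, ∀ x : EuclideanSpace ℝ (Fin D),
      𝒞S.SemiLE (fun s => K ((h n)⁻¹ • ((s : EuclideanSpace ℝ (Fin D)) - x))) ((n : ℝ) ^ κ))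
    {M' : ℝ} (hM'0 : 0 ≤ M') {t : ℝ} (ht : 0 < t) :
    ∃ B P E W : ℝ, 0 ≤ B ∧ 0 ≤ P ∧ 0 ≤ E ∧ 0 ≤ W ∧
      ∀ᶠ N : ℕ in atTop, ∀ x ∈ 𝒳, ∀ z, ‖z - x‖ ≤ M' * h N → ∀ j ≤ 2, ∀ s : ℝ, s = 1 ∨ s = -1 →
        PastBounds μ (fun i => Z (τ N i)) N ⌈(N : ℝ) ^ t⌉₊
          (fun q => s * (K ((h N)⁻¹ • ((q.1 : EuclideanSpace ℝ (Fin D)) - z)) * (q.2 : ℝ) ^ j))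
          (fun q => L ^ 2 * K ((h N)⁻¹ • ((q.1 : EuclideanSpace ℝ (Fin D)) - z)))
          (s * ∫ ω, K ((h N)⁻¹ • (X 0 ω - z)) * Y 0 ω ^ j ∂μ) B (P * h N ^ D) (E / N)
          (fun d => W * (h N ^ D + 1 / ((d : ℝ) + 1) ^ 2)) := by
  obtain ⟨B₀, hB₀⟩ := hs.kernel.bounded
  obtain ⟨B, hB, hB1⟩ : ∃ B, (∀ u, K u ≤ B) ∧ 1 ≤ B :=
    ⟨max B₀ 1, fun u => (hB₀ u).trans (le_max_left _ _), le_max_right _ _⟩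
  have hB0 : 0 < B := by linarith
  have hL := hs.one_le_L
  have hL0 : 0 < L := hs.L_pos
  have hα := hs.α_pos
  have hbp := hs.b_pos
  have hγp := hs.γ_pos
  have hKm := hs.kernel.measurable
  obtain ⟨C₁, hC₁0, hmean⟩ := hs.exists_mean_le hh M'
  obtain ⟨C₂, hC₂0, hpast⟩ := hs.exists_past_mean_le hh hκ hgrow M'
  obtain ⟨W, hW0, hsum⟩ := hs.exists_past_mean_le_summable hh hκ hgrow hM'0
  obtain ⟨p, hp⟩ : ∃ p, p = 1 / (2 * α + D) := ⟨_, rfl⟩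
  have hp0 : 0 < p := by rw [hp]; positivity
  -- The exponent `κ + 3` splits into `κ` for the kernel seminorm, 2 for approximating at parameter
  -- `N⁻²`, and 1 to leave an error of order `1 / N`. In `C₄`, the power `p D` pays for `h^{-D}`.
  obtain ⟨C₃, hC₃0, hC₃⟩ := exists_exp_neg_mul_rpow_le hbp (mul_pos ht hγp) (κ + 3)
  obtain ⟨C₄, hC₄0, hC₄⟩ := exists_exp_neg_mul_rpow_le hbp (mul_pos ht hγp) (κ + p * D)
  obtain ⟨C₅, hC₅⟩ : ∃ C₅, C₅ = 8 * B ^ 2 * L ^ 2 + 8 * L * (B + 2) := ⟨_, rfl⟩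
  have hC₅0 : 0 < C₅ := by rw [hC₅]; positivity
  refine ⟨L ^ 2 * B, L ^ 2 * C₂ * (1 + C₄) + L ^ 2 * C₁, 2 * (2 * B * L) ^ 3 + C₅ * C₃,
    L ^ 2 * W + L ^ 2 * B, by positivity, by positivity, by positivity, by positivity, ?_⟩
  filter_upwards [hmean, hpast, hsum, hh.eventually, hh.eventually_inv_le hα, hgrow,
    eventually_ge_atTop 1, eventually_ge_atTop ⌈2 * B * L⌉₊] with N hmeanN hpastN hsumN
    ⟨h0, _, _⟩ hinv hgrowN hN1 hNB x hx z hz j hj s hs1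
  have hN1' : (1 : ℝ) ≤ N := by exact_mod_cast hN1
  have hN0 : (0 : ℝ) < N := by linarith
  have hNB' : 2 * B * L ≤ N := (Nat.le_ceil _).trans (by exact_mod_cast hNB)
  have hD0 : 0 < h N ^ D := by positivity
  have hNsq : (N : ℝ) ≤ (N : ℝ) ^ 2 := le_self_pow₀ hN1' two_ne_zero
  have hNκ : 1 ≤ (N : ℝ) ^ κ := Real.one_le_rpow hN1' hκ.le
  have hk0 : 0 < ⌈(N : ℝ) ^ t⌉₊ := Nat.ceil_pos.2 (by positivity)
  have habs_s : |s| = 1 := by rcases hs1 with rfl | rfl <;> simp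
  have hexp : Real.exp (-b * (⌈(N : ℝ) ^ t⌉₊ : ℝ) ^ γ) ≤ Real.exp (-b * (N : ℝ) ^ (t * γ)) := by
    refine Real.exp_le_exp.2 ?_
    have : (N : ℝ) ^ (t * γ) ≤ (⌈(N : ℝ) ^ t⌉₊ : ℝ) ^ γ := by
      rw [Real.rpow_mul hN0.le]
      exact Real.rpow_le_rpow (by positivity) (Nat.le_ceil _) hγp.le
    rw [neg_mul, neg_mul]
    exact neg_le_neg (mul_le_mul_of_nonneg_left this hbp.le)
  have hKabs : ∀ u, |K u| ≤ B := fun u => by rw [abs_of_nonneg (hs.kernel.nonneg u)]; exact hB u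
  have hLj : ∀ y ∈ Icc (-L) L, |y ^ j| ≤ L ^ 2 := fun y hy => by
    rw [abs_pow]
    exact (pow_le_pow_left₀ (abs_nonneg _) (abs_le.2 hy) j).trans (pow_le_pow_right₀ hL hj)
  have hZm : ∀ i, Measurable (Z (τ N i)) := fun i => hs.measurable_Z _
  refine ⟨by fun_prop, by fun_prop, fun q => ?_, fun q => ?_, ?_, ?_, ?_, fun d => ?_, ?_, ?_, ?_⟩
  · rw [abs_mul, habs_s, one_mul, abs_mul, abs_of_nonneg (hs.kernel.nonneg _), mul_comm]
    exact mul_le_mul_of_nonneg_right (hLj _ q.2.2) (hs.kernel.nonneg _)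
  · exact mul_le_mul_of_nonneg_left (hB _) (by positivity)
  · intro U i hi hU F hF
    have htB : ((N : ℝ) ^ 2)⁻¹ * (2 * B * L) ≤ 1 := by
      rw [inv_mul_le_iff₀ (by positivity), mul_one]
      exact hNB'.trans hNsq
    have happ : 𝒞Z.Approx (fun q => K ((h N)⁻¹ • ((q.1 : EuclideanSpace ℝ (Fin D)) - z)) *
        (q.2 : ℝ) ^ j) _ _ :=
      hs.semi.approx_mul_pow hL (hgrowN z) hB1 (fun _ => hKabs _) (by positivity) htB hj
    have happ' : 𝒞Z.Approx (fun q => s * (K ((h N)⁻¹ • ((q.1 : EuclideanSpace ℝ (Fin D)) - z)) *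
        (q.2 : ℝ) ^ j)) (((N : ℝ) ^ 2)⁻¹ * (2 * B * L) ^ 3)
        (8 * B ^ 2 * L ^ 2 + 8 * L * ((N : ℝ) ^ κ + B + 1) / ((N : ℝ) ^ 2)⁻¹) := by
      rcases hs1 with rfl | rfl
      · simpa using happ
      · simpa using happ.neg
    have key := happ'.mean_le (by fun_prop) hZm (hs.mixing N) hi hk0 hU hF
    have hmeaneq : ∫ ω, s * (K ((h N)⁻¹ • (((Z (τ N i) ω).1 : EuclideanSpace ℝ (Fin D)) - z)) *
        ((Z (τ N i) ω).2 : ℝ) ^ j) ∂μ = s * ∫ ω, K ((h N)⁻¹ • (X 0 ω - z)) * Y 0 ω ^ j ∂μ := by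
      simp only [← hs.X_eq, ← hs.Y_eq]
      rw [integral_const_mul]
      have hm : Measurable fun u => K ((h N)⁻¹ • (u - z)) := by fun_prop
      rw [hs.expectation_eq hm (τ N i) j, hs.expectation_eq hm 0 j]
    rw [hmeaneq] at key
    refine key.trans (mul_le_mul_of_nonneg_right (add_le_add le_rfl ?_) hF.integral_nonneg)
    have h1 : 2 * (((N : ℝ) ^ 2)⁻¹ * (2 * B * L) ^ 3) ≤ 2 * (2 * B * L) ^ 3 / N := by
      rw [div_eq_inv_mul]
      have : ((N : ℝ) ^ 2)⁻¹ ≤ (N : ℝ)⁻¹ := inv_anti₀ hN0 hNsq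
      have := mul_le_mul_of_nonneg_right this (by positivity : 0 ≤ 2 * (2 * B * L) ^ 3)
      linarith
    have h2 : 8 * B ^ 2 * L ^ 2 + 8 * L * ((N : ℝ) ^ κ + B + 1) / ((N : ℝ) ^ 2)⁻¹ ≤
        C₅ * ((N : ℝ) ^ κ * (N : ℝ) ^ 2) := by
      have h3 : (1 : ℝ) ≤ (N : ℝ) ^ κ * (N : ℝ) ^ 2 :=
        one_le_mul_of_one_le_of_one_le hNκ (one_le_pow₀ hN1')
      have h4 : (N : ℝ) ^ κ + B + 1 ≤ (B + 2) * (N : ℝ) ^ κ := by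
        linarith [le_mul_of_one_le_right hB0.le hNκ]
      have h5 : 8 * L * ((N : ℝ) ^ κ + B + 1) * (N : ℝ) ^ 2 ≤
          8 * L * ((B + 2) * (N : ℝ) ^ κ) * (N : ℝ) ^ 2 := by gcongr
      have h6 := mul_le_mul_of_nonneg_left h3 (by positivity : 0 ≤ 8 * B ^ 2 * L ^ 2)
      rw [div_inv_eq_mul, hC₅]
      linarith
    have h7 : Real.exp (-b * (⌈(N : ℝ) ^ t⌉₊ : ℝ) ^ γ) *
        (8 * B ^ 2 * L ^ 2 + 8 * L * ((N : ℝ) ^ κ + B + 1) / ((N : ℝ) ^ 2)⁻¹) ≤ C₅ * C₃ / N := by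
      rw [le_div_iff₀ hN0]
      have h8 := hC₃ N hN1'
      have e : (N : ℝ) ^ (κ + 3) = (N : ℝ) ^ κ * (N : ℝ) ^ 2 * N := by
        rw [Real.rpow_add hN0, mul_assoc, ← pow_succ]; norm_cast
      rw [e] at h8
      calc _ ≤ Real.exp (-b * (N : ℝ) ^ (t * γ)) * (C₅ * ((N : ℝ) ^ κ * (N : ℝ) ^ 2)) * N := by
            gcongr
        _ = C₅ * (Real.exp (-b * (N : ℝ) ^ (t * γ)) * ((N : ℝ) ^ κ * (N : ℝ) ^ 2 * N)) := by ring
        _ ≤ _ := mul_le_mul_of_nonneg_left h8 hC₅0.le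
    rw [add_div]
    exact add_le_add h1 h7
  · intro U i hi hU F hF
    simp only [← hs.X_eq]
    have e : ∫ ω, F ω * (L ^ 2 * K ((h N)⁻¹ • (X (τ N i) ω - z))) ∂μ =
        L ^ 2 * ∫ ω, F ω * K ((h N)⁻¹ • (X (τ N i) ω - z)) ∂μ := by
      rw [← integral_const_mul]; congr 1; ext ω; ring
    rw [e]
    have h1 := hpastN x hx z hz N U i _ hi hk0 hU F hF
    have h2 : Real.exp (-b * (⌈(N : ℝ) ^ t⌉₊ : ℝ) ^ γ) * (N : ℝ) ^ κ ≤ C₄ * h N ^ D := by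
      have h3 := hC₄ N hN1'
      have h4 : (h N ^ D)⁻¹ ≤ (N : ℝ) ^ (p * D) := by
        rw [Real.rpow_mul hN0.le, Real.rpow_natCast, ← inv_pow, hp]
        exact pow_le_pow_left₀ (by positivity) hinv D
      rw [Real.rpow_add hN0] at h3
      have h5 : Real.exp (-b * (N : ℝ) ^ (t * γ)) * ((N : ℝ) ^ κ * (h N ^ D)⁻¹) ≤ C₄ :=
        (by gcongr : _ ≤ Real.exp (-b * (N : ℝ) ^ (t * γ)) *
          ((N : ℝ) ^ κ * (N : ℝ) ^ (p * D))).trans h3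
      rw [← mul_assoc, ← div_eq_mul_inv, div_le_iff₀ hD0] at h5
      exact (mul_le_mul_of_nonneg_right hexp (by positivity)).trans h5
    have hF0 := hF.integral_nonneg (μ := μ)
    calc L ^ 2 * ∫ ω, F ω * K ((h N)⁻¹ • (X (τ N i) ω - z)) ∂μ ≤
          L ^ 2 * (C₂ * (h N ^ D + C₄ * h N ^ D) * ∫ ω, F ω ∂μ) := by
          refine mul_le_mul_of_nonneg_left (h1.trans ?_) (by positivity)
          gcongr
      _ = L ^ 2 * C₂ * (1 + C₄) * h N ^ D * ∫ ω, F ω ∂μ := by ring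
      _ ≤ _ := by
          gcongr
          exact le_add_of_nonneg_right (by positivity)
  · intro U i ρ hi hρ hU F hF
    simp only [← hs.X_eq]
    have e : ∫ ω, F ω * (L ^ 2 * K ((h N)⁻¹ • (X (τ N i) ω - z))) ∂μ =
        L ^ 2 * ∫ ω, F ω * K ((h N)⁻¹ • (X (τ N i) ω - z)) ∂μ := by
      rw [← integral_const_mul]; congr 1; ext ω; ring
    rw [e]
    have h1 := hsumN x hx z hz U i ρ hi hρ hU F hF
    have hF0 := hF.integral_nonneg (μ := μ)
    calc L ^ 2 * ∫ ω, F ω * K ((h N)⁻¹ • (X (τ N i) ω - z)) ∂μ ≤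
          L ^ 2 * (W * (h N ^ D + 1 / ((ρ : ℝ) + 1) ^ 2) * ∫ ω, F ω ∂μ) :=
          mul_le_mul_of_nonneg_left h1 (by positivity)
      _ = L ^ 2 * W * (h N ^ D + 1 / ((ρ : ℝ) + 1) ^ 2) * ∫ ω, F ω ∂μ := by ring
      _ ≤ _ := by
          gcongr
          exact le_add_of_nonneg_right (by positivity)
  · positivity
  -- At lag 0 the weight has to exceed the sup norm; the summand `L ^ 2 * B` of its constant is
  -- there for this.
  · have h1 : (1 : ℝ) ≤ h N ^ D + 1 / (((0 : ℕ) : ℝ) + 1) ^ 2 := by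
      norm_num; exact hD0.le
    have h2 : L ^ 2 * B ≤ L ^ 2 * W + L ^ 2 * B := le_add_of_nonneg_left (by positivity)
    exact h2.trans (le_mul_of_one_le_right (by positivity) h1)
  · rw [abs_mul, habs_s, one_mul]
    have hm : Measurable fun ω => K ((h N)⁻¹ • (X 0 ω - z)) := by
      have := hs.measurable_X 0
      fun_prop
    have hint : Integrable (fun ω => K ((h N)⁻¹ • (X 0 ω - z))) μ :=
      Integrable.of_bound hm.aestronglyMeasurable B (ae_of_all _ fun ω => hKabs _)
    rw [← Real.norm_eq_abs]
    refine (norm_integral_le_of_norm_le (hint.const_mul (L ^ 2)) (ae_of_all _ fun ω => ?_)).trans ?_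
    · rw [norm_mul, Real.norm_eq_abs, Real.norm_eq_abs, abs_of_nonneg (hs.kernel.nonneg _), mul_comm]
      exact mul_le_mul_of_nonneg_right (hLj _ (hs.Y_mem 0 ω)) (hs.kernel.nonneg _)
    · rw [integral_const_mul, add_mul]
      have := mul_le_mul_of_nonneg_left (hmeanN x hx z hz 0) (by positivity : 0 ≤ L ^ 2)
      have h3 : 0 ≤ L ^ 2 * C₂ * (1 + C₄) * h N ^ D := by positivity
      linarith
  · positivity

set_option maxHeartbeats 1000000 in
/-- Deviations of the kernel averages at one point have polynomially small probability. -/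
lemma exists_measure_deviation_le (hs : MixingRegression μ α b γ L 𝒳 𝒞S 𝒞Z Z X Y f K τ)
    {h : ℕ → ℝ} {a κ : ℝ} (hh : AdmissibleBandwidth α D h a) (hκ : 0 < κ)
    (hgrow : ∀ᶠ n : ℕ in atTop, ∀ x : EuclideanSpace ℝ (Fin D),
      𝒞S.SemiLE (fun s => K ((h n)⁻¹ • ((s : EuclideanSpace ℝ (Fin D)) - x))) ((n : ℝ) ^ κ))
    {M' : ℝ} (hM'0 : 0 ≤ M') {q : ℝ} (hq : 0 ≤ q) :
    ∃ T E : ℝ, 0 ≤ T ∧ 0 ≤ E ∧ ∀ᶠ N : ℕ in atTop, ∀ x ∈ 𝒳, ∀ z, ‖z - x‖ ≤ M' * h N → ∀ j ≤ 2,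
      μ.real {ω | T * (h N ^ α * (N * h N ^ D)) ≤
        |∑ i ∈ Finset.range N, (K ((h N)⁻¹ • (X i ω - z)) * Y i ω ^ j -
          ∫ ω, K ((h N)⁻¹ • (X 0 ω - z)) * Y 0 ω ^ j ∂μ)|} ≤ E * (N : ℝ) ^ (-q) := by
  have hα := hs.α_pos
  have ha := hh.a_pos
  -- The block exponent is small enough that `k h^α → 0`, so that Chernoff's parameter `h^α` is
  -- allowed, and that eventually `k h^D ≤ 1` and `k ≤ N`.
  obtain ⟨t, ht0, ht1, ht2, ht3⟩ : ∃ t, 0 < t ∧ 2 * t ≤ a * α ∧ 2 * t ≤ a ∧ 2 * t ≤ 1 := by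
    refine ⟨min (a * α) (min a 1) / 2, by positivity, ?_, ?_, ?_⟩ <;> rw [mul_div_cancel₀ _ two_ne_zero]
    · exact min_le_left _ _
    · exact (min_le_right _ _).trans (min_le_left _ _)
    · exact (min_le_right _ _).trans (min_le_right _ _)
  obtain ⟨B, P, E, W, hB, hP, hE, hW, hev⟩ := hs.exists_pastBounds hh hκ hgrow hM'0 ht0
  -- The lag weights sum to at most `W (k h^D + 2) ≤ 3 W`; the summand `P` covers the condition on
  -- `k P h^D`.
  obtain ⟨Q, hQ⟩ : ∃ Q, Q = 3 * W + P := ⟨_, rfl⟩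
  have hQ0 : 0 ≤ Q := by rw [hQ]; positivity
  have hlim : Tendsto (fun n : ℕ => (n : ℝ) ^ (-t) * (2 * (B + P) + 2)) atTop (nhds 0) := by
    have := ((tendsto_rpow_neg_atTop ht0).comp tendsto_natCast_atTop_atTop).mul_const
      (2 * (B + P) + 2)
    simpa using this
  refine ⟨2 * (12 * P * Q + q), 4 * Real.exp (2 * E), by positivity, by positivity, ?_⟩
  filter_upwards [hev, hlim.eventually (gt_mem_nhds one_pos), hh.eventually,
    eventually_ge_atTop 1] with N hevN hN2 ⟨h0, h1, h2⟩ hN1 x hx z hz j hj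
  have hN1' : (1 : ℝ) ≤ N := by exact_mod_cast hN1
  have hN0 : (0 : ℝ) < N := by linarith
  set k := ⌈(N : ℝ) ^ t⌉₊ with hk
  have hNt : (N : ℝ) ^ (-t) * (N : ℝ) ^ t = 1 := by
    rw [← Real.rpow_add hN0]; simp
  have hNt1 : 1 ≤ (N : ℝ) ^ t := Real.one_le_rpow hN1' ht0.le
  have hNt0 : 0 < (N : ℝ) ^ (-t) := by positivity
  have hk0 : 0 < k := Nat.ceil_pos.2 (by positivity)
  have hk2 : (k : ℝ) ≤ 2 * (N : ℝ) ^ t := by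
    have := Nat.ceil_lt_add_one (a := (N : ℝ) ^ t) (by positivity)
    rw [← hk] at this
    linarith
  have hle : ∀ y e, 0 ≤ y → 2 * t ≤ e → y ≤ (N : ℝ) ^ (-e) → k * y ≤ 2 * (N : ℝ) ^ (-t) := by
    intro y e hy he hye
    have h3 : y ≤ (N : ℝ) ^ (-t) * (N : ℝ) ^ (-t) := by
      rw [← Real.rpow_add hN0]
      exact hye.trans (Real.rpow_le_rpow_of_exponent_le hN1' (by linarith))
    calc k * y ≤ 2 * (N : ℝ) ^ t * ((N : ℝ) ^ (-t) * (N : ℝ) ^ (-t)) :=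
          mul_le_mul hk2 h3 hy (by positivity)
      _ = 2 * ((N : ℝ) ^ (-t) * (N : ℝ) ^ t) * (N : ℝ) ^ (-t) := by ring
      _ = _ := by rw [hNt]; ring
  have hN2' : (N : ℝ) ^ (-t) * 2 ≤ 1 := by
    have : 0 ≤ (N : ℝ) ^ (-t) * (2 * (B + P)) := by positivity
    linarith
  have hh1 : h N ≤ 1 := h1.trans (Real.rpow_le_one_of_one_le_of_nonpos hN1' (by linarith))
  have hD1 : h N ^ D ≤ h N := pow_le_of_le_one h0.le hh1 hs.D_pos.ne'
  have hD0 : 0 < h N ^ D := by positivity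
  have hDle : h N ^ D ≤ 1 := hD1.trans hh1
  have hα1 : h N ^ α ≤ (N : ℝ) ^ (-(a * α)) := by
    rw [← neg_mul, Real.rpow_mul hN0.le]
    exact Real.rpow_le_rpow h0.le h1 hα.le
  have hα0 : 0 < h N ^ α := by positivity
  have hαle : h N ^ α ≤ 1 := Real.rpow_le_one h0.le hh1 hα.le
  have hkD : k * h N ^ D ≤ 1 := (hle _ a hD0.le ht2 (hD1.trans h1)).trans (by linarith)
  have hkα : h N ^ α * (k * (B + P * h N ^ D)) ≤ 1 := by
    have h3 := hle _ _ hα0.le ht1 hα1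
    calc h N ^ α * (k * (B + P * h N ^ D)) = k * h N ^ α * (B + P * h N ^ D) := by ring
      _ ≤ 2 * (N : ℝ) ^ (-t) * (B + P * 1) := by gcongr
      _ ≤ 1 := by linarith
  have hkN : k ≤ N := by
    have h3 : (k : ℝ) ≤ N := by
      refine hk2.trans ?_
      have h4 : (N : ℝ) ^ t * (N : ℝ) ^ t ≤ N := by
        rw [← Real.rpow_add hN0]
        exact (Real.rpow_le_rpow_of_exponent_le hN1' (by linarith : t + t ≤ 1)).trans
          (Real.rpow_one _).le
      nlinarith
    exact_mod_cast h3
  have hQsum : ∑ d ∈ Finset.range k, W * (h N ^ D + 1 / ((d : ℝ) + 1) ^ 2) ≤ Q := by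
    rw [← Finset.mul_sum, Finset.sum_add_distrib, Finset.sum_const, Finset.card_range,
      nsmul_eq_mul]
    have := mul_le_mul_of_nonneg_left (add_le_add hkD (sum_range_inv_succ_sq_le k)) hW
    rw [hQ]; linarith
  have hkP : k * (P * h N ^ D) ≤ Q := by
    have := mul_le_mul_of_nonneg_left hkD hP
    rw [hQ]; linarith
  set m := ∫ ω, K ((h N)⁻¹ • (X 0 ω - z)) * Y 0 ω ^ j ∂μ with hm
  -- The part `12 P Q` of the threshold cancels the variance term exactly. What remains is `-q N
  -- h^{2α+D} ≤ -q log N`, plus the bounded mixing error.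
  have hexpo : Real.exp (-h N ^ α * ((12 * P * Q + q) * (h N ^ α * (N * h N ^ D))) +
      (2 * h N ^ α * N * (E / N) + 12 * (h N ^ α) ^ 2 * N * (P * h N ^ D) * Q)) ≤
      Real.exp (2 * E) * (N : ℝ) ^ (-q) := by
    rw [Real.rpow_def_of_pos hN0, ← Real.exp_add]
    refine Real.exp_le_exp.2 ?_
    have e1 : 2 * h N ^ α * N * (E / N) = h N ^ α * (2 * E) := by field_simp
    have e2 : (h N ^ α) ^ 2 * (N * h N ^ D) = N * h N ^ (2 * α + D) := by
      rw [Real.rpow_add h0, Real.rpow_natCast, two_mul, Real.rpow_add h0]; ring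
    have h3 : q * Real.log N ≤ q * ((h N ^ α) ^ 2 * (N * h N ^ D)) := by
      rw [e2]; exact mul_le_mul_of_nonneg_left h2 hq
    have h4 : h N ^ α * (2 * E) ≤ 2 * E := mul_le_of_le_one_left (by positivity) hαle
    rw [e1]
    linarith
  have hone : ∀ s : ℝ, s = 1 ∨ s = -1 →
      μ.real {ω | 2 * ((12 * P * Q + q) * (h N ^ α * (N * h N ^ D))) ≤
        s * ∑ i ∈ Finset.range N, (K ((h N)⁻¹ • (X i ω - z)) * Y i ω ^ j - m)} ≤
      2 * (Real.exp (2 * E) * (N : ℝ) ^ (-q)) := by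
    intro s hs1
    have key := (hevN x hx z hz j hj s hs1).measure_sum_ge_le (fun i => hs.measurable_Z (τ N i))
      hk0 hkN hα0.le hkα hQsum hkP ((12 * P * Q + q) * (h N ^ α * (N * h N ^ D)))
    have e : ∀ ω, ∑ i ∈ Finset.range N,
        (s * (K ((h N)⁻¹ • (((Z (τ N i) ω).1 : EuclideanSpace ℝ (Fin D)) - z)) *
          ((Z (τ N i) ω).2 : ℝ) ^ j) - s * m) =
        s * ∑ i ∈ Finset.range N, (K ((h N)⁻¹ • (X i ω - z)) * Y i ω ^ j - m) := by
      intro ω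
      rw [← hs.sum_reindex N fun i => K ((h N)⁻¹ • (X i ω - z)) * Y i ω ^ j - m, Finset.mul_sum]
      refine Finset.sum_congr rfl fun i _ => ?_
      simp only [hs.X_eq, hs.Y_eq]
      ring
    refine (measureReal_mono fun ω hω => ?_).trans
      (key.trans (mul_le_mul_of_nonneg_left hexpo (by norm_num)))
    rw [Set.mem_ofPred_eq] at hω ⊢
    rw [← e ω] at hω
    exact hω
  have hcover : {ω | 2 * (12 * P * Q + q) * (h N ^ α * (N * h N ^ D)) ≤
      |∑ i ∈ Finset.range N, (K ((h N)⁻¹ • (X i ω - z)) * Y i ω ^ j - m)|} ⊆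
      {ω | 2 * ((12 * P * Q + q) * (h N ^ α * (N * h N ^ D))) ≤
        1 * ∑ i ∈ Finset.range N, (K ((h N)⁻¹ • (X i ω - z)) * Y i ω ^ j - m)} ∪
      {ω | 2 * ((12 * P * Q + q) * (h N ^ α * (N * h N ^ D))) ≤
        -1 * ∑ i ∈ Finset.range N, (K ((h N)⁻¹ • (X i ω - z)) * Y i ω ^ j - m)} := by
    intro ω hω
    have hω' : 2 * (12 * P * Q + q) * (h N ^ α * (N * h N ^ D)) ≤
      |∑ i ∈ Finset.range N, (K ((h N)⁻¹ • (X i ω - z)) * Y i ω ^ j - m)| := hω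
    rcases le_abs.1 hω' with h3 | h3
    · left
      rw [Set.mem_ofPred_eq]
      linarith
    · right
      rw [Set.mem_ofPred_eq]
      linarith
  refine (measureReal_mono hcover).trans ((measureReal_union_le _ _).trans ?_)
  linarith [hone 1 (Or.inl rfl), hone (-1) (Or.inr rfl)]

end MixingRegression

end Deviation

/-! ### Uniformity by a polynomially fine grid -/

section UniformDeviation

/-- Balls of a Euclidean space are covered by polynomially many balls of radius `δ`. -/
lemma exists_finset_cover {D : ℕ} (hD : 0 < D) (R : ℝ) (hR : 0 < R) :
    ∃ C : ℝ, 0 ≤ C ∧ ∀ δ : ℝ, 0 < δ → δ ≤ 1 → ∃ T : Finset (EuclideanSpace ℝ (Fin D)),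
      (T.card : ℝ) ≤ C * δ⁻¹ ^ D ∧ ∀ z, ‖z‖ ≤ R → ∃ y ∈ T, ‖z - y‖ ≤ δ := by
  classical
  refine ⟨(2 * (D * R) + 4) ^ D, by positivity, fun δ hδ hδ1 => ?_⟩
  have hD' : (0 : ℝ) < D := by exact_mod_cast hD
  -- Coordinate errors of at most `δ / D` give Euclidean error at most `√D δ / D ≤ δ`.
  set s := δ / D with hs
  have hs0 : 0 < s := by positivity
  set n : ℕ := ⌈R / s⌉₊ with hn
  have hnR : R / s ≤ n := Nat.le_ceil _
  have hn1 : (n : ℝ) < R / s + 1 := Nat.ceil_lt_add_one (by positivity)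
  set B : Finset (Fin D → ℤ) := Fintype.piFinset fun _ => Finset.Icc (-(n + 1) : ℤ) n with hB
  set g : (Fin D → ℤ) → EuclideanSpace ℝ (Fin D) := fun v =>
    WithLp.toLp 2 fun i => s * (v i : ℝ) with hg
  refine ⟨B.image g, ?_, fun z hz => ⟨g fun i => ⌊z i / s⌋, ?_, ?_⟩⟩
  · have hcard : B.card = (2 * n + 2) ^ D := by
      rw [hB, Fintype.card_piFinset]
      simp only [Int.card_Icc, Finset.prod_const, Finset.card_univ, Fintype.card_fin]
      congr 1
      omega
    calc ((B.image g).card : ℝ) ≤ B.card := by exact_mod_cast Finset.card_image_le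
      _ = (2 * (n : ℝ) + 2) ^ D := by rw [hcard]; push_cast; ring
      _ ≤ ((2 * (D * R) + 4) * δ⁻¹) ^ D := by
          refine pow_le_pow_left₀ (by positivity) ?_ D
          have h1 : R / s = D * R * δ⁻¹ := by rw [hs]; field_simp
          have h2 : 1 ≤ δ⁻¹ := (one_le_inv₀ hδ).2 hδ1
          rw [h1] at hn1
          linarith
      _ = _ := by rw [mul_pow]
  · refine Finset.mem_image_of_mem g (Fintype.mem_piFinset.2 fun i => ?_)
    have h1 : |z i| ≤ R := (by simpa using EuclideanSpace.norm_eq z ▸ PiLp.norm_apply_le z i :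
      |z i| ≤ ‖z‖).trans hz
    have h2 : |z i / s| ≤ n := by
      rw [abs_div, abs_of_pos hs0]
      exact (div_le_div_of_nonneg_right h1 hs0.le).trans hnR
    have h3 := abs_le.1 h2
    refine Finset.mem_Icc.2 ⟨Int.le_floor.2 ?_, ?_⟩
    · push_cast; linarith [h3.1]
    · have : ((⌊z i / s⌋ : ℤ) : ℝ) ≤ ((n : ℤ) : ℝ) := by
        rw [Int.cast_natCast]
        exact (Int.floor_le (z i / s)).trans h3.2
      exact Int.cast_le.1 this
  · have hcoord : ∀ i, |(z - g fun i => ⌊z i / s⌋) i| ≤ s := by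
      intro i
      have e : (z - g fun i => ⌊z i / s⌋) i = s * Int.fract (z i / s) := by
        simp only [hg, PiLp.sub_apply, Int.fract]
        field_simp
      rw [e, abs_of_nonneg (mul_nonneg hs0.le (Int.fract_nonneg _))]
      exact mul_le_of_le_one_right hs0.le (Int.fract_lt_one _).le
    rw [EuclideanSpace.norm_eq]
    refine Real.sqrt_le_iff.2 ⟨hδ.le, ?_⟩
    calc ∑ i, ‖(z - g fun i => ⌊z i / s⌋) i‖ ^ 2 ≤ ∑ _i : Fin D, s ^ 2 :=
          Finset.sum_le_sum fun i _ => by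
            rw [Real.norm_eq_abs]
            exact pow_le_pow_left₀ (abs_nonneg _) (hcoord i) 2
      _ = D * s ^ 2 := by simp
      _ ≤ (D * s) ^ 2 := by
          have h1 : (1 : ℝ) ≤ D := by exact_mod_cast hD
          nlinarith [sq_nonneg s, mul_le_mul_of_nonneg_right h1 (by positivity : 0 ≤ D * s ^ 2)]
      _ = δ ^ 2 := by rw [hs, mul_div_cancel₀ _ hD'.ne']

namespace MixingRegression

variable {Ω : Type*} [MeasurableSpace Ω] {μ : Measure Ω} [IsProbabilityMeasure μ] {D : ℕ}
  {α b γ L : ℝ} {S 𝒳 : Set (EuclideanSpace ℝ (Fin D))}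
  {𝒞S : CSpace S} {𝒞Z : CSpace (S × Icc (-L) L)} {Z : ℕ → Ω → S × Icc (-L) L}
  {X : ℕ → Ω → EuclideanSpace ℝ (Fin D)} {Y : ℕ → Ω → ℝ}
  {f : EuclideanSpace ℝ (Fin D) × ℝ → ℝ} {K : EuclideanSpace ℝ (Fin D) → ℝ} {τ : ℕ → ℕ → ℕ}

set_option maxHeartbeats 1000000 in
/-- Uniform deviations of the kernel averages over an `O(h)`-neighbourhood of `𝒳`. -/
lemma exists_measure_uniform_deviation_le (hs : MixingRegression μ α b γ L 𝒳 𝒞S 𝒞Z Z X Y f K τ)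
    {h : ℕ → ℝ} {a κ : ℝ} (hh : AdmissibleBandwidth α D h a) (hκ : 0 < κ)
    (hgrow : ∀ᶠ n : ℕ in atTop, ∀ x : EuclideanSpace ℝ (Fin D),
      𝒞S.SemiLE (fun s => K ((h n)⁻¹ • ((s : EuclideanSpace ℝ (Fin D)) - x))) ((n : ℝ) ^ κ))
    {M : ℝ} (hM0 : 0 < M) (hM : Function.support K ⊆ Metric.closedBall 0 M) :
    ∃ C E : ℝ, 0 ≤ C ∧ 0 ≤ E ∧ ∀ᶠ N : ℕ in atTop,
      μ {ω | ∃ x ∈ 𝒳, ∃ z, ‖z - x‖ ≤ M * h N ∧ ∃ j ≤ 2, C * (h N ^ α * (N * h N ^ D)) <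
        |∑ i ∈ Finset.range N, K ((h N)⁻¹ • (X i ω - z)) * Y i ω ^ j -
          N * h N ^ D * partialMoment f L j x|} ≤ ENNReal.ofReal (E * (N : ℝ) ^ (-2 : ℝ)) := by
  classical
  have hα := hs.α_pos
  have ha := hh.a_pos
  have hL := hs.one_le_L
  have hL0 : 0 < L := by linarith
  obtain ⟨p, hp⟩ : ∃ p, p = 1 / (2 * α + D) := ⟨_, rfl⟩
  have hp0 : 0 < p := by rw [hp]; positivity
  -- The mesh `N^{-e}` is at most `h^{α+D+1}`: after division by `h` in the Lipschitz bound, each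
  -- summand moves by `O(h^α h^D)`.
  obtain ⟨e, he⟩ : ∃ e, e = p * (α + D + 1) := ⟨_, rfl⟩
  have he0 : 0 < e := by rw [he]; positivity
  obtain ⟨R₀, hR₀⟩ := hs.compact.isBounded.exists_norm_le
  obtain ⟨Λ, hΛ⟩ := hs.kernel.lipschitz
  obtain ⟨Cc, hCc0, hcover⟩ := exists_finset_cover hs.D_pos (|R₀| + M) (by positivity)
  -- The power `e D` compensates for the number of grid points and leaves `N⁻²`. The radius `M + 1`
  -- makes room for grid points next to `z`.
  obtain ⟨T, E, hT0, hE0, hdev⟩ := hs.exists_measure_deviation_le hh hκ hgrow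
    (by positivity : 0 ≤ M + 1) (q := e * D + 2) (by positivity)
  obtain ⟨Cb, h₀, hCb0, hh₀, hbias⟩ :=
    hs.toJointDensity.exists_bias_le hs.kernel hM0 hM (M + 1)
  have hlim : Tendsto (fun n : ℕ => (n : ℝ) ^ (-a)) atTop (nhds 0) :=
    (tendsto_rpow_neg_atTop ha).comp tendsto_natCast_atTop_atTop
  refine ⟨Λ * L ^ 2 + T + Cb, 3 * Cc * E, by positivity, by positivity, ?_⟩
  filter_upwards [hdev, hh.eventually, hh.eventually_inv_le hα, hlim.eventually (gt_mem_nhds hh₀),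
    eventually_ge_atTop 1] with N hdevN ⟨h0, h1, _⟩ hinv hsmall hN1
  have hN1' : (1 : ℝ) ≤ N := by exact_mod_cast hN1
  have hN0 : (0 : ℝ) < N := by linarith
  have hh1 : h N ≤ 1 := h1.trans (Real.rpow_le_one_of_one_le_of_nonpos hN1' (by linarith))
  have hD0 : 0 < h N ^ D := by positivity
  have hα0 : 0 < h N ^ α := by positivity
  obtain ⟨δ, hδ⟩ : ∃ δ, δ = (N : ℝ) ^ (-e) := ⟨_, rfl⟩
  have hδ0 : 0 < δ := by rw [hδ]; positivity
  have hδ1 : δ ≤ 1 := by rw [hδ]; exact Real.rpow_le_one_of_one_le_of_nonpos hN1' (by linarith)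
  have hδh : δ ≤ h N ^ α * h N ^ D * h N := by
    have h2 : h N ^ α * h N ^ D * h N = h N ^ (α + D + 1) := by
      rw [Real.rpow_add h0, Real.rpow_add h0, Real.rpow_natCast, Real.rpow_one]
    have h3 : (h N)⁻¹ ^ (α + D + 1) ≤ (N : ℝ) ^ e := by
      rw [he, Real.rpow_mul hN0.le, hp]
      exact Real.rpow_le_rpow (by positivity) hinv (by positivity)
    rw [h2, hδ, Real.rpow_neg hN0.le]
    rw [Real.inv_rpow h0.le] at h3
    exact inv_le_of_inv_le₀ (by positivity) h3
  have hδh' : δ ≤ h N := by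
    have h2 : h N ^ α ≤ 1 := Real.rpow_le_one h0.le hh1 hα.le
    have h3 : h N ^ D ≤ 1 := pow_le_one₀ h0.le hh1
    have h4 : h N ^ α * h N ^ D ≤ 1 := mul_le_one₀ h2 hD0.le h3
    exact hδh.trans (mul_le_of_le_one_left h0.le h4)
  obtain ⟨G, hGcard, hGcover⟩ := hcover δ hδ0 hδ1
  set G' : Finset (EuclideanSpace ℝ (Fin D)) := {y ∈ G | ∃ x ∈ 𝒳, ‖y - x‖ ≤ (M + 1) * h N} with hG'
  set m : ℕ → EuclideanSpace ℝ (Fin D) → ℝ :=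
    fun j y => ∫ ω, K ((h N)⁻¹ • (X 0 ω - y)) * Y 0 ω ^ j ∂μ with hm
  set A : ℕ → EuclideanSpace ℝ (Fin D) → Set Ω := fun j y =>
    {ω | T * (h N ^ α * (N * h N ^ D)) ≤
      |∑ i ∈ Finset.range N, (K ((h N)⁻¹ • (X i ω - y)) * Y i ω ^ j - m j y)|} with hA
  have hAle : ∀ j ≤ 2, ∀ y ∈ G', μ (A j y) ≤ ENNReal.ofReal (E * (N : ℝ) ^ (-(e * D + 2))) := by
    intro j hj y hy
    obtain ⟨x, hx, hyx⟩ := (Finset.mem_filter.1 hy).2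
    rw [← ofReal_measureReal]
    exact ENNReal.ofReal_le_ofReal (hdevN x hx y hyx j hj)
  have hsub : {ω | ∃ x ∈ 𝒳, ∃ z, ‖z - x‖ ≤ M * h N ∧ ∃ j ≤ 2,
      (Λ * L ^ 2 + T + Cb) * (h N ^ α * (N * h N ^ D)) <
        |∑ i ∈ Finset.range N, K ((h N)⁻¹ • (X i ω - z)) * Y i ω ^ j -
          N * h N ^ D * partialMoment f L j x|} ⊆ ⋃ j ∈ Finset.range 3, ⋃ y ∈ G', A j y := by
    rintro ω ⟨x, hx, z, hz, j, hj, hlt⟩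
    have hzR : ‖z‖ ≤ |R₀| + M := by
      have h2 := norm_le_norm_add_norm_sub' z x
      have h3 := (hR₀ x hx).trans (le_abs_self R₀)
      have h4 : M * h N ≤ M := mul_le_of_le_one_right hM0.le hh1
      linarith
    obtain ⟨y, hyG, hyz⟩ := hGcover z hzR
    have hyx : ‖y - x‖ ≤ (M + 1) * h N := by
      have h2 := norm_sub_le_norm_sub_add_norm_sub y z x
      rw [norm_sub_rev] at hyz
      linarith
    have hyG' : y ∈ G' := Finset.mem_filter.2 ⟨hyG, x, hx, hyx⟩
    simp only [Set.mem_iUnion]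
    refine ⟨j, Finset.mem_range.2 (by omega), y, hyG', ?_⟩
    by_contra hnot
    have hnot' : |∑ i ∈ Finset.range N, (K ((h N)⁻¹ • (X i ω - y)) * Y i ω ^ j - m j y)| <
        T * (h N ^ α * (N * h N ^ D)) := not_le.1 hnot
    have b1 : |∑ i ∈ Finset.range N, (K ((h N)⁻¹ • (X i ω - z)) * Y i ω ^ j -
        K ((h N)⁻¹ • (X i ω - y)) * Y i ω ^ j)| ≤ Λ * L ^ 2 * (h N ^ α * (N * h N ^ D)) := by
      calc _ ≤ ∑ i ∈ Finset.range N, |K ((h N)⁻¹ • (X i ω - z)) * Y i ω ^ j -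
            K ((h N)⁻¹ • (X i ω - y)) * Y i ω ^ j| := Finset.abs_sum_le_sum_abs _ _
        _ ≤ ∑ _i ∈ Finset.range N, Λ * (h N ^ α * h N ^ D) * L ^ 2 := by
            refine Finset.sum_le_sum fun i _ => ?_
            rw [← sub_mul, abs_mul]
            refine mul_le_mul ?_ ?_ (abs_nonneg _) (by positivity)
            · have h2 := hΛ.dist_le_mul ((h N)⁻¹ • (X i ω - z)) ((h N)⁻¹ • (X i ω - y))
              rw [Real.dist_eq, dist_eq_norm, ← smul_sub, sub_sub_sub_cancel_left, norm_smul,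
                norm_inv, Real.norm_eq_abs, abs_of_pos h0, norm_sub_rev] at h2
              refine h2.trans (mul_le_mul_of_nonneg_left ?_ Λ.2)
              rw [inv_mul_le_iff₀ h0]
              linarith
            · rw [abs_pow]
              exact (pow_le_pow_left₀ (abs_nonneg _) (abs_le.2 (hs.Y_mem i ω)) j).trans
                (pow_le_pow_right₀ hL hj)
        _ = _ := by rw [Finset.sum_const, Finset.card_range, nsmul_eq_mul]; ring
    have b2 : |N * m j y - N * h N ^ D * partialMoment f L j x| ≤
        Cb * (h N ^ α * (N * h N ^ D)) := by
      have h2 := hbias (h N) h0 (h1.trans hsmall.le) x hx y hyx 0 j hj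
      have h3 : N * m j y - N * h N ^ D * partialMoment f L j x =
          N * (m j y - h N ^ D * partialMoment f L j x) := by ring
      rw [h3, abs_mul, abs_of_pos hN0]
      have := mul_le_mul_of_nonneg_left h2 hN0.le
      linarith
    -- Discretization error, fluctuation at the grid point, and bias relative to the moments at `x`.
    have hsplit : ∑ i ∈ Finset.range N, K ((h N)⁻¹ • (X i ω - z)) * Y i ω ^ j -
        N * h N ^ D * partialMoment f L j x =
        ∑ i ∈ Finset.range N, (K ((h N)⁻¹ • (X i ω - z)) * Y i ω ^ j -
          K ((h N)⁻¹ • (X i ω - y)) * Y i ω ^ j) +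
        ∑ i ∈ Finset.range N, (K ((h N)⁻¹ • (X i ω - y)) * Y i ω ^ j - m j y) +
        (N * m j y - N * h N ^ D * partialMoment f L j x) := by
      rw [Finset.sum_sub_distrib, Finset.sum_sub_distrib, Finset.sum_const, Finset.card_range,
        nsmul_eq_mul]
      ring
    rw [hsplit] at hlt
    have := hlt.trans_le (abs_add_three _ _ _)
    linarith
  refine (measure_mono hsub).trans ?_
  have hcount : μ (⋃ j ∈ Finset.range 3, ⋃ y ∈ G', A j y) ≤
      ∑ _j ∈ Finset.range 3, ∑ _y ∈ G', ENNReal.ofReal (E * (N : ℝ) ^ (-(e * D + 2))) := by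
    refine (measure_biUnion_finset_le _ _).trans (Finset.sum_le_sum fun j hj => ?_)
    refine (measure_biUnion_finset_le _ _).trans (Finset.sum_le_sum fun y hy => ?_)
    exact hAle j (by have := Finset.mem_range.1 hj; omega) y hy
  refine hcount.trans ?_
  have hpos : 0 ≤ E * (N : ℝ) ^ (-(e * D + 2)) := by positivity
  rw [Finset.sum_const, Finset.sum_const, Finset.card_range, nsmul_eq_mul, nsmul_eq_mul,
    ← ENNReal.ofReal_natCast, ← ENNReal.ofReal_natCast, ← ENNReal.ofReal_mul (by positivity),
    ← ENNReal.ofReal_mul (by positivity)]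
  refine ENNReal.ofReal_le_ofReal ?_
  have hG'card : (G'.card : ℝ) ≤ Cc * δ⁻¹ ^ D :=
    (by exact_mod_cast Finset.card_filter_le _ _ : (G'.card : ℝ) ≤ G.card).trans hGcard
  have hpow : δ⁻¹ ^ D * (N : ℝ) ^ (-(e * D + 2)) = (N : ℝ) ^ (-2 : ℝ) := by
    rw [hδ, ← Real.rpow_neg hN0.le, neg_neg, ← Real.rpow_natCast, ← Real.rpow_mul hN0.le,
      ← Real.rpow_add hN0]
    congr 1; ring
  calc ((3 : ℕ) : ℝ) * (G'.card * (E * (N : ℝ) ^ (-(e * D + 2)))) ≤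
        3 * (Cc * δ⁻¹ ^ D * (E * (N : ℝ) ^ (-(e * D + 2)))) := by
        push_cast
        gcongr
    _ = 3 * Cc * E * (δ⁻¹ ^ D * (N : ℝ) ^ (-(e * D + 2))) := by ring
    _ = _ := by rw [hpow]

end MixingRegression

end UniformDeviation

/-! ### From kernel averages to the estimators -/

section Rates

/-- Deterministic error bound for a local average with numerator close to `V g₁` and denominator
close to `V g₀`. -/
lemma abs_div_sub_div_le {s₀ s₁ V g₀ g₁ c d u : ℝ} (hV : 0 < V) (hc : 0 < c) (hg : c ≤ g₀)
    (h0 : |s₀ - V * g₀| ≤ V * d) (h1 : |s₁ - V * g₁| ≤ V * u) (hd : d ≤ c / 2) :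
    V * (c / 2) ≤ s₀ ∧ |s₁ / s₀ - g₁ / g₀| ≤ 2 / c * (u + |g₁ / g₀| * d) := by
  have hg0 : 0 < g₀ := hc.trans_le hg
  have hs : V * (c / 2) ≤ s₀ := by
    have h2 := (abs_le.1 h0).1
    nlinarith [mul_le_mul_of_nonneg_left hd hV.le, mul_le_mul_of_nonneg_left hg hV.le]
  have hs0 : 0 < s₀ := lt_of_lt_of_le (by positivity) hs
  refine ⟨hs, ?_⟩
  set r := g₁ / g₀ with hr
  have hgr : g₁ = r * g₀ := by rw [hr, div_mul_cancel₀ _ hg0.ne']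
  -- Linearization with the random denominator kept, so that only a lower bound on `s₀` is needed.
  have e : s₁ / s₀ - r = ((s₁ - V * g₁) - r * (s₀ - V * g₀)) / s₀ := by
    rw [hgr]; field_simp; ring
  rw [e, abs_div, abs_of_pos hs0, div_le_iff₀ hs0]
  have hnum : |(s₁ - V * g₁) - r * (s₀ - V * g₀)| ≤ V * (u + |r| * d) := by
    refine (abs_sub _ _).trans ?_
    rw [abs_mul]
    have := mul_le_mul_of_nonneg_left h0 (abs_nonneg r)
    linarith
  have hw : 0 ≤ u + |r| * d := by
    have := (abs_nonneg _).trans hnum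
    exact nonneg_of_mul_nonneg_right this hV
  refine hnum.trans ?_
  calc V * (u + |r| * d) = 2 / c * (u + |r| * d) * (V * (c / 2)) := by field_simp
    _ ≤ _ := mul_le_mul_of_nonneg_left hs (by positivity)

/-- A uniform bound failing with probability `O(N⁻²)` holds almost surely and in probability. -/
lemma UnifBigOAS.of_measure_le {Ω E : Type*} [MeasurableSpace Ω] {μ : Measure Ω} {A : Set E}
    {err : ℕ → Ω → E → ℝ} {r : ℕ → ℝ} {C c : ℝ}
    (h : ∀ᶠ N : ℕ in atTop, μ {ω | ∃ x ∈ A, C * r N < |err N ω x|} ≤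
      ENNReal.ofReal (c * (N : ℝ) ^ (-2 : ℝ))) :
    UnifBigOAS μ A err r := by
  obtain ⟨n, hn⟩ := eventually_atTop.1 h
  refine ⟨C, ?_⟩
  have hsum : Summable fun N : ℕ => c * ((N + n : ℕ) : ℝ) ^ (-2 : ℝ) :=
    ((summable_nat_add_iff n).2 (Real.summable_nat_rpow.2 (by norm_num))).mul_left c
  have hne : ∑' N : ℕ, μ {ω | ∃ x ∈ A, C * r (N + n) < |err (N + n) ω x|} ≠ ⊤ := by
    refine ne_top_of_le_ne_top hsum.tsum_ofReal_ne_top (ENNReal.tsum_le_tsum fun N => ?_)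
    exact hn (N + n) (Nat.le_add_left _ _)
  -- Borel–Cantelli.
  filter_upwards [ae_eventually_notMem hne] with ω hω
  obtain ⟨k, hk⟩ := eventually_atTop.1 hω
  refine eventually_atTop.2 ⟨k + n, fun N hN x hx => ?_⟩
  have := hk (N - n) (by omega)
  rw [Nat.sub_add_cancel (by omega)] at this
  by_contra hcon
  exact this ⟨x, hx, not_le.1 hcon⟩

lemma UnifBigOP.of_measure_le {Ω E : Type*} [MeasurableSpace Ω] {μ : Measure Ω} {A : Set E}
    {err : ℕ → Ω → E → ℝ} {r : ℕ → ℝ} {C c : ℝ}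
    (h : ∀ᶠ N : ℕ in atTop, μ {ω | ∃ x ∈ A, C * r N < |err N ω x|} ≤
      ENNReal.ofReal (c * (N : ℝ) ^ (-2 : ℝ))) :
    UnifBigOP μ A err r := by
  intro δ hδ
  refine ⟨C, ?_⟩
  have hlim : Tendsto (fun N : ℕ => c * (N : ℝ) ^ (-2 : ℝ)) atTop (nhds 0) := by
    simpa using ((tendsto_rpow_neg_atTop (by norm_num : (0 : ℝ) < 2)).comp
      tendsto_natCast_atTop_atTop).const_mul c
  filter_upwards [h, hlim.eventually (gt_mem_nhds hδ)] with N h1 h2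
  exact h1.trans (ENNReal.ofReal_le_ofReal h2.le)

namespace MixingRegression

variable {Ω : Type*} [MeasurableSpace Ω] {μ : Measure Ω} [IsProbabilityMeasure μ] {D : ℕ}
  {α b γ L : ℝ} {S 𝒳 : Set (EuclideanSpace ℝ (Fin D))}
  {𝒞S : CSpace S} {𝒞Z : CSpace (S × Icc (-L) L)} {Z : ℕ → Ω → S × Icc (-L) L}
  {X : ℕ → Ω → EuclideanSpace ℝ (Fin D)} {Y : ℕ → Ω → ℝ}
  {f : EuclideanSpace ℝ (Fin D) × ℝ → ℝ} {K : EuclideanSpace ℝ (Fin D) → ℝ} {τ : ℕ → ℕ → ℕ}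

set_option maxHeartbeats 1000000 in
/-- Uniform rates for the local constant estimators of the conditional mean and variance. -/
lemma exists_measure_error_le (hs : MixingRegression μ α b γ L 𝒳 𝒞S 𝒞Z Z X Y f K τ)
    {h : ℕ → ℝ} {a : ℝ} (hh : AdmissibleBandwidth α D h a)
    (hgrow : KernelSeminormGrowth 𝒞S K h)
    (hfX : ∃ c : ℝ, 0 < c ∧ ∀ x ∈ 𝒳, c ≤ margDensity f x) :
    ∃ C E : ℝ, 0 ≤ E ∧ ∀ᶠ N : ℕ in atTop,
      μ {ω | ∃ x ∈ 𝒳, C * h N ^ α < |nadarayaWatson K (h N) N (fun i => X i ω)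
        (fun i => Y i ω) x - condMean f x|} ≤ ENNReal.ofReal (E * (N : ℝ) ^ (-2 : ℝ)) ∧
      μ {ω | ∃ x ∈ 𝒳, C * h N ^ α < |residualVariance K (h N) N (fun i => X i ω)
        (fun i => Y i ω) x - condVar f x|} ≤ ENNReal.ofReal (E * (N : ℝ) ^ (-2 : ℝ)) := by
  obtain ⟨κ, hκ, hgrow⟩ := hgrow
  obtain ⟨M, hM0, hM⟩ := hs.kernel.support_subset
  obtain ⟨C, E, hC0, hE0, hdev⟩ :=
    hs.exists_measure_uniform_deviation_le hh hκ hgrow hM0 hM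
  obtain ⟨c, hc, hcx⟩ := hfX
  obtain ⟨G, hG0, hG⟩ := hs.toJointDensity.abs_partialMoment_le
  have hα := hs.α_pos
  have ha := hh.a_pos
  have hL0 : 0 < L := hs.L_pos
  obtain ⟨r, hr⟩ : ∃ r, r = G / c := ⟨_, rfl⟩
  have hr0 : 0 ≤ r := by rw [hr]; positivity
  obtain ⟨C₁, hC₁⟩ : ∃ C₁, C₁ = 2 / c * (C + r * C) := ⟨_, rfl⟩
  have hC₁0 : 0 ≤ C₁ := by rw [hC₁]; positivity
  obtain ⟨C₂, hC₂⟩ : ∃ C₂, C₂ = C₁ * (2 * L + 2 * r + C₁) := ⟨_, rfl⟩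
  have hC₂0 : 0 ≤ C₂ := by rw [hC₂]; positivity
  obtain ⟨v, hv⟩ : ∃ v, v = (G + 2 * r * G + r ^ 2 * G) / c := ⟨_, rfl⟩
  have hv0 : 0 ≤ v := by rw [hv]; positivity
  obtain ⟨C₃, hC₃⟩ : ∃ C₃, C₃ = 2 / c * (C * (1 + 2 * r + r ^ 2) + v * C) := ⟨_, rfl⟩
  have hC₃0 : 0 ≤ C₃ := by rw [hC₃]; positivity
  have hlim : Tendsto (fun n : ℕ => (n : ℝ) ^ (-(a * α)) * (C + 1)) atTop (nhds 0) := by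
    have := ((tendsto_rpow_neg_atTop (by positivity : 0 < a * α)).comp
      tendsto_natCast_atTop_atTop).mul_const (C + 1)
    simpa using this
  refine ⟨C₁ + C₂ + C₃, E, hE0, ?_⟩
  filter_upwards [hdev, hh.eventually, hlim.eventually (gt_mem_nhds (by positivity : 0 < c / 2)),
    hlim.eventually (gt_mem_nhds one_pos), eventually_ge_atTop 1]
    with N hdevN ⟨h0, h1, _⟩ hN2 hN3 hN1
  have hN1' : (1 : ℝ) ≤ N := by exact_mod_cast hN1
  have hN0 : (0 : ℝ) < N := by linarith
  have hα0 : 0 < h N ^ α := by positivity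
  have hα1 : h N ^ α ≤ (N : ℝ) ^ (-(a * α)) := by
    rw [← neg_mul, Real.rpow_mul hN0.le]
    exact Real.rpow_le_rpow h0.le h1 hα.le
  have hNa : 0 < (N : ℝ) ^ (-(a * α)) := by positivity
  have hCα := mul_le_mul_of_nonneg_right hα1 (by positivity : 0 ≤ C + 1)
  have hd : C * h N ^ α ≤ c / 2 := by linarith
  have hle1 : h N ^ α ≤ 1 := by nlinarith
  set V := N * h N ^ D with hV
  have hV0 : 0 < V := by positivity
  set G₀ : EuclideanSpace ℝ (Fin D) → ℝ := partialMoment f L 0 with hG₀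
  set G₁ : EuclideanSpace ℝ (Fin D) → ℝ := partialMoment f L 1 with hG₁
  set G₂ : EuclideanSpace ℝ (Fin D) → ℝ := partialMoment f L 2 with hG₂
  -- The rest is deterministic on the good event; both estimators share this one event.
  have hgood : ∀ ω, (¬ ∃ x ∈ 𝒳, ∃ z, ‖z - x‖ ≤ M * h N ∧ ∃ j ≤ 2, C * (h N ^ α * V) <
      |∑ i ∈ Finset.range N, K ((h N)⁻¹ • (X i ω - z)) * Y i ω ^ j -
        V * partialMoment f L j x|) → ∀ x ∈ 𝒳,
      |nadarayaWatson K (h N) N (fun i => X i ω) (fun i => Y i ω) x - condMean f x| ≤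
        (C₁ + C₂ + C₃) * h N ^ α ∧
      |residualVariance K (h N) N (fun i => X i ω) (fun i => Y i ω) x - condVar f x| ≤
        (C₁ + C₂ + C₃) * h N ^ α := by
    intro ω hω x hx
    push Not at hω
    set w : EuclideanSpace ℝ (Fin D) → ℕ → ℝ := fun z i => K ((h N)⁻¹ • (X i ω - z)) with hw
    have hw0 : ∀ z i, 0 ≤ w z i := fun z i => hs.kernel.nonneg _
    have hcG : c ≤ G₀ x := by
      rw [hG₀, ← hs.toJointDensity.margDensity_eq hx]; exact hcx x hx
    have hG0pos : 0 < G₀ x := hc.trans_le hcG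
    set θ := condMean f x with hθ
    have hθeq : θ = G₁ x / G₀ x := hs.toJointDensity.condMean_eq hx
    have hθr : |θ| ≤ r := by
      rw [hθeq, abs_div, abs_of_pos hG0pos, hr]
      exact div_le_div₀ hG0 (hG x hx 1 (by norm_num)) hc hcG
    have hsum0 : ∀ z, ‖z - x‖ ≤ M * h N →
        |∑ i ∈ Finset.range N, w z i - V * G₀ x| ≤ V * (C * h N ^ α) := fun z hz => by
      have := hω x hx z hz 0 (by norm_num)
      simp only [pow_zero, mul_one] at this
      linarith
    have hsum1 : ∀ z, ‖z - x‖ ≤ M * h N →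
        |∑ i ∈ Finset.range N, w z i * Y i ω - V * G₁ x| ≤ V * (C * h N ^ α) := fun z hz => by
      have := hω x hx z hz 1 (by norm_num)
      simp only [pow_one] at this
      linarith
    -- The estimator at `z` is compared with the conditional mean at `x`, not at `z`; `z` may lie
    -- outside `𝒳`.
    have hmean : ∀ z, ‖z - x‖ ≤ M * h N →
        |nadarayaWatson K (h N) N (fun i => X i ω) (fun i => Y i ω) z - θ| ≤ C₁ * h N ^ α := by
      intro z hz
      have key := (abs_div_sub_div_le hV0 hc hcG (hsum0 z hz) (hsum1 z hz) hd).2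
      rw [← hθeq] at key
      refine key.trans ?_
      have : |θ| * (C * h N ^ α) ≤ r * (C * h N ^ α) :=
        mul_le_mul_of_nonneg_right hθr (by positivity)
      calc 2 / c * (C * h N ^ α + |θ| * (C * h N ^ α)) ≤
            2 / c * (C * h N ^ α + r * (C * h N ^ α)) := by gcongr
        _ = _ := by rw [hC₁]; ring
    have hxx : ‖x - x‖ ≤ M * h N := by rw [sub_self, norm_zero]; positivity
    refine ⟨(hmean x hxx).trans (mul_le_mul_of_nonneg_right (by linarith) hα0.le), ?_⟩
    have hsum2 : |∑ i ∈ Finset.range N, w x i * Y i ω ^ 2 - V * G₂ x| ≤ V * (C * h N ^ α) := by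
      have := hω x hx x hxx 2 le_rfl
      linarith
    have hcent : |∑ i ∈ Finset.range N, w x i * (Y i ω - θ) ^ 2 -
        V * (G₂ x - 2 * θ * G₁ x + θ ^ 2 * G₀ x)| ≤
        V * (C * (1 + 2 * r + r ^ 2) * h N ^ α) := by
      have e : ∑ i ∈ Finset.range N, w x i * (Y i ω - θ) ^ 2 -
          V * (G₂ x - 2 * θ * G₁ x + θ ^ 2 * G₀ x) =
          (∑ i ∈ Finset.range N, w x i * Y i ω ^ 2 - V * G₂ x) +
          (-(2 * θ)) * (∑ i ∈ Finset.range N, w x i * Y i ω - V * G₁ x) +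
          θ ^ 2 * (∑ i ∈ Finset.range N, w x i - V * G₀ x) := by
        have e' : ∑ i ∈ Finset.range N, w x i * (Y i ω - θ) ^ 2 =
            ∑ i ∈ Finset.range N, w x i * Y i ω ^ 2 -
            2 * θ * ∑ i ∈ Finset.range N, w x i * Y i ω +
            θ ^ 2 * ∑ i ∈ Finset.range N, w x i := by
          rw [Finset.mul_sum, Finset.mul_sum, ← Finset.sum_sub_distrib, ← Finset.sum_add_distrib]
          exact Finset.sum_congr rfl fun i _ => by ring
        rw [e']; ring
      rw [e]
      refine (abs_add_three _ _ _).trans ?_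
      rw [abs_mul, abs_mul, abs_neg, abs_mul, abs_two, abs_pow]
      have t1 : 2 * |θ| * |∑ i ∈ Finset.range N, w x i * Y i ω - V * G₁ x| ≤
          2 * r * (V * (C * h N ^ α)) :=
        mul_le_mul (by linarith) (hsum1 x hxx) (abs_nonneg _) (by positivity)
      have t2 : |θ| ^ 2 * |∑ i ∈ Finset.range N, w x i - V * G₀ x| ≤ r ^ 2 * (V * (C * h N ^ α)) :=
        mul_le_mul (pow_le_pow_left₀ (abs_nonneg _) hθr 2) (hsum0 x hxx) (abs_nonneg _)
          (by positivity)
      linarith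
    obtain ⟨hden, hvar⟩ := abs_div_sub_div_le hV0 hc hcG (hsum0 x hxx) hcent hd
    have hden0 : 0 < ∑ i ∈ Finset.range N, w x i := lt_of_lt_of_le (by positivity) hden
    rw [← hs.toJointDensity.condVar_eq hx] at hvar
    have hvv : |condVar f x| ≤ v := by
      rw [hs.toJointDensity.condVar_eq hx, abs_div, abs_of_pos hG0pos, hv]
      refine div_le_div₀ (by positivity) ?_ hc hcG
      have g0 := hG x hx 0 (by norm_num)
      have g1 := hG x hx 1 (by norm_num)
      have g2 := hG x hx 2 (by norm_num)
      calc |G₂ x - 2 * θ * G₁ x + θ ^ 2 * G₀ x| ≤ |G₂ x| + 2 * |θ| * |G₁ x| + |θ| ^ 2 * |G₀ x| := by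
            refine (abs_add_le _ _).trans (add_le_add ((abs_sub _ _).trans (le_of_eq ?_)) (le_of_eq ?_))
            · rw [abs_mul, abs_mul, abs_two]
            · rw [abs_mul, abs_pow]
        _ ≤ _ := by gcongr
    -- Residuals around the estimated mean are replaced by residuals around the constant `θ`. Only
    -- indices with non-zero kernel weight count, and for them `X i ω` is within `M h` of `x`, so
    -- `hmean` applies.
    have hres : |∑ i ∈ Finset.range N, w x i * (Y i ω - nadarayaWatson K (h N) N (fun i => X i ω)
          (fun i => Y i ω) (X i ω)) ^ 2 - ∑ i ∈ Finset.range N, w x i * (Y i ω - θ) ^ 2| ≤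
        C₂ * h N ^ α * ∑ i ∈ Finset.range N, w x i := by
      rw [← Finset.sum_sub_distrib, Finset.mul_sum]
      refine (Finset.abs_sum_le_sum_abs _ _).trans (Finset.sum_le_sum fun i _ => ?_)
      by_cases hwi : w x i = 0
      · rw [hwi]; simp
      have hXi : ‖X i ω - x‖ ≤ M * h N := by
        have h2 : (h N)⁻¹ • (X i ω - x) ∈ Metric.closedBall 0 M := hM hwi
        rw [mem_closedBall_zero_iff, norm_smul, norm_inv, Real.norm_eq_abs, abs_of_pos h0,
          inv_mul_le_iff₀ h0] at h2
        linarith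
      have hm := hmean (X i ω) hXi
      set η := nadarayaWatson K (h N) N (fun i => X i ω) (fun i => Y i ω) (X i ω) with hη
      have hY : |Y i ω| ≤ L := abs_le.2 (hs.Y_mem i ω)
      have e : w x i * (Y i ω - η) ^ 2 - w x i * (Y i ω - θ) ^ 2 =
          w x i * ((η - θ) * ((η - θ) + 2 * θ - 2 * Y i ω)) := by ring
      rw [e, abs_mul, abs_of_nonneg (hw0 x i), mul_comm _ (w x i), abs_mul]
      refine mul_le_mul_of_nonneg_left ?_ (hw0 x i)
      have hb : |(η - θ) + 2 * θ - 2 * Y i ω| ≤ 2 * L + 2 * r + C₁ := by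
        have hη1 : |η - θ| ≤ C₁ := hm.trans (mul_le_of_le_one_right hC₁0 hle1)
        have a1 := abs_le.1 hη1
        have a2 := abs_le.1 hθr
        have a3 := abs_le.1 hY
        rw [abs_le]
        constructor <;> linarith [a1.1, a1.2, a2.1, a2.2, a3.1, a3.2]
      calc |η - θ| * |(η - θ) + 2 * θ - 2 * Y i ω| ≤ C₁ * h N ^ α * (2 * L + 2 * r + C₁) :=
            mul_le_mul hm hb (abs_nonneg _) (by positivity)
        _ = _ := by rw [hC₂]; ring
    have hdiff : |residualVariance K (h N) N (fun i => X i ω) (fun i => Y i ω) x -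
        (∑ i ∈ Finset.range N, w x i * (Y i ω - θ) ^ 2) / ∑ i ∈ Finset.range N, w x i| ≤
        C₂ * h N ^ α := by
      rw [residualVariance, nadarayaWatson, ← sub_div, abs_div, abs_of_pos hden0,
        div_le_iff₀ hden0]
      exact hres
    have hvar' : 2 / c * (C * (1 + 2 * r + r ^ 2) * h N ^ α + |condVar f x| * (C * h N ^ α)) ≤
        C₃ * h N ^ α := by
      calc _ ≤ 2 / c * (C * (1 + 2 * r + r ^ 2) * h N ^ α + v * (C * h N ^ α)) := by gcongr
        _ = _ := by rw [hC₃]; ring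
    have htri := abs_sub_le (residualVariance K (h N) N (fun i => X i ω) (fun i => Y i ω) x)
      ((∑ i ∈ Finset.range N, w x i * (Y i ω - θ) ^ 2) / ∑ i ∈ Finset.range N, w x i) (condVar f x)
    have hpos : 0 ≤ C₁ * h N ^ α := by positivity
    linarith
  constructor
  · refine (measure_mono fun ω hω => ?_).trans hdevN
    by_contra hcon
    obtain ⟨x, hx, hlt⟩ := hω
    exact absurd ((hgood ω hcon x hx).1) (not_le.2 hlt)
  · refine (measure_mono fun ω hω => ?_).trans hdevN
    by_contra hcon
    obtain ⟨x, hx, hlt⟩ := hω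
    exact absurd ((hgood ω hcon x hx).2) (not_le.2 hlt)

end MixingRegression

end Rates

/-! ### The two bandwidths -/

section Bandwidths

/-- Here `N h^{2α+D}` equals `(log N)^q`, which is at least `log N` because `q ≥ 1`. The upper bound
follows from `(log N)^q ≤ N^{1/2}` for large `N`, whence half the exponent. -/
lemma admissibleBandwidth_rpow {α : ℝ} (hα : 0 < α) (D : ℕ) {q : ℝ} (hq : 1 ≤ q) :
    AdmissibleBandwidth α D (fun N => (Real.log N ^ q / N) ^ (1 / (2 * α + D)))
      (1 / 2 * (1 / (2 * α + D))) := by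
  have hp : 0 < 2 * α + D := by positivity
  refine ⟨by positivity, ?_⟩
  have hlog := ((isLittleO_log_rpow_rpow_atTop q (by norm_num : (0 : ℝ) < 1 / 2)).bound
    one_pos).natCast_atTop
  filter_upwards [hlog, eventually_ge_atTop 3] with N h1 h3
  have hN : (3 : ℝ) ≤ N := by exact_mod_cast h3
  have hN0 : (0 : ℝ) < N := by linarith
  have hl : 1 ≤ Real.log N := by
    rw [Real.le_log_iff_exp_le hN0]
    linarith [Real.exp_one_lt_d9]
  have hl0 : 0 < Real.log N := by linarith
  refine ⟨by positivity, ?_, ?_⟩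
  · rw [← neg_mul, Real.rpow_mul hN0.le]
    refine Real.rpow_le_rpow (by positivity) ?_ (by positivity)
    rw [one_mul, Real.norm_eq_abs, Real.norm_eq_abs, abs_of_pos (by positivity),
      abs_of_pos (by positivity)] at h1
    rw [div_le_iff₀ hN0]
    refine h1.trans (le_of_eq ?_)
    rw [← Real.rpow_add_one hN0.ne']
    norm_num
  · rw [← Real.rpow_mul (by positivity), one_div_mul_cancel hp.ne', Real.rpow_one,
      mul_div_cancel₀ _ hN0.ne']
    exact Real.self_le_rpow_of_one_le hl hq

lemma rpow_bandwidth_rpow {α p q : ℝ} (N : ℕ) :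
    ((Real.log N ^ q / N) ^ (1 / p)) ^ α = (Real.log N ^ q / N) ^ (α / p) := by
  have : 0 ≤ Real.log N := Real.log_natCast_nonneg N
  rw [← Real.rpow_mul (by positivity)]
  congr 1
  ring

lemma rateP_eq (s : ℝ) : rateP s = fun N : ℕ => (Real.log N ^ (1 : ℝ) / N) ^ s := by
  ext N
  rw [rateP, Real.rpow_one]

end Bandwidths

/-! ### The theorem -/

theorem mainTheorem7 {Ω : Type*} [MeasurableSpace Ω] (μ : Measure Ω) [IsProbabilityMeasure μ]
    (D : ℕ) (hD : 0 < D) (α b γ L : ℝ) (hα : 0 < α) (hb : 0 < b) (hγ : 0 < γ) (hL : 1 < L)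
    -- `S` is the state space of the regressors, `𝒳` the compact set of estimation points
    (S 𝒳 : Set (EuclideanSpace ℝ (Fin D))) (h𝒳 : IsCompact 𝒳) (h𝒳S : 𝒳 ⊆ S)
    (𝒞S : CSpace S) (𝒞Z : CSpace (S × Icc (-L) L)) (h𝒞 : SeminormAssumptions 𝒞S 𝒞Z)
    -- the process `Z i = (X i, Y i)`, geometrically (time-reversed) `𝒞`-mixing
    (Z : ℕ → Ω → S × Icc (-L) L) (X : ℕ → Ω → EuclideanSpace ℝ (Fin D)) (Y : ℕ → Ω → ℝ)
    (hX : ∀ i ω, X i ω = ((Z i ω).1 : EuclideanSpace ℝ (Fin D)))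
    (hY : ∀ i ω, Y i ω = ((Z i ω).2 : ℝ))
    (hZ : ∀ i, Measurable (Z i))
    (hmix : GeomCMixing μ 𝒞Z b γ Z ∨ GeomCMixingReversed μ 𝒞Z b γ Z)
    -- common joint density
    (f : EuclideanSpace ℝ (Fin D) × ℝ → ℝ) (hf : Measurable f) (hf0 : ∀ p, 0 ≤ f p)
    (hlaw : ∀ i, μ.map (fun ω => (X i ω, Y i ω)) =
      (volume : Measure (EuclideanSpace ℝ (Fin D) × ℝ)).withDensity
        (fun p => ENNReal.ofReal (f p)))
    (hfα : UnifHolderControllableOn α (𝒳 ×ˢ (univ : Set ℝ)) f)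
    (hfXα : UnifHolderControllableOn α 𝒳 (margDensity f))
    (hfX : ∃ c : ℝ, 0 < c ∧ ∀ x ∈ 𝒳, c ≤ margDensity f x)
    -- heteroscedastic regression model; on `𝒳`, `m` and `σ ^ 2` are the versions of the conditional
    -- mean and variance given by the joint density
    (m σ : EuclideanSpace ℝ (Fin D) → ℝ) (ε : ℕ → Ω → ℝ) (hε : ∀ i, Measurable (ε i))
    (hε2 : ∀ i, Integrable (fun ω => ε i ω ^ 2) μ)
    (hmodel : ∀ i, ∀ᵐ ω ∂μ, Y i ω = m (X i ω) + σ (X i ω) * ε i ω)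
    (hεmean : ∀ i, μ[ε i | MeasurableSpace.comap (X i) inferInstance] =ᵐ[μ] fun _ => 0)
    (hεvar : ∀ i, μ[fun ω => ε i ω ^ 2 | MeasurableSpace.comap (X i) inferInstance]
      =ᵐ[μ] fun _ => 1)
    (hm : ∀ x ∈ 𝒳, m x = condMean f x) (hσ : ∀ x ∈ 𝒳, σ x ^ 2 = condVar f x)
    (K : EuclideanSpace ℝ (Fin D) → ℝ) (hK : KernelAssumptions α K) :
    -- bandwidth `((log N)^((γ+1)/γ) / N)^(1/(2α+D))`
    (KernelSeminormGrowth 𝒞S K (rateAS γ (1 / (2 * α + D))) →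
      UnifBigOAS μ 𝒳
        (fun N ω x => nadarayaWatson K (rateAS γ (1 / (2 * α + D)) N) N
          (fun i => X i ω) (fun i => Y i ω) x - m x)
        (rateAS γ (α / (2 * α + D))) ∧
      (UnifHolderControllableOn α 𝒳 m →
        UnifBigOAS μ 𝒳
          (fun N ω x => residualVariance K (rateAS γ (1 / (2 * α + D)) N) N
            (fun i => X i ω) (fun i => Y i ω) x - σ x ^ 2)
          (rateAS γ (α / (2 * α + D))))) ∧
    -- bandwidth `(log N / N)^(1/(2α+D))`
    (KernelSeminormGrowth 𝒞S K (rateP (1 / (2 * α + D))) →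
      UnifBigOP μ 𝒳
        (fun N ω x => nadarayaWatson K (rateP (1 / (2 * α + D)) N) N
          (fun i => X i ω) (fun i => Y i ω) x - m x)
        (rateP (α / (2 * α + D))) ∧
      (UnifHolderControllableOn α 𝒳 m →
        UnifBigOP μ 𝒳
          (fun N ω x => residualVariance K (rateP (1 / (2 * α + D)) N) N
            (fun i => X i ω) (fun i => Y i ω) x - σ x ^ 2)
          (rateP (α / (2 * α + D))))) := by
  have hL0 : 0 < L := by linarith
  have hXm : ∀ i, Measurable (X i) := fun i => by
    rw [show X i = fun ω => ((Z i ω).1 : EuclideanSpace ℝ (Fin D)) from funext (hX i)]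
    exact measurable_subtype_coe.comp (measurable_fst.comp (hZ i))
  have hYm : ∀ i, Measurable (Y i) := fun i => by
    rw [show Y i = fun ω => ((Z i ω).2 : ℝ) from funext (hY i)]
    exact measurable_subtype_coe.comp (measurable_snd.comp (hZ i))
  have hdens : JointDensity μ α L 𝒳 X Y f :=
    ⟨hα, hL0, h𝒳, hXm, hYm, fun i ω => by rw [hY]; exact (Z i ω).2.2, hf, hf0, hlaw, hfα⟩
  -- Identity for mixing, reflection of the window for time-reversed mixing; from here on the two
  -- cases coincide.
  obtain ⟨τ, hs⟩ : ∃ τ : ℕ → ℕ → ℕ, MixingRegression μ α b γ L 𝒳 𝒞S 𝒞Z Z X Y f K τ := by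
    rcases hmix with hmix | hmix
    · exact ⟨fun _ i => i, hdens, hD, hb, hγ, hL.le, hX, hY, hZ, h𝒞, hK,
        hmix.windowMixing hb hγ hZ, fun _ _ => rfl⟩
    · exact ⟨fun N i => N - 1 - i, hdens, hD, hb, hγ, hL.le, hX, hY, hZ, h𝒞, hK,
        hmix.windowMixing hb hγ hZ, fun N x => Finset.sum_range_reflect x N⟩
  -- One statement for both bandwidths: `q = (γ + 1) / γ` for the almost sure rate and `q = 1` for
  -- the rate in probability.
  have key : ∀ q : ℝ, 1 ≤ q → ∀ h r : ℕ → ℝ,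
      h = (fun N : ℕ => (Real.log N ^ q / N) ^ (1 / (2 * α + D))) →
      r = (fun N : ℕ => (Real.log N ^ q / N) ^ (α / (2 * α + D))) →
      KernelSeminormGrowth 𝒞S K h → ∃ C E : ℝ, ∀ᶠ N : ℕ in atTop,
        μ {ω | ∃ x ∈ 𝒳, C * r N < |nadarayaWatson K (h N) N (fun i => X i ω)
          (fun i => Y i ω) x - m x|} ≤ ENNReal.ofReal (E * (N : ℝ) ^ (-2 : ℝ)) ∧
        μ {ω | ∃ x ∈ 𝒳, C * r N < |residualVariance K (h N) N (fun i => X i ω)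
          (fun i => Y i ω) x - σ x ^ 2|} ≤ ENNReal.ofReal (E * (N : ℝ) ^ (-2 : ℝ)) := by
    rintro q hq h r rfl rfl hgrow
    obtain ⟨C, E, -, hev⟩ :=
      hs.exists_measure_error_le (admissibleBandwidth_rpow hα D hq) hgrow hfX
    refine ⟨C, E, hev.mono fun N hN => ⟨?_, ?_⟩⟩
    · refine (measure_mono fun ω hω => ?_).trans hN.1
      obtain ⟨x, hx, hlt⟩ := hω
      refine ⟨x, hx, ?_⟩
      rw [rpow_bandwidth_rpow, ← hm x hx]
      exact hlt
    · refine (measure_mono fun ω hω => ?_).trans hN.2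
      obtain ⟨x, hx, hlt⟩ := hω
      refine ⟨x, hx, ?_⟩
      rw [rpow_bandwidth_rpow, ← hσ x hx]
      exact hlt
  constructor
  · intro hgrow
    have hq : 1 ≤ (γ + 1) / γ := by rw [le_div_iff₀ hγ]; linarith
    obtain ⟨C, E, hev⟩ := key _ hq _ (rateAS γ (α / (2 * α + D))) rfl rfl hgrow
    exact ⟨UnifBigOAS.of_measure_le (hev.mono fun N hN => hN.1),
      fun _ => UnifBigOAS.of_measure_le (hev.mono fun N hN => hN.2)⟩
  · intro hgrow
    obtain ⟨C, E, hev⟩ := key 1 le_rfl _ (rateP (α / (2 * α + D))) (rateP_eq _) (rateP_eq _) hgrow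
    exact ⟨UnifBigOP.of_measure_le (hev.mono fun N hN => hN.1),
      fun _ => UnifBigOP.of_measure_le (hev.mono fun N hN => hN.2)⟩
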